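/- **Definitions.** All graphs are finite, undirected and simple. A matching cut of a graph $G$ is an edge set $M=E_G(A,B)$, for a partition $\{A,B\}$ of $V(G)$ into two nonempty parts, in which no two edges share an end-vertex ($M=\emptyset$ is allowed); it is minimal if no proper subset of $M$ is a matching cut of $G$. The feedback edge number ${\sf fn}(G)$ is the least number of edges whose deletion turns $G$ into a forest. A parameterized enumeration problem over a finite alphabet $\Sigma$ assigns to every instance $x\in\Sigma^*$ a finite set ${\sf Sol}(x)\subseteq\Sigma^*$ of solutions and a parameter $\kappa(x)\in\mathbb N$. A polynomial-delay enumeration kernel is a pair of algorithms $\mathcal A$, $\mathcal A'$ such that * (i) for every instance $x$, $\mathcal A$ computes in time polynomial in $|x|+\kappa(x)$ an instance $y$ with $|y|+\kappa(y)\le f(\kappa(x))$, where $f$ is a computable function; * (ii) for every $x$, with $y$ as in (i), and every $s\in{\sf Sol}(y)$, $\mathcal A'$ enumerates from $x$, $y$ and $s$, without repetition and with delay polynomial in $|x|+|y|+\kappa(x)+\kappa(y)$ (including the time before the first and after the last output), a nonempty set $S_s\subseteq{\sf Sol}(x)$, such that the sets $S_s$, $s\in{\sf Sol}(y)$, are pairwise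 disjoint and have union ${\sf Sol}(x)$. The kernel is fully-polynomial if $\mathcal A'$ even computes every $S_s$ in total time polynomial in $|x|+|y|+\kappa(x)+\kappa(y)$. Enum Minimal MC, parameterized by the feedback edge number, is the problem whose instances are (encodings of) graphs $G$, whose solutions are the minimal matching cuts of $G$, and whose parameter is $k={\sf fn}(G)$. **Theorem 5.6.** Enum Minimal MC, parameterized by the feedback edge number $k$ of the input graph, admits a polynomial-delay enumeration kernel with $\mathcal O(k)$ vertices: there is a constant $c$ such that for every graph $G$ the instance computed by $\mathcal A$ is a graph with at most $c\,({\sf fn}(G)+1)$ vertices. It does not admit a fully-polynomial enumeration kernel (of any size). -/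

import Mathlib

/-! ## The machine model: random access machines with a step count

Programs are structured programs of a random access machine with the operations `+` and truncated
`-`, at unit cost.  There is no multiplication, so the binary length of every number in the memory
grows at most linearly with the running time; the model is therefore polynomially equivalent to
Turing machines. -/

namespace RAM

/-- The memory: registers `reg v` and arrays `arr a`, all holding natural numbers. -/
structure State where
  reg : ℕ → ℕ
  arr : ℕ → ℕ → ℕ

/-- Expressions: constants, registers, array cells `arr[a][i]`, sums, truncated differences. -/
inductive Expr where
  | lit (c : ℕ)
  | reg (v : ℕ)
  | cell (a i : Expr)
  | plus (e₁ e₂ : Expr)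
  | minus (e₁ e₂ : Expr)

/-- The value of an expression. -/
def Expr.eval (σ : State) : Expr → ℕ
  | .lit c => c
  | .reg v => σ.reg v
  | .cell a i => σ.arr (a.eval σ) (i.eval σ)
  | .plus e₁ e₂ => e₁.eval σ + e₂.eval σ
  | .minus e₁ e₂ => e₁.eval σ - e₂.eval σ

/-- Programs.  A test succeeds if its expression is not zero. `emit a l` outputs the binary
string stored in the first `l` cells of the array `a` (a cell that is not zero is the bit 1). -/
inductive Prog where
  | skip
  | assign (v : ℕ) (e : Expr)
  | store (a i e : Expr)
  | emit (a l : Expr)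
  | seq (p q : Prog)
  | ite (e : Expr) (p q : Prog)
  | loop (e : Expr) (p : Prog)

/-- What can be observed of a computation: elementary steps, and strings that are output. -/
inductive Event where
  | tick
  | out (w : List Bool)

/-- The state after `reg[v] := c`. -/
def State.setReg (σ : State) (v c : ℕ) : State :=
  { σ with reg := Function.update σ.reg v c }

/-- The state after `arr[a][i] := c`. -/
def State.setCell (σ : State) (a i c : ℕ) : State :=
  { σ with arr := Function.update σ.arr a (Function.update (σ.arr a) i c) }

/-- The binary string in the first `l` cells of the array `a`. -/
def State.word (σ : State) (a l : ℕ) : List Bool :=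
  (List.range l).map fun i => decide (σ.arr a i ≠ 0)

/-- `Exec p σ τ σ'`: the program `p`, started in `σ`, halts in `σ'`, and `τ` lists in order all its
steps and outputs.  Each elementary instruction and each test is a step; writing a string takes one
step more than its length. -/
inductive Exec : Prog → State → List Event → State → Prop where
  | skip (σ) : Exec .skip σ [.tick] σ
  | assign (v e σ) : Exec (.assign v e) σ [.tick] (σ.setReg v (e.eval σ))
  | store (a i e σ) :
      Exec (.store a i e) σ [.tick] (σ.setCell (a.eval σ) (i.eval σ) (e.eval σ))
  | emit (a l σ) :
      Exec (.emit a l) σ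
        (List.replicate (l.eval σ + 1) .tick ++ [.out (σ.word (a.eval σ) (l.eval σ))]) σ
  | seq {p q σ₁ σ₂ σ₃ τ₁ τ₂} :
      Exec p σ₁ τ₁ σ₂ → Exec q σ₂ τ₂ σ₃ → Exec (.seq p q) σ₁ (τ₁ ++ τ₂) σ₃
  | ite_true {e p q σ σ' τ} :
      e.eval σ ≠ 0 → Exec p σ τ σ' → Exec (.ite e p q) σ (.tick :: τ) σ'
  | ite_false {e p q σ σ' τ} :
      e.eval σ = 0 → Exec q σ τ σ' → Exec (.ite e p q) σ (.tick :: τ) σ'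
  | loop_true {e p σ₁ σ₂ σ₃ τ₁ τ₂} :
      e.eval σ₁ ≠ 0 → Exec p σ₁ τ₁ σ₂ → Exec (.loop e p) σ₂ τ₂ σ₃ →
        Exec (.loop e p) σ₁ (.tick :: (τ₁ ++ τ₂)) σ₃
  | loop_false {e p σ} : e.eval σ = 0 → Exec (.loop e p) σ [.tick] σ

/-- The start state for a list of binary strings: the `i`-th string is in the array `i` and its
length in the register `i`; everything else is zero. -/
def start (ws : List (List Bool)) : State where
  reg i := (ws.getD i []).length
  arr i j := ((ws.getD i []).getD j false).toNat

/-- On the input strings `ws` the program halts, with the steps and outputs `τ`. -/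
def Prog.Run (p : Prog) (ws : List (List Bool)) (τ : List Event) : Prop :=
  ∃ σ, Exec p (start ws) τ σ

/-- The output strings, in order. -/
def outputs : List Event → List (List Bool)
  | [] => []
  | .tick :: τ => outputs τ
  | .out w :: τ => w :: outputs τ

/-- The number of steps. -/
def time : List Event → ℕ
  | [] => 0
  | .tick :: τ => time τ + 1
  | .out _ :: τ => time τ

/-- The numbers of steps before the first output, between consecutive outputs and after the last
output, if `d` steps have been made already since the previous output. -/
def delaysFrom (d : ℕ) : List Event → List ℕ
  | [] => [d]
  | .tick :: τ => delaysFrom (d + 1) τ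
  | .out _ :: τ => d :: delaysFrom 0 τ

/-- All delays of a computation, the precalculation and the postcalculation time included. -/
def delays (τ : List Event) : List ℕ := delaysFrom 0 τ

end RAM

/-! ## Parameterized enumeration problems and enumeration kernels -/

/-- A parameterized enumeration problem over the alphabet `{0, 1}`: each string `x` is an instance
with a finite set `Sol x` of solutions and a parameter `κ x`.  The language of the problem is
`{x | (Sol x).Nonempty}`. -/
structure ParamEnumProblem where
  Sol : List Bool → Set (List Bool)
  finite_Sol : ∀ x, (Sol x).Finite
  κ : List Bool → ℕ

/-- The program `A` computes the map `K` in time polynomial in `|x| + κ(x)`, and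
`|K x| + κ(K x) ≤ f(κ(x))` for a computable function `f`. -/
structure IsKernelization (P : ParamEnumProblem) (A : RAM.Prog) (K : List Bool → List Bool) :
    Prop where
  poly_time : ∃ p : Polynomial ℕ, ∀ x, ∃ τ, A.Run [x] τ ∧ RAM.outputs τ = [K x] ∧
    RAM.time τ ≤ p.eval (x.length + P.κ x)
  size_le : ∃ f : ℕ → ℕ, Computable f ∧ ∀ x, (K x).length + P.κ (K x) ≤ f (P.κ x)

/-- The sets `S s`, for `s` in `Y`, are the classes of a partition of `X`. -/
structure IsPartitionBy (Y X : Set (List Bool)) (S : List Bool → Set (List Bool)) : Prop where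
  nonempty : ∀ s ∈ Y, (S s).Nonempty
  disjoint : ∀ s ∈ Y, ∀ t ∈ Y, s ≠ t → Disjoint (S s) (S t)
  union : ⋃ s ∈ Y, S s = X

/-- A fully-polynomial enumeration kernel: `A` is the kernelization algorithm, `K` the map that it
computes, and `A'` the solution-lifting algorithm, which computes `S x s` from `x`, `K x` and a
solution `s` of `K x` in polynomial time. -/
structure IsFullyPolyEnumKernel (P : ParamEnumProblem) (A A' : RAM.Prog)
    (K : List Bool → List Bool) : Prop where
  kernelization : IsKernelization P A K
  lifting : ∃ S : List Bool → List Bool → Set (List Bool),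
    (∀ x, IsPartitionBy (P.Sol (K x)) (P.Sol x) (S x)) ∧
    ∃ p : Polynomial ℕ, ∀ x, ∀ s ∈ P.Sol (K x), ∃ τ, A'.Run [x, K x, s] τ ∧
      {w | w ∈ RAM.outputs τ} = S x s ∧
      RAM.time τ ≤ p.eval (x.length + (K x).length + P.κ x + P.κ (K x))

/-- A polynomial-delay enumeration kernel: the same, but `A'` enumerates `S x s` without repetition
and with polynomial delay. -/
structure IsPolyDelayEnumKernel (P : ParamEnumProblem) (A A' : RAM.Prog)
    (K : List Bool → List Bool) : Prop where
  kernelization : IsKernelization P A K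
  lifting : ∃ S : List Bool → List Bool → Set (List Bool),
    (∀ x, IsPartitionBy (P.Sol (K x)) (P.Sol x) (S x)) ∧
    ∃ p : Polynomial ℕ, ∀ x, ∀ s ∈ P.Sol (K x), ∃ τ, A'.Run [x, K x, s] τ ∧
      (RAM.outputs τ).Nodup ∧ {w | w ∈ RAM.outputs τ} = S x s ∧
      ∀ d ∈ RAM.delays τ, d ≤ p.eval (x.length + (K x).length + P.κ x + P.κ (K x))

/-! ## Matching cuts and the feedback edge number -/

namespace SimpleGraph

variable {V : Type*}

/-- The set of edges with one end in `A` and the other one outside `A`. -/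
def cutEdges (G : SimpleGraph V) (A : Set V) : Set (Sym2 V) :=
  {e | ∃ u ∈ A, ∃ v ∉ A, G.Adj u v ∧ e = s(u, v)}

/-- A matching cut: the set of edges between the two (nonempty) parts of a partition of the vertex
set, if no two of these edges have a common end. -/
def IsMatchingCut (G : SimpleGraph V) (M : Set (Sym2 V)) : Prop :=
  (∃ A : Set V, A.Nonempty ∧ Aᶜ.Nonempty ∧ M = G.cutEdges A) ∧
    ∀ e ∈ M, ∀ f ∈ M, ∀ v, v ∈ e → v ∈ f → e = f

/-- An inclusion minimal matching cut. -/
def IsMinimalMatchingCut (G : SimpleGraph V) (M : Set (Sym2 V)) : Prop :=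
  Minimal G.IsMatchingCut M

/-- The minimum number of edges whose deletion leaves a forest. -/
noncomputable def feedbackEdgeNumber (G : SimpleGraph V) : ℕ :=
  sInf {k | ∃ S : Finset (Sym2 V), (S : Set (Sym2 V)) ⊆ G.edgeSet ∧
    (G.deleteEdges (S : Set (Sym2 V))).IsAcyclic ∧ S.card = k}

open Classical in
/-- A graph with the vertices `0, …, n - 1` as a binary string: its adjacency matrix, row by
row. -/
noncomputable def encode {n : ℕ} (G : SimpleGraph (Fin n)) : List Bool :=
  List.ofFn fun p : Fin (n * n) => decide (G.Adj p.divNat p.modNat)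

theorem length_encode {n : ℕ} (G : SimpleGraph (Fin n)) : G.encode.length = n * n := by
  simp [encode]

/-- A string encodes at most one graph. -/
theorem encode_inj {n m : ℕ} {G : SimpleGraph (Fin n)} {H : SimpleGraph (Fin m)}
    (h : G.encode = H.encode) : n = m ∧ HEq G H := by
  have hnm : n = m := by
    have := congrArg List.length h
    rw [length_encode, length_encode] at this
    exact Nat.mul_self_inj.1 this
  subst hnm
  refine ⟨rfl, heq_of_eq ?_⟩
  have hf := List.ofFn_injective h
  ext u v
  have := congrFun hf (finProdFinEquiv (u, v))
  have h1 : (finProdFinEquiv (u, v)).divNat = u :=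
    congrArg Prod.fst (finProdFinEquiv.symm_apply_apply (u, v))
  have h2 : (finProdFinEquiv (u, v)).modNat = v :=
    congrArg Prod.snd (finProdFinEquiv.symm_apply_apply (u, v))
  simpa [h1, h2] using this

end SimpleGraph

/-- A set of edges on the vertices `0, …, n - 1` as a binary string: the adjacency matrix of the
graph with these edges. -/
noncomputable def encodeEdges {n : ℕ} (M : Set (Sym2 (Fin n))) : List Bool :=
  (SimpleGraph.fromEdgeSet M).encode

/-- The enumeration of the minimal matching cuts of a graph, parameterized by its feedback edge
number.  A string that does not encode a graph has no solutions and the parameter `0`. -/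
noncomputable def enumMinimalMC : ParamEnumProblem where
  Sol x := {s | ∃ (n : ℕ) (G : SimpleGraph (Fin n)) (M : Set (Sym2 (Fin n))),
    G.encode = x ∧ G.IsMinimalMatchingCut M ∧ s = encodeEdges M}
  finite_Sol x := by
    refine (List.finite_length_eq Bool x.length).subset ?_
    rintro s ⟨n, G, M, rfl, -, rfl⟩
    simp [encodeEdges, SimpleGraph.length_encode]
  κ x := sInf {k | ∃ (n : ℕ) (G : SimpleGraph (Fin n)), G.encode = x ∧ G.feedbackEdgeNumber = k}

/-- The parameter of (the string that encodes) `G` is the feedback edge number of `G`. -/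
theorem enumMinimalMC_κ {n : ℕ} (G : SimpleGraph (Fin n)) :
    enumMinimalMC.κ G.encode = G.feedbackEdgeNumber := by
  have : {k | ∃ (m : ℕ) (H : SimpleGraph (Fin m)), H.encode = G.encode ∧
      H.feedbackEdgeNumber = k} = {G.feedbackEdgeNumber} := by
    ext k
    constructor
    · rintro ⟨m, H, h, rfl⟩
      obtain ⟨rfl, h⟩ := SimpleGraph.encode_inj h
      rw [eq_of_heq h]; rfl
    · rintro rfl
      exact ⟨n, G, rfl, rfl⟩
  change sInf _ = _
  rw [this, csInf_singleton]

/-! ## A data-parallel language that compiles to random access machines -/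

namespace RAM

/-! Positive part. In a connected graph the minimal matching cuts are the bonds (minimal nonempty
cuts) that are matchings (`isMinimalMatchingCut_iff`). In a disconnected graph the empty set is the
only solution, and two isolated vertices serve as kernel. Call two edges similar if they are equal
or form a cut; as cuts are closed under symmetric difference, this is an equivalence relation. A
non-bridge is loose if it is similar to every adjacent non-bridge; long paths of vertices of degree
two, possibly with trees attached, consist of such edges. The kernel contracts all bridges and,
among similar loose edges, all but the first.

A solution with at least three edges contains no bridge and at most one edge of each similarity
class, and a loose edge in it may be replaced by any similar loose edge (`LargeSol.swap`,
`LargeSol.exchange`). Replacing every loose edge by the first one of its class gives a canonical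
solution without contracted edges; the solutions with a given canonical form correspond to
independent choices, one for each edge (`largeSol_star_iff`). Canonical solutions survive the
contraction (`IsContraction.kept_of_large`), and no two surviving edges become parallel
(`IsContraction.injOn`). Solutions with one or two edges either survive and represent themselves, or
are lost. The lost ones are polynomially many, and all of them together are represented by one
pendant edge, added to the contracted graph if there are any (`IsContraction.isKernel_of_pendant`).

The contracted graph has no bridge, and, unless it is a single vertex, each of its vertices of
degree two has a neighbour of degree at least three: otherwise two similar loose edges would have
remained. Since contraction does not raise the excess of edges over vertices, this bounds the number
of vertices linearly in the feedback edge number (`IsContraction.card_quo_le`).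

The algorithms are written in a small language of array assignments and loops of a common length
`N`. Its programs take polynomially many steps in `N` by construction (`Cmd.exe`), so only their
meaning has to be checked. The lifting algorithm is a loop with at least one output in each round,
so a bound for one round bounds the delay (`iterProg_run`). Lost solutions are all output in a
single round; choice functions are enumerated in colexicographic order, one in each round
(`Odometer.enumerates`).

Negative part. A theta graph consisting of `r` paths between two hubs, with `l + 1` inner vertices
on each, has feedback edge number at most `r` and at least `l ^ r` minimal matching cuts, obtained
by choosing one inner edge on each path. With a fully-polynomial kernel there would be at most a
constant number of classes for fixed `r`, each of a size polynomial in `l` with a degree that does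
not depend on `r`; this fails once `r` exceeds the degree. -/

@[simp] theorem outputs_append (τ₁ τ₂ : List Event) :
    outputs (τ₁ ++ τ₂) = outputs τ₁ ++ outputs τ₂ := by
  induction τ₁ with
  | nil => rfl
  | cons e τ ih => cases e <;> simp [outputs, ih]

@[simp] theorem time_append (τ₁ τ₂ : List Event) : time (τ₁ ++ τ₂) = time τ₁ + time τ₂ := by
  induction τ₁ with
  | nil => simp [time]
  | cons e τ ih => cases e <;> simp [time, ih]; omega

@[simp] theorem outputs_replicate_tick (n : ℕ) : outputs (List.replicate n .tick) = [] := by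
  induction n with
  | zero => rfl
  | succ n ih => simpa [List.replicate_succ, outputs] using ih

@[simp] theorem time_replicate_tick (n : ℕ) : time (List.replicate n .tick) = n := by
  induction n with
  | zero => rfl
  | succ n ih => simpa [List.replicate_succ, time] using ih

theorem eval_mono (p : Polynomial ℕ) {a b : ℕ} (h : a ≤ b) : p.eval a ≤ p.eval b := by
  rw [Polynomial.eval_eq_sum, Polynomial.eval_eq_sum]
  exact Finset.sum_le_sum fun i _ => Nat.mul_le_mul_left _ (Nat.pow_le_pow_left h i)

/-- The program halts with the outputs `o` within `T` steps in a state that satisfies `Q`. -/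
def Exe (p : Prog) (σ : State) (o : List (List Bool)) (T : ℕ) (Q : State → Prop) : Prop :=
  ∃ τ σ', Exec p σ τ σ' ∧ outputs τ = o ∧ time τ ≤ T ∧ Q σ'

theorem Exe.mono {p σ o T T' Q Q'} (h : Exe p σ o T Q) (hT : T ≤ T') (hQ : ∀ σ', Q σ' → Q' σ') :
    Exe p σ o T' Q' := by
  obtain ⟨τ, σ', h1, h2, h3, h4⟩ := h
  exact ⟨τ, σ', h1, h2, h3.trans hT, hQ _ h4⟩

theorem Exe.seq {p q σ o₁ o₂ T₁ T₂ Q}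
    (h : Exe p σ o₁ T₁ fun σ' => Exe q σ' o₂ T₂ Q) :
    Exe (.seq p q) σ (o₁ ++ o₂) (T₁ + T₂) Q := by
  obtain ⟨τ, σ', h1, h2, h3, τ', σ'', h4, h5, h6, h7⟩ := h
  exact ⟨τ ++ τ', σ'', .seq h1 h4, by simp [*], by simp only [time_append]; omega, h7⟩

theorem Exe.seq_nil {p q σ o T₁ T₂ Q} (h : Exe p σ [] T₁ fun σ' => Exe q σ' o T₂ Q) :
    Exe (.seq p q) σ o (T₁ + T₂) Q := by
  simpa using Exe.seq h

theorem Exe.assign {v e σ} {Q : State → Prop} (h : Q (σ.setReg v (e.eval σ))) :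
    Exe (.assign v e) σ [] 1 Q :=
  ⟨_, _, .assign _ _ _, rfl, le_rfl, h⟩

theorem Exe.store {a i e σ} {Q : State → Prop}
    (h : Q (σ.setCell (a.eval σ) (i.eval σ) (e.eval σ))) :
    Exe (.store a i e) σ [] 1 Q :=
  ⟨_, _, .store _ _ _ _, rfl, le_rfl, h⟩

theorem Exe.emit {a l σ} {Q : State → Prop} (h : Q σ) :
    Exe (.emit a l) σ [σ.word (a.eval σ) (l.eval σ)] (l.eval σ + 1) Q :=
  ⟨_, _, .emit _ _ _, by simp [outputs], by simp [time], h⟩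

theorem Exe.ite {e p q σ o T Q} (h₁ : e.eval σ ≠ 0 → Exe p σ o T Q)
    (h₂ : e.eval σ = 0 → Exe q σ o T Q) : Exe (.ite e p q) σ o (T + 1) Q := by
  by_cases h : e.eval σ = 0
  · obtain ⟨τ, σ', a, b, c, d⟩ := h₂ h
    exact ⟨_, σ', .ite_false h a, by simpa [outputs] using b, by simpa [time] using c, d⟩
  · obtain ⟨τ, σ', a, b, c, d⟩ := h₁ h
    exact ⟨_, σ', .ite_true h a, by simpa [outputs] using b, by simpa [time] using c, d⟩

/-- `for reg[r] = 0, …, reg[0] - 1 do body`. -/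
def forReg (r : ℕ) (body : Prog) : Prog :=
  .seq (.assign r (.lit 0))
    (.loop (.minus (.reg 0) (.reg r)) (.seq body (.assign r (.plus (.reg r) (.lit 1)))))

/-- Each round costs the body, the test and the increment; initialisation and the last, failing test
add 2. The counter changes between the rounds, so the invariant has to be stable under writing to
the register `r`. -/
theorem Exe.forReg {r body N T} {o : ℕ → List (List Bool)} (Inv : ℕ → State → Prop) (hr : r ≠ 0)
    (hbody : ∀ i < N, ∀ σ, Inv i σ → σ.reg 0 = N → σ.reg r = i →
      Exe body σ (o i) T fun σ' => Inv (i + 1) σ' ∧ σ'.reg 0 = N ∧ σ'.reg r = i)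
    (hset : ∀ i σ c, Inv i σ → Inv i (σ.setReg r c))
    {σ} (h0 : Inv 0 σ) (hN : σ.reg 0 = N) {Q : State → Prop}
    (hQ : ∀ σ', Inv N σ' → Q σ') :
    Exe (forReg r body) σ ((List.range N).flatMap o) (N * (T + 2) + 2) Q := by
  have key : ∀ k i, i + k = N → ∀ σ, Inv i σ → σ.reg 0 = N → σ.reg r = i →
      Exe (.loop (.minus (.reg 0) (.reg r)) (.seq body (.assign r (.plus (.reg r) (.lit 1)))))
        σ ((List.range' i k).flatMap o) (k * (T + 2) + 1) Q := by
    intro k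
    induction k with
    | zero =>
      intro i hi σ h1 h2 h3
      refine ⟨[.tick], σ, .loop_false (by simp [Expr.eval]; omega), by simp [outputs], by simp [time],
        hQ _ ?_⟩
      have : i = N := by omega
      exact this ▸ h1
    | succ k ih =>
      intro i hi σ h1 h2 h3
      obtain ⟨τ, σ', a, b, c, d1, d2, d3⟩ := hbody i (by omega) σ h1 h2 h3
      obtain ⟨τ', σ'', a', b', c', d'⟩ := ih (i + 1) (by omega) (σ'.setReg r (i + 1))
        (hset _ _ _ d1) (by simp [State.setReg, Function.update_of_ne hr.symm, d2])
        (by simp [State.setReg])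
      have hs : Exec (.assign r (.plus (.reg r) (.lit 1))) σ' [.tick] (σ'.setReg r (i + 1)) := by
        have := Exec.assign r (.plus (.reg r) (.lit 1)) σ'
        simpa [Expr.eval, d3] using this
      refine ⟨_, σ'', .loop_true (by simp [Expr.eval]; omega) (.seq a hs) a', ?_, ?_, d'⟩
      · simp [outputs, b, b', List.range'_succ]
      · simp only [time, time_append]
        have : (k + 1) * (T + 2) = k * (T + 2) + (T + 2) := by ring
        omega
  refine Exe.mono (Exe.seq_nil (T₁ := 1) (T₂ := N * (T + 2) + 1) (Exe.assign ?_)) (by omega)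
    fun _ h => h
  rw [List.range_eq_range']
  exact key N 0 (by omega) _ (hset _ _ _ h0)
    (by simp [State.setReg, Function.update_of_ne hr.symm, hN]) (by simp [State.setReg, Expr.eval])

theorem Exe.forReg_nil {r body N T} (Inv : ℕ → State → Prop) (hr : r ≠ 0)
    (hbody : ∀ i < N, ∀ σ, Inv i σ → σ.reg 0 = N → σ.reg r = i →
      Exe body σ [] T fun σ' => Inv (i + 1) σ' ∧ σ'.reg 0 = N ∧ σ'.reg r = i)
    (hset : ∀ i σ c, Inv i σ → Inv i (σ.setReg r c))
    {σ} (h0 : Inv 0 σ) (hN : σ.reg 0 = N) {Q : State → Prop}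
    (hQ : ∀ σ', Inv N σ' → Q σ') :
    Exe (RAM.forReg r body) σ [] (N * (T + 2) + 2) Q := by
  have h : (List.range N).flatMap (fun _ => ([] : List (List Bool))) = [] := by simp
  exact h ▸ Exe.forReg (o := fun _ => []) Inv hr hbody hset h0 hN hQ

/-- The memory of the data-parallel language: 32 two-dimensional arrays. -/
abbrev Mem := Fin 32 → ℕ → ℕ → ℕ

/-- Terms: constants, local variables, the global bound `N`, array cells, sums, truncated
differences, case distinctions, and sums with `N` summands. -/
inductive Tm where
  | lit (c : ℕ)
  | var (v : ℕ)
  | top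
  | cell (a : Fin 32) (s t : Tm)
  | add (s t : Tm)
  | sub (s t : Tm)
  | ite (c s t : Tm)
  | sum (v : ℕ) (t : Tm)

/-- The value of a term. -/
def Tm.val (N : ℕ) (u : Mem) : Tm → (ℕ → ℕ) → ℕ
  | .lit c, _ => c
  | .var v, ρ => ρ v
  | .top, _ => N
  | .cell a s t, ρ => u a (s.val N u ρ) (t.val N u ρ)
  | .add s t, ρ => s.val N u ρ + t.val N u ρ
  | .sub s t, ρ => s.val N u ρ - t.val N u ρ
  | .ite c s t, ρ => if c.val N u ρ ≠ 0 then s.val N u ρ else t.val N u ρ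
  | .sum v t, ρ => ∑ i ∈ Finset.range N, t.val N u (Function.update ρ v i)

def Expr.dbl (e : Expr) : Expr := .plus e e

/-- The machine array that holds the row `e` of the array `a`. -/
def Expr.row (a : ℕ) (e : Expr) : Expr := .plus (.lit a) e.dbl.dbl.dbl.dbl.dbl.dbl

/-- Six doublings replace a multiplication by 64. For `a < 64` the numbers `a + 64 * i` are
distinct: those with `a < 32` belong to the arrays of the language, `a = 32` is scratch space. -/
theorem Expr.eval_row (a : ℕ) (e : Expr) (σ : State) :
    (Expr.row a e).eval σ = a + 64 * e.eval σ := by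
  simp only [Expr.row, Expr.dbl, Expr.eval]; ring

/-- The compilation of a term; `m` are the registers of the local variables, the value is left in
the register `c`, and only registers from `c` on are changed. -/
def Tm.comp : Tm → (ℕ → ℕ) → ℕ → Prog
  | .lit k, _, c => .assign c (.lit k)
  | .var v, m, c => .assign c (.reg (m v))
  | .top, _, c => .assign c (.reg 0)
  | .cell a s t, m, c => .seq (s.comp m c) (.seq (t.comp m (c + 1))
      (.assign c (.cell (Expr.row a (.reg c)) (.reg (c + 1)))))
  | .add s t, m, c => .seq (s.comp m c) (.seq (t.comp m (c + 1))
      (.assign c (.plus (.reg c) (.reg (c + 1)))))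
  | .sub s t, m, c => .seq (s.comp m c) (.seq (t.comp m (c + 1))
      (.assign c (.minus (.reg c) (.reg (c + 1)))))
  | .ite b s t, m, c => .seq (b.comp m c) (.ite (.reg c) (s.comp m c) (t.comp m c))
  | .sum v t, m, c => .seq (.assign c (.lit 0)) (forReg (c + 1)
      (.seq (t.comp (Function.update m v (c + 1)) (c + 2))
        (.assign c (.plus (.reg c) (.reg (c + 2))))))

open Polynomial in
/-- A bound for the running time of a term. -/
noncomputable def Tm.cost : Tm → Polynomial ℕ
  | .lit _ | .var _ | .top => 1
  | .cell _ s t | .add s t | .sub s t => s.cost + (t.cost + 1)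
  | .ite b s t => b.cost + (s.cost + t.cost + 1)
  | .sum _ t => 1 + (X * (t.cost + 1 + 2) + 2)

/-- The machine state `σ` represents the memory `u`. -/
structure Rel (N : ℕ) (u : Mem) (σ : State) : Prop where
  reg0 : σ.reg 0 = N
  arr : ∀ (a : Fin 32) i j, σ.arr (a + 64 * i) j = u a i j

/-- The registers `m` hold the values `ρ` of the local variables. -/
def Vars (ρ m : ℕ → ℕ) (c : ℕ) (σ : State) : Prop := ∀ v, m v < c ∧ σ.reg (m v) = ρ v

theorem Vars.congr {ρ m c c' σ σ'} (h : Vars ρ m c σ) (hr : ∀ r < c, σ'.reg r = σ.reg r)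
    (hc : c ≤ c') : Vars ρ m c' σ' :=
  fun v => ⟨(h v).1.trans_le hc, by rw [hr _ (h v).1, (h v).2]⟩

theorem Rel.congr {N u σ σ'} (h : Rel N u σ) {c} (hc : 1 ≤ c) (hr : ∀ r < c, σ'.reg r = σ.reg r)
    (ha : σ'.arr = σ.arr) : Rel N u σ' :=
  ⟨by rw [hr 0 hc, h.reg0], by rw [ha]; exact h.arr⟩

theorem Vars.update {ρ m c σ} (h : Vars ρ m c σ) (v : ℕ) {r i c' : ℕ} (hr : r < c')
    (hi : σ.reg r = i) (hc : c ≤ c') :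
    Vars (Function.update ρ v i) (Function.update m v r) c' σ := by
  intro w
  by_cases hw : w = v
  · subst hw; simp [hr, hi]
  · simp only [Function.update_of_ne hw]
    exact ⟨(h w).1.trans_le hc, (h w).2⟩

/-- Induction on the term. Code compiled at `c` changes only registers from `c` on, so a value left
in `c` survives the evaluation of a second subterm compiled at `c + 1`. -/
theorem Tm.exe (N : ℕ) (u : Mem) (t : Tm) : ∀ (ρ m : ℕ → ℕ) (c : ℕ) (σ : State), 1 ≤ c → Rel N u σ →
    Vars ρ m c σ → Exe (t.comp m c) σ [] (t.cost.eval N) fun σ' =>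
      σ'.reg c = t.val N u ρ ∧ (∀ r < c, σ'.reg r = σ.reg r) ∧ σ'.arr = σ.arr := by
  induction t with
  | lit k =>
    intro ρ m c σ hc hR hV
    simp only [comp, cost, Polynomial.eval_one]
    exact Exe.assign ⟨by simp [State.setReg, Expr.eval, val],
      fun r hr => by simp [State.setReg, hr.ne], rfl⟩
  | var v =>
    intro ρ m c σ hc hR hV
    simp only [comp, cost, Polynomial.eval_one]
    exact Exe.assign ⟨by simp [State.setReg, Expr.eval, val, (hV v).2],
      fun r hr => by simp [State.setReg, hr.ne], rfl⟩
  | top =>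
    intro ρ m c σ hc hR hV
    simp only [comp, cost, Polynomial.eval_one]
    exact Exe.assign ⟨by simp [State.setReg, Expr.eval, val, hR.reg0],
      fun r hr => by simp [State.setReg, hr.ne], rfl⟩
  | cell a s t ihs iht =>
    intro ρ m c σ hc hR hV
    simp only [comp, cost, Polynomial.eval_add, Polynomial.eval_one]
    refine Exe.seq_nil (Exe.mono (ihs ρ m c σ hc hR hV) le_rfl ?_)
    rintro σ₁ ⟨h1, h2, h3⟩
    refine Exe.seq_nil (Exe.mono (iht ρ m (c + 1) σ₁ (by omega) (hR.congr hc h2 h3)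
      (hV.congr h2 (by omega))) le_rfl ?_)
    rintro σ₂ ⟨h4, h5, h6⟩
    refine Exe.assign ⟨?_, fun r hr => ?_, ?_⟩
    · simp [State.setReg, Expr.eval_row, Expr.eval, val, h4, h5 c (by omega), h1, h6, h3, hR.arr]
    · simp [State.setReg, hr.ne, h5 r (by omega), h2 r hr]
    · simp [State.setReg, h6, h3]
  | add s t ihs iht =>
    intro ρ m c σ hc hR hV
    simp only [comp, cost, Polynomial.eval_add, Polynomial.eval_one]
    refine Exe.seq_nil (Exe.mono (ihs ρ m c σ hc hR hV) le_rfl ?_)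
    rintro σ₁ ⟨h1, h2, h3⟩
    refine Exe.seq_nil (Exe.mono (iht ρ m (c + 1) σ₁ (by omega) (hR.congr hc h2 h3)
      (hV.congr h2 (by omega))) le_rfl ?_)
    rintro σ₂ ⟨h4, h5, h6⟩
    refine Exe.assign ⟨?_, fun r hr => ?_, ?_⟩
    · simp [State.setReg, Expr.eval, val, h4, h5 c (by omega), h1]
    · simp [State.setReg, hr.ne, h5 r (by omega), h2 r hr]
    · simp [State.setReg, h6, h3]
  | sub s t ihs iht =>
    intro ρ m c σ hc hR hV
    simp only [comp, cost, Polynomial.eval_add, Polynomial.eval_one]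
    refine Exe.seq_nil (Exe.mono (ihs ρ m c σ hc hR hV) le_rfl ?_)
    rintro σ₁ ⟨h1, h2, h3⟩
    refine Exe.seq_nil (Exe.mono (iht ρ m (c + 1) σ₁ (by omega) (hR.congr hc h2 h3)
      (hV.congr h2 (by omega))) le_rfl ?_)
    rintro σ₂ ⟨h4, h5, h6⟩
    refine Exe.assign ⟨?_, fun r hr => ?_, ?_⟩
    · simp [State.setReg, Expr.eval, val, h4, h5 c (by omega), h1]
    · simp [State.setReg, hr.ne, h5 r (by omega), h2 r hr]
    · simp [State.setReg, h6, h3]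
  | ite b s t ihb ihs iht =>
    intro ρ m c σ hc hR hV
    simp only [comp, cost, Polynomial.eval_add, Polynomial.eval_one]
    refine Exe.seq_nil (Exe.mono (ihb ρ m c σ hc hR hV) le_rfl ?_)
    rintro σ₁ ⟨h1, h2, h3⟩
    refine Exe.ite (fun h => ?_) fun h => ?_
    · refine Exe.mono (ihs ρ m c σ₁ hc (hR.congr hc h2 h3) (hV.congr h2 le_rfl)) (by omega) ?_
      rintro σ₂ ⟨h4, h5, h6⟩
      simp only [Expr.eval, h1] at h
      exact ⟨by simp [val, h, h4], fun r hr => by rw [h5 r hr, h2 r hr], by rw [h6, h3]⟩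
    · refine Exe.mono (iht ρ m c σ₁ hc (hR.congr hc h2 h3) (hV.congr h2 le_rfl)) (by omega) ?_
      rintro σ₂ ⟨h4, h5, h6⟩
      simp only [Expr.eval, h1] at h
      exact ⟨by simp [val, h, h4], fun r hr => by rw [h5 r hr, h2 r hr], by rw [h6, h3]⟩
  | sum v t ih =>
    intro ρ m c σ hc hR hV
    simp only [comp, cost, Polynomial.eval_add, Polynomial.eval_one, Polynomial.eval_mul,
      Polynomial.eval_X, Polynomial.eval_ofNat]
    refine Exe.seq_nil (Exe.assign ?_)
    -- The register `c` accumulates the sum, `c + 1` is the counter, and `c + 2` receives the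
    -- summand.
    refine Exe.forReg_nil (fun i σ' =>
      σ'.reg c = ∑ k ∈ Finset.range i, t.val N u (Function.update ρ v k) ∧
        (∀ r < c, σ'.reg r = σ.reg r) ∧ σ'.arr = σ.arr) (by omega) ?_ ?_ ?_ ?_ ?_
    · rintro i hi σ₁ ⟨h1, h2, h3⟩ h4 h5
      refine Exe.seq_nil (Exe.mono (ih (Function.update ρ v i) (Function.update m v (c + 1)) (c + 2)
        σ₁ (by omega) (hR.congr hc h2 h3)
        ((hV.congr h2 le_rfl).update v (by omega) h5 (by omega))) le_rfl ?_)
      rintro σ₂ ⟨h6, h7, h8⟩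
      refine Exe.assign ⟨⟨?_, fun r hr => ?_, ?_⟩, ?_, ?_⟩
      · simp [State.setReg, Expr.eval, h6, h7 c (by omega), h1, Finset.sum_range_succ]
      · simp [State.setReg, hr.ne, h7 r (by omega), h2 r hr]
      · simp [State.setReg, h8, h3]
      · simp [State.setReg, (show (0 : ℕ) ≠ c by omega), h7 0 (by omega), h4]
      · simp [State.setReg, h7 (c + 1) (by omega), h5]
    · rintro i σ₁ k ⟨h1, h2, h3⟩
      refine ⟨by simp [State.setReg, h1], fun r hr => ?_, h3⟩
      simp [State.setReg, (show r ≠ c + 1 by omega), h2 r hr]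
    · refine ⟨by simp [State.setReg, Expr.eval], fun r hr => ?_, rfl⟩
      simp [State.setReg, hr.ne]
    · simp [State.setReg, (show (0 : ℕ) ≠ c by omega), hR.reg0]
    · rintro σ' ⟨h1, h2, h3⟩
      exact ⟨by simp [val, h1], h2, h3⟩

/-- Commands: assignment of an `N × N` array in parallel (the local variables `0` and `1` are row
and column), composition, case distinction, `N`-fold iteration, and output of the first cells of
the row `0` of an array. -/
inductive Cmd where
  | nop
  | par (a : Fin 32) (t : Tm)
  | seq (c d : Cmd)
  | ite (t : Tm) (c d : Cmd)
  | rep (v : ℕ) (c : Cmd)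
  | emit (a : Fin 32) (l : Tm)

/-- The memory after a command. -/
def Cmd.st (N : ℕ) : Cmd → (ℕ → ℕ) → Mem → Mem
  | .nop, _, u => u
  | .par a t, ρ, u => fun b i j => if b = a ∧ i < N ∧ j < N then
      t.val N u (Function.update (Function.update ρ 0 i) 1 j) else u b i j
  | .seq c d, ρ, u => d.st N ρ (c.st N ρ u)
  | .ite t c d, ρ, u => if t.val N u ρ ≠ 0 then c.st N ρ u else d.st N ρ u
  | .rep v c, ρ, u => Nat.rec u (fun i w => c.st N (Function.update ρ v i) w) N
  | .emit _ _, _, u => u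

/-- The outputs of a command. -/
def Cmd.out (N : ℕ) : Cmd → (ℕ → ℕ) → Mem → List (List Bool)
  | .nop, _, _ => []
  | .par _ _, _, _ => []
  | .seq c d, ρ, u => c.out N ρ u ++ d.out N ρ (c.st N ρ u)
  | .ite t c d, ρ, u => if t.val N u ρ ≠ 0 then c.out N ρ u else d.out N ρ u
  | .rep v c, ρ, u => (List.range N).flatMap fun i =>
      c.out N (Function.update ρ v i) (Nat.rec u (fun i w => c.st N (Function.update ρ v i) w) i)
  | .emit a l, ρ, u => [(List.range (min (l.val N u ρ) N)).map fun i => decide (u a 0 i ≠ 0)]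

/-- The compilation of a command, with registers from `c` on as scratch registers. -/
def Cmd.comp : Cmd → (ℕ → ℕ) → ℕ → Prog
  | .nop, _, _ => .skip
  | .par a t, m, c => .seq
      (forReg c (forReg (c + 1)
        (.seq (t.comp (Function.update (Function.update m 0 c) 1 (c + 1)) (c + 2))
          (.store (Expr.row 32 (.reg c)) (.reg (c + 1)) (.reg (c + 2))))))
      (forReg c (forReg (c + 1)
        (.store (Expr.row a (.reg c)) (.reg (c + 1))
          (.cell (Expr.row 32 (.reg c)) (.reg (c + 1))))))
  | .seq p q, m, c => .seq (p.comp m c) (q.comp m c)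
  | .ite t p q, m, c => .seq (t.comp m c) (.ite (.reg c) (p.comp m c) (q.comp m c))
  | .rep v p, m, c => forReg c (p.comp (Function.update m v c) (c + 1))
  | .emit a l, m, c => .seq (l.comp m c)
      (.emit (.lit a) (.minus (.reg c) (.minus (.reg c) (.reg 0))))

open Polynomial in
/-- A bound for the running time of a command. -/
noncomputable def Cmd.cost : Cmd → Polynomial ℕ
  | .nop => 1
  | .par _ t => (X * ((X * ((t.cost + 1) + 2) + 2) + 2) + 2) + (X * ((X * (1 + 2) + 2) + 2) + 2)
  | .seq c d => c.cost + d.cost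
  | .ite t c d => t.cost + (c.cost + d.cost + 1)
  | .rep _ c => X * (c.cost + 2) + 2
  | .emit _ l => l.cost + (X + 1)

theorem row_injective {a b : ℕ} (ha : a < 64) (hb : b < 64) {i j : ℕ}
    (h : a + 64 * i = b + 64 * j) : a = b ∧ i = j := by omega

/-- All cells have to be evaluated in the old memory. The values are therefore collected in the
scratch rows `32 + 64 * i` first, which no term can read, and copied to the rows of `a` afterwards.
-/
theorem Cmd.exe_par (N : ℕ) (u : Mem) (a : Fin 32) (t : Tm) (ρ m : ℕ → ℕ) (c : ℕ) (σ : State)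
    (hc : 1 ≤ c) (hR : Rel N u σ) (hV : Vars ρ m c σ) :
    Exe ((Cmd.par a t).comp m c) σ [] ((Cmd.par a t).cost.eval N) fun σ' =>
      Rel N ((Cmd.par a t).st N ρ u) σ' ∧ ∀ r < c, σ'.reg r = σ.reg r := by
  simp only [comp, cost, Polynomial.eval_add, Polynomial.eval_one, Polynomial.eval_mul,
    Polynomial.eval_X, Polynomial.eval_ofNat]
  set w : ℕ → ℕ → ℕ := fun i j => t.val N u (Function.update (Function.update ρ 0 i) 1 j) with hw
  set I : State → Prop := fun σ' => Rel N u σ' ∧ ∀ r < c, σ'.reg r = σ.reg r with hI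
  have hIset : ∀ (σ' : State) (r k : ℕ), c ≤ r → I σ' → I (σ'.setReg r k) := by
    rintro σ' r k hr ⟨h1, h2⟩
    have h3 : ∀ r' < c, (σ'.setReg r k).reg r' = σ'.reg r' := fun r' hr' => by
      simp [State.setReg, (show r' ≠ r by omega)]
    exact ⟨h1.congr hc h3 rfl, fun r' hr' => by rw [h3 r' hr', h2 r' hr']⟩
  rw [show ([] : List (List Bool)) = [] ++ [] from rfl]
  refine Exe.seq ?_
  refine Exe.forReg_nil (fun i σ' => I σ' ∧ ∀ i' < i, ∀ j < N, σ'.arr (32 + 64 * i') j = w i' j)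
    (by omega) ?_ ?_ ⟨⟨hR, fun _ _ => rfl⟩, by simp⟩ hR.reg0 ?_
  · rintro i hi σ₁ ⟨h1, h2⟩ h3 h4
    refine Exe.forReg_nil (fun j σ' => (I σ' ∧ ∀ i' < i, ∀ j < N, σ'.arr (32 + 64 * i') j = w i' j) ∧
      (σ'.reg c = i ∧ ∀ j' < j, σ'.arr (32 + 64 * i) j' = w i j'))
      (by omega) ?_ ?_ ⟨⟨h1, h2⟩, h4, by simp⟩ h3 ?_
    · rintro j hj σ₂ ⟨⟨h5, h6⟩, h7, h8⟩ h9 h10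
      refine Exe.seq_nil (Exe.mono (t.exe N u (Function.update (Function.update ρ 0 i) 1 j) _ (c + 2)
        σ₂ (by omega) h5.1 (((hV.congr h5.2 le_rfl).update 0 (c' := c + 1) (by omega) h7
          (by omega)).update 1 (by omega) h10 (by omega))) le_rfl ?_)
      rintro σ₃ ⟨h11, h12, h13⟩
      have e1 : (Expr.row 32 (.reg c)).eval σ₃ = 32 + 64 * i := by
        rw [Expr.eval_row]; simp [Expr.eval, h12 c (by omega), h7]
      have e2 : (Expr.reg (c + 1)).eval σ₃ = j := by simp [Expr.eval, h12 (c + 1) (by omega), h10]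
      have e3 : (Expr.reg (c + 2)).eval σ₃ = w i j := by simp [Expr.eval, h11, hw]
      refine Exe.store ?_
      rw [e1, e2, e3]
      refine ⟨⟨⟨⟨⟨?_, ?_⟩, ?_⟩, ?_⟩, ?_, ?_⟩, ?_, ?_⟩
      · simp [State.setCell, h12 0 (by omega), h9]
      · intro b i' j'
        have : (b : ℕ) + 64 * i' ≠ 32 + 64 * i := by omega
        simp [State.setCell, Function.update_of_ne this, h13, h5.1.arr]
      · intro r hr
        simp [State.setCell, h12 r (by omega), h5.2 r hr]
      · intro i' hi' j' hj'
        have : 32 + 64 * i' ≠ 32 + 64 * i := by omega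
        simp [State.setCell, Function.update_of_ne this, h13, h6 i' hi' j' hj']
      · simp [State.setCell, h12 c (by omega), h7]
      · intro j' hj'
        by_cases hjj : j' = j
        · subst hjj; simp [State.setCell]
        · simp [State.setCell, Function.update_of_ne hjj, h13, h8 j' (by omega)]
      · simp [State.setCell, h12 0 (by omega), h9]
      · simp [State.setCell, h12 (c + 1) (by omega), h10]
    · rintro j σ' k ⟨⟨h5, h6⟩, h7, h8⟩
      exact ⟨⟨hIset _ _ _ (by omega) h5, h6⟩, by simp [State.setReg, h7], h8⟩
    · rintro σ' ⟨⟨h5, h6⟩, h7, h8⟩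
      refine ⟨⟨h5, fun i' hi' j hj => ?_⟩, h5.1.reg0, h7⟩
      rcases Nat.lt_succ_iff_lt_or_eq.1 hi' with h | rfl
      · exact h6 i' h j hj
      · exact h8 j hj
  · rintro i σ' k ⟨h1, h2⟩
    exact ⟨hIset _ _ _ le_rfl h1, h2⟩
  rintro σ₁ ⟨⟨hR₁, hr₁⟩, hw₁⟩
  -- Invariant of the copying phase: the cells before `(i, j)` in row-major order have their new
  -- values, all others still the old ones.
  set J : ℕ → ℕ → State → Prop := fun i j σ' => σ'.reg 0 = N ∧ (∀ r < c, σ'.reg r = σ.reg r) ∧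
    (∀ i < N, ∀ j < N, σ'.arr (32 + 64 * i) j = w i j) ∧
    ∀ (b : Fin 32) i' j', σ'.arr (b + 64 * i') j' =
      if b = a ∧ i' < N ∧ j' < N ∧ (i' < i ∨ i' = i ∧ j' < j) then w i' j' else u b i' j' with hJ
  have hJset : ∀ i j (σ' : State) (r k : ℕ), c ≤ r → J i j σ' → J i j (σ'.setReg r k) := by
    rintro i j σ' r k hr ⟨h1, h2, h3, h4⟩
    exact ⟨by simp [State.setReg, (show 0 ≠ r by omega), h1], fun r' hr' => by
      simp [State.setReg, (show r' ≠ r by omega), h2 r' hr'], h3, h4⟩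
  refine Exe.forReg_nil (fun i σ' => J i 0 σ') (by omega) ?_ (fun i σ' k h => hJset _ _ _ _ _ le_rfl h)
    ⟨hR₁.reg0, hr₁, hw₁, by simp [hR₁.arr]⟩ hR₁.reg0 ?_
  · rintro i hi σ₂ h1 h2 h3
    refine Exe.forReg_nil (fun j σ' => J i j σ' ∧ σ'.reg c = i) (by omega) ?_ ?_ ⟨h1, h3⟩ h2 ?_
    · rintro j hj σ₃ ⟨⟨h4, h5, h6, h7⟩, h8⟩ h9 h10
      have e1 : ∀ k, (Expr.row k (.reg c)).eval σ₃ = k + 64 * i := fun k => by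
        rw [Expr.eval_row]; simp [Expr.eval, h8]
      have e2 : (Expr.reg (c + 1)).eval σ₃ = j := by simp [Expr.eval, h10]
      have e3 : (Expr.cell (Expr.row 32 (.reg c)) (.reg (c + 1))).eval σ₃ = w i j := by
        simp only [Expr.eval, e1, h10]; exact h6 i hi j hj
      refine Exe.store ?_
      rw [e1, e2, e3]
      refine ⟨⟨⟨h4, h5, fun i' hi' j' hj' => ?_, fun b i' j' => ?_⟩, h8⟩, h4, h10⟩
      · have : 32 + 64 * i' ≠ a + 64 * i := by omega
        simp [State.setCell, Function.update_of_ne this, h6 i' hi' j' hj']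
      · by_cases hb : b = a ∧ i' = i
        · obtain ⟨rfl, rfl⟩ := hb
          by_cases hj' : j' = j
          · subst hj'; simp [State.setCell, hi, hj]
          · have e : (j' < j + 1) ↔ j' < j := by omega
            simp [State.setCell, Function.update_of_ne hj', h7, e]
        · have : (b : ℕ) + 64 * i' ≠ a + 64 * i := fun h => by
            have := row_injective (by omega) (by omega) h
            exact hb ⟨Fin.ext this.1, this.2⟩
          simp only [State.setCell, Function.update_of_ne this, h7]
          refine if_congr ?_ rfl rfl
          constructor
          · rintro ⟨x1, x2, x3, x4⟩
            exact ⟨x1, x2, x3, by omega⟩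
          · rintro ⟨x1, x2, x3, x4⟩
            have : i' ≠ i := fun h => hb ⟨x1, h⟩
            exact ⟨x1, x2, x3, by omega⟩
    · rintro j σ' k ⟨h4, h5⟩
      exact ⟨hJset _ _ _ _ _ (by omega) h4, by simp [State.setReg, h5]⟩
    · rintro σ' ⟨⟨h4, h5, h6, h7⟩, h8⟩
      refine ⟨⟨h4, h5, h6, fun b i' j' => ?_⟩, h4, h8⟩
      rw [h7]
      refine if_congr ?_ rfl rfl
      constructor
      · rintro ⟨x1, x2, x3, x4⟩
        exact ⟨x1, x2, x3, by omega⟩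
      · rintro ⟨x1, x2, x3, x4⟩
        exact ⟨x1, x2, x3, by omega⟩
  · rintro σ' ⟨h1, h2, h3, h4⟩
    refine ⟨⟨h1, fun b i j => ?_⟩, h2⟩
    rw [h4]
    simp only [st, hw]
    refine if_congr ?_ rfl rfl
    constructor
    · rintro ⟨x1, x2, x3, x4⟩
      exact ⟨x1, x2, x3⟩
    · rintro ⟨x1, x2, x3⟩
      exact ⟨x1, x2, x3, Or.inl x2⟩

theorem Cmd.exe (N : ℕ) (p : Cmd) : ∀ (u : Mem) (ρ m : ℕ → ℕ) (c : ℕ) (σ : State), 1 ≤ c →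
    Rel N u σ → Vars ρ m c σ → Exe (p.comp m c) σ (p.out N ρ u) (p.cost.eval N) fun σ' =>
      Rel N (p.st N ρ u) σ' ∧ ∀ r < c, σ'.reg r = σ.reg r := by
  induction p with
  | nop =>
    intro u ρ m c σ hc hR hV
    exact ⟨_, _, .skip _, rfl, by simp [time, cost], hR, fun _ _ => rfl⟩
  | par a t =>
    intro u ρ m c σ hc hR hV
    exact exe_par N u a t ρ m c σ hc hR hV
  | seq p q ihp ihq =>
    intro u ρ m c σ hc hR hV
    simp only [comp, cost, out, st, Polynomial.eval_add]
    refine Exe.seq (Exe.mono (ihp u ρ m c σ hc hR hV) le_rfl ?_)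
    rintro σ₁ ⟨h1, h2⟩
    refine Exe.mono (ihq _ ρ m c σ₁ hc h1 (hV.congr h2 le_rfl)) le_rfl ?_
    rintro σ₂ ⟨h3, h4⟩
    exact ⟨h3, fun r hr => by rw [h4 r hr, h2 r hr]⟩
  | ite t p q ihp ihq =>
    intro u ρ m c σ hc hR hV
    simp only [comp, cost, out, st, Polynomial.eval_add, Polynomial.eval_one]
    refine Exe.seq_nil (Exe.mono (t.exe N u ρ m c σ hc hR hV) le_rfl ?_)
    rintro σ₁ ⟨h1, h2, h3⟩
    have hR₁ := hR.congr hc h2 h3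
    refine Exe.ite (fun h => ?_) fun h => ?_
    · simp only [Expr.eval, h1] at h
      rw [if_pos h, if_pos h]
      refine Exe.mono (ihp u ρ m c σ₁ hc hR₁ (hV.congr h2 le_rfl)) (by omega) ?_
      rintro σ₂ ⟨h3, h4⟩
      exact ⟨h3, fun r hr => by rw [h4 r hr, h2 r hr]⟩
    · simp only [Expr.eval, h1] at h
      rw [if_neg (not_not.2 h), if_neg (not_not.2 h)]
      refine Exe.mono (ihq u ρ m c σ₁ hc hR₁ (hV.congr h2 le_rfl)) (by omega) ?_
      rintro σ₂ ⟨h3, h4⟩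
      exact ⟨h3, fun r hr => by rw [h4 r hr, h2 r hr]⟩
  | rep v p ih =>
    intro u ρ m c σ hc hR hV
    simp only [comp, cost, out, st, Polynomial.eval_add, Polynomial.eval_mul, Polynomial.eval_X,
      Polynomial.eval_ofNat]
    refine Exe.forReg (fun i σ' =>
      Rel N (Nat.rec u (fun i w => p.st N (Function.update ρ v i) w) i) σ' ∧
      ∀ r < c, σ'.reg r = σ.reg r) (by omega) ?_ ?_ ⟨hR, fun _ _ => rfl⟩ hR.reg0 fun _ h => h
    · rintro i hi σ₁ ⟨h1, h2⟩ h3 h4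
      refine Exe.mono (ih _ (Function.update ρ v i) (Function.update m v c) (c + 1) σ₁ (by omega) h1
        ((hV.congr h2 le_rfl).update v (by omega) h4 (by omega))) le_rfl ?_
      rintro σ₂ ⟨h5, h6⟩
      exact ⟨⟨h5, fun r hr => by rw [h6 r (by omega), h2 r hr]⟩, h5.reg0, by
        rw [h6 c (by omega), h4]⟩
    · rintro i σ₁ k ⟨h1, h2⟩
      have h3 : ∀ r < c, (σ₁.setReg c k).reg r = σ₁.reg r := fun r hr => by
        simp [State.setReg, hr.ne]
      exact ⟨h1.congr hc h3 rfl, fun r hr => by rw [h3 r hr, h2 r hr]⟩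
  | emit a l =>
    intro u ρ m c σ hc hR hV
    simp only [comp, cost, out, st, Polynomial.eval_add, Polynomial.eval_one, Polynomial.eval_X]
    refine Exe.seq_nil (Exe.mono (l.exe N u ρ m c σ hc hR hV) le_rfl ?_)
    rintro σ₁ ⟨h1, h2, h3⟩
    have hR₁ := hR.congr hc h2 h3
    -- The nested truncated differences compute a minimum; cutting the length off at `N` keeps the
    -- cost of an output polynomial in `N`.
    have e : (Expr.minus (.reg c) (.minus (.reg c) (.reg 0))).eval σ₁ = min (l.val N u ρ) N := by
      simp only [Expr.eval, h1, hR₁.reg0]; omega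
    have hw : σ₁.word ((Expr.lit a).eval σ₁) (min (l.val N u ρ) N) =
        (List.range (min (l.val N u ρ) N)).map fun i => decide (u a 0 i ≠ 0) := by
      simp only [State.word]
      refine List.map_congr_left fun i _ => ?_
      have := hR₁.arr a 0 i
      simp only [mul_zero, add_zero] at this
      simp only [Expr.eval, this]
    rw [← hw, ← e]
    refine Exe.mono (Exe.emit (Q := fun σ' => σ' = σ₁) rfl) (by rw [e]; omega) ?_
    rintro σ' rfl
    exact ⟨hR₁, h2⟩

end RAM

/-! ## Cuts, bonds and contractions -/

namespace SimpleGraph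

variable {V W : Type*} {G : SimpleGraph V}

theorem mem_cutEdges {A : Set V} {u v : V} :
    s(u, v) ∈ G.cutEdges A ↔ G.Adj u v ∧ ¬(u ∈ A ↔ v ∈ A) := by
  constructor
  · rintro ⟨a, ha, b, hb, hab, h⟩
    rcases Sym2.eq_iff.1 h with ⟨rfl, rfl⟩ | ⟨rfl, rfl⟩
    · exact ⟨hab, by tauto⟩
    · exact ⟨hab.symm, by tauto⟩
  · rintro ⟨h1, h2⟩
    by_cases hu : u ∈ A
    · exact ⟨u, hu, v, by tauto, h1, rfl⟩
    · exact ⟨v, by tauto, u, hu, h1.symm, Sym2.eq_swap⟩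

theorem cutEdges_subset (A : Set V) : G.cutEdges A ⊆ G.edgeSet := by
  rintro e ⟨u, -, v, -, h, rfl⟩
  exact h

theorem cutEdges_compl (A : Set V) : G.cutEdges Aᶜ = G.cutEdges A := by
  ext e
  induction e with | _ u v => simp only [mem_cutEdges, Set.mem_compl_iff]; tauto

/-- The edge sets `E(A, V \ A)`, trivial ones included. -/
def IsCut (G : SimpleGraph V) (M : Set (Sym2 V)) : Prop := ∃ A, M = G.cutEdges A

theorem IsCut.subset {M : Set (Sym2 V)} (h : G.IsCut M) : M ⊆ G.edgeSet := by
  obtain ⟨A, rfl⟩ := h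
  exact cutEdges_subset A

/-- Take the symmetric difference of the two sides. All exchange arguments below rest on this
closure property. -/
theorem IsCut.symmDiff {M N : Set (Sym2 V)} (hM : G.IsCut M) (hN : G.IsCut N) :
    G.IsCut (_root_.symmDiff M N) := by
  obtain ⟨A, rfl⟩ := hM
  obtain ⟨B, rfl⟩ := hN
  refine ⟨_root_.symmDiff A B, ?_⟩
  ext e
  induction e with | _ u v =>
  simp only [Set.mem_symmDiff, mem_cutEdges]
  tauto

/-- Every nontrivial vertex set has a leaving edge. -/
def CutConnected (G : SimpleGraph V) : Prop := ∀ A, G.cutEdges A = ∅ → A = ∅ ∨ A = Set.univ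

/-- The minimal nonempty cuts. -/
def IsBond (G : SimpleGraph V) (M : Set (Sym2 V)) : Prop :=
  G.IsCut M ∧ M.Nonempty ∧ ∀ N, G.IsCut N → N.Nonempty → N ⊆ M → N = M

/-- No two edges share an end. -/
def IsMat (M : Set (Sym2 V)) : Prop := ∀ e ∈ M, ∀ f ∈ M, ∀ v, v ∈ e → v ∈ f → e = f

/-- Connectedness makes a bipartition nontrivial exactly if its cut is nonempty. Subsets of
matchings are matchings, so minimality among matching cuts and minimality among all nonempty cuts
agree. -/
theorem isMinimalMatchingCut_iff (hG : G.CutConnected) (M : Set (Sym2 V)) :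
    G.IsMinimalMatchingCut M ↔ G.IsBond M ∧ IsMat M := by
  have key : ∀ M, (∃ A : Set V, A.Nonempty ∧ Aᶜ.Nonempty ∧ M = G.cutEdges A) ↔
      G.IsCut M ∧ M.Nonempty := by
    intro M
    constructor
    · rintro ⟨A, h1, h2, rfl⟩
      refine ⟨⟨A, rfl⟩, Set.nonempty_iff_ne_empty.2 fun h => ?_⟩
      rcases hG A h with rfl | rfl
      · exact h1.ne_empty rfl
      · simp at h2
    · rintro ⟨⟨A, rfl⟩, e, u, hu, v, hv, -, -⟩
      exact ⟨A, ⟨u, hu⟩, ⟨v, hv⟩, rfl⟩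
  constructor
  · rintro ⟨⟨h1, h2⟩, h3⟩
    obtain ⟨h4, h5⟩ := (key M).1 h1
    refine ⟨⟨h4, h5, fun N hN hN' hNM => ?_⟩, h2⟩
    refine hNM.antisymm (h3 ⟨(key N).2 ⟨hN, hN'⟩, fun e he f hf => h2 e (hNM he) f (hNM hf)⟩ hNM)
  · rintro ⟨⟨h1, h2, h3⟩, h4⟩
    refine ⟨⟨(key M).2 ⟨h1, h2⟩, h4⟩, fun N hN hNM => ?_⟩
    obtain ⟨h5, h6⟩ := (key N).1 hN.1
    exact (h3 N h5 h6 hNM).ge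

/-- The empty set is a matching cut itself and is contained in all others. -/
theorem isMinimalMatchingCut_of_not_cutConnected (hG : ¬ G.CutConnected) (M : Set (Sym2 V)) :
    G.IsMinimalMatchingCut M ↔ M = ∅ := by
  have h0 : G.IsMatchingCut ∅ := by
    simp only [CutConnected, not_forall, not_or] at hG
    obtain ⟨A, h1, h2, h3⟩ := hG
    refine ⟨⟨A, Set.nonempty_iff_ne_empty.2 h2, ?_, h1.symm⟩, by simp⟩
    rwa [Set.nonempty_compl]
  constructor
  · intro h
    exact Set.subset_empty_iff.1 (h.2 h0 (Set.empty_subset _))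
  · rintro rfl
    exact ⟨h0, fun _ _ _ => Set.empty_subset _⟩

/-- Bridges. -/
def Br (G : SimpleGraph V) (e : Sym2 V) : Prop := G.IsCut {e}

/-- Two edges are similar if they are equal or form a cut. -/
def Sim (G : SimpleGraph V) (e f : Sym2 V) : Prop := e = f ∨ G.IsCut {e, f}

theorem Sim.symm {e f : Sym2 V} (h : G.Sim e f) : G.Sim f e := by
  rcases h with rfl | h
  · exact Or.inl rfl
  · exact Or.inr (by rwa [Set.pair_comm])

/-- The symmetric difference of `{e, f}` and `{f, g}` is `{e, g}`. -/
theorem Sim.trans {e f g : Sym2 V} (h : G.Sim e f) (h' : G.Sim f g) : G.Sim e g := by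
  by_cases h1 : e = f
  · exact h1 ▸ h'
  by_cases h2 : f = g
  · exact h2 ▸ h
  by_cases h3 : e = g
  · exact Or.inl h3
  right
  convert (h.resolve_left h1).symmDiff (h'.resolve_left h2) using 1
  ext x
  simp only [Set.mem_symmDiff, Set.mem_insert_iff, Set.mem_singleton_iff]
  constructor
  · rintro (rfl | rfl)
    · exact Or.inl ⟨Or.inl rfl, by tauto⟩
    · exact Or.inr ⟨Or.inr rfl, by tauto⟩
  · tauto

/-- Loose edges: those similar to all adjacent edges except for bridges. -/
def Loose (G : SimpleGraph V) (e : Sym2 V) : Prop :=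
  e ∈ G.edgeSet ∧ ¬ G.Br e ∧
    ∀ e' ∈ G.edgeSet, ¬ G.Br e' → (∃ v, v ∈ e ∧ v ∈ e') → G.Sim e e'

/-- The edges that are contracted: bridges, and all but the first one of similar loose edges. -/
def Ctr (G : SimpleGraph V) (ix : Sym2 V → ℕ) (e : Sym2 V) : Prop :=
  G.Br e ∨ G.Loose e ∧ ∃ g, G.Loose g ∧ G.Sim g e ∧ ix g < ix e

theorem IsBond.eq_of_br {M : Set (Sym2 V)} (h : G.IsBond M) {e : Sym2 V} (he : e ∈ M)
    (hb : G.Br e) : M = {e} :=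
  (h.2.2 _ hb ⟨e, rfl⟩ (by simpa using he)).symm

theorem IsBond.eq_of_sim {M : Set (Sym2 V)} (h : G.IsBond M) {e f : Sym2 V} (he : e ∈ M)
    (hf : f ∈ M) (hne : e ≠ f) (hs : G.Sim e f) : M = {e, f} :=
  (h.2.2 _ (hs.resolve_left hne) ⟨e, by simp⟩ (by simp [Set.insert_subset_iff, he, hf])).symm

theorem Br.isBond {e : Sym2 V} (h : G.Br e) : G.IsBond {e} := by
  refine ⟨h, ⟨e, rfl⟩, fun N _ h2 h3 => ?_⟩
  exact (Set.subset_singleton_iff_eq.1 h3).resolve_left h2.ne_empty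

theorem isBond_pair {e f : Sym2 V} (he : ¬ G.Br e) (hf : ¬ G.Br f) (hne : e ≠ f)
    (h : G.Sim e f) : G.IsBond {e, f} := by
  refine ⟨h.resolve_left hne, ⟨e, by simp⟩, fun N h1 h2 h3 => ?_⟩
  have h4 : e ∈ N := by
    by_contra h4
    have : N = {f} := (Set.subset_singleton_iff_eq.1 fun x hx => by
      rcases h3 hx with rfl | h
      · exact absurd hx h4
      · exact h).resolve_left h2.ne_empty
    exact hf (by rw [Br, ← this]; exact h1)
  have h5 : f ∈ N := by
    by_contra h5
    have : N = {e} := (Set.subset_singleton_iff_eq.1 fun x hx => by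
      rcases h3 hx with rfl | h
      · rfl
      · exact absurd (h ▸ hx) h5).resolve_left h2.ne_empty
    exact he (by rw [Br, ← this]; exact h1)
  exact h3.antisymm (by simp [Set.insert_subset_iff, h4, h5])

theorem IsBond.not_br {M : Set (Sym2 V)} (h : G.IsBond M) (hM : 3 ≤ M.ncard) {e : Sym2 V}
    (he : e ∈ M) : ¬ G.Br e := fun hb => by
  rw [h.eq_of_br he hb, Set.ncard_singleton] at hM
  omega

theorem IsBond.eq_of_sim_of_three_le {M : Set (Sym2 V)} (h : G.IsBond M) (hM : 3 ≤ M.ncard)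
    {e f : Sym2 V} (he : e ∈ M) (hf : f ∈ M) (hs : G.Sim e f) : e = f := by
  by_contra hne
  rw [h.eq_of_sim he hf hne hs, Set.ncard_pair hne] at hM
  omega

/-- Replacing an edge of a large bond by a similar one gives a bond. -/
theorem IsBond.swap {M : Set (Sym2 V)} (h : G.IsBond M) {f g : Sym2 V} (hf : f ∈ M) (hg : g ∉ M)
    (hs : G.Sim f g) : G.IsBond (insert g (M \ {f})) := by
  have hne : f ≠ g := fun h => hg (h ▸ hf)
  have hcut := hs.resolve_left hne
  have e1 : insert g (M \ {f}) = symmDiff M {f, g} := by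
    ext x
    simp only [Set.mem_symmDiff, Set.mem_insert_iff, Set.mem_sdiff, Set.mem_singleton_iff]
    constructor
    · rintro (rfl | ⟨h1, h2⟩)
      · exact Or.inr ⟨Or.inr rfl, hg⟩
      · refine Or.inl ⟨h1, ?_⟩
        rintro (rfl | rfl)
        · exact h2 rfl
        · exact hg h1
    · rintro (⟨h1, h2⟩ | ⟨rfl | rfl, h2⟩)
      · exact Or.inr ⟨h1, by tauto⟩
      · exact absurd hf h2
      · exact Or.inl rfl
  refine ⟨e1 ▸ h.1.symmDiff hcut, ⟨g, Set.mem_insert _ _⟩, fun N h1 h2 h3 => ?_⟩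
  -- If `N` contains `g`, then exchanging back gives a nonempty cut inside `M`, hence `M` itself.
  -- Otherwise `N` is a nonempty cut inside `M` that misses `f`, which is impossible.
  by_cases hgN : g ∈ N
  · have h4 : symmDiff N {f, g} ⊆ M := by
      intro x hx
      simp only [Set.mem_symmDiff, Set.mem_insert_iff, Set.mem_singleton_iff] at hx
      rcases hx with ⟨hx1, hx2⟩ | ⟨rfl | rfl, hx2⟩
      · rcases h3 hx1 with rfl | h5
        · tauto
        · exact h5.1
      · exact hf
      · exact absurd hgN hx2
    have hfN : f ∉ N := fun h => by
      rcases h3 h with h5 | h5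
      · exact hne h5
      · exact h5.2 rfl
    have h5 := h.2.2 _ (h1.symmDiff hcut) ⟨f, by simp [Set.mem_symmDiff, hfN]⟩ h4
    rw [e1, ← h5, symmDiff_symmDiff_cancel_right]
  · exfalso
    have h4 : N ⊆ M \ {f} := fun x hx => by
      rcases h3 hx with rfl | h5
      · exact absurd hx hgN
      · exact h5
    have h5 := h.2.2 N h1 h2 (h4.trans Set.sdiff_subset)
    exact (h4 (h5 ▸ hf)).2 rfl

/-- Large bonds that are matchings. -/
def LargeSol (G : SimpleGraph V) (M : Set (Sym2 V)) : Prop :=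
  G.IsBond M ∧ IsMat M ∧ 3 ≤ M.ncard

/-- Looseness of `g` is needed for the matching property only: an edge of the new bond that is
adjacent to `g` is not a bridge, hence similar to `g`, and a bond with at least three edges contains
only one edge of each class. -/
theorem LargeSol.swap [Finite V] {M : Set (Sym2 V)} (h : G.LargeSol M) {f g : Sym2 V} (hf : f ∈ M)
    (hg : g ∉ M) (hs : G.Sim f g) (hfree : G.Loose g) : G.LargeSol (insert g (M \ {f})) := by
  have hb := h.1.swap hf hg hs
  have hc : 3 ≤ (insert g (M \ {f})).ncard := by
    rw [Set.ncard_insert_of_notMem (fun h => hg h.1) (Set.toFinite _),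
      Set.ncard_sdiff_singleton_add_one hf (Set.toFinite _)]
    exact h.2.2
  have hgg : ∀ e ∈ insert g (M \ {f}), (∃ v, v ∈ g ∧ v ∈ e) → g = e := fun e he hv =>
    hb.eq_of_sim_of_three_le hc (Set.mem_insert _ _) he
      (hfree.2.2 e (hb.1.subset he) (hb.not_br hc he) hv)
  refine ⟨hb, fun e he e' he' v hv hv' => ?_, hc⟩
  rcases he with rfl | he
  · exact hgg _ he' ⟨v, hv, hv'⟩
  rcases he' with rfl | he'
  · exact (hgg _ (Or.inr he) ⟨v, hv', hv⟩).symm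
  exact h.2.1 e he.1 e' he'.1 v hv hv'

/-- `c` replaces loose edges by similar loose edges. -/
def IsExchange (G : SimpleGraph V) (M : Set (Sym2 V)) (c : Sym2 V → Sym2 V) : Prop :=
  ∀ g ∈ M, c g = g ∨ G.Loose g ∧ G.Loose (c g) ∧ G.Sim g (c g)

theorem IsExchange.sim {M : Set (Sym2 V)} {c : Sym2 V → Sym2 V} (h : G.IsExchange M c)
    {g : Sym2 V} (hg : g ∈ M) : G.Sim g (c g) := by
  rcases h g hg with h | h
  · exact Or.inl h.symm
  · exact h.2.2

/-- The edges are replaced one at a time, by induction on the set `T` of those already replaced. The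
edges of a large bond lie in distinct classes, so the replacements do not interfere. -/
theorem LargeSol.exchange [Finite V] {M : Set (Sym2 V)} (h : G.LargeSol M) {c : Sym2 V → Sym2 V}
    (hc : G.IsExchange M c) : G.LargeSol (c '' M) := by
  have key : ∀ T : Set (Sym2 V), T ⊆ M → G.LargeSol (c '' T ∪ (M \ T)) := by
    intro T
    induction T, Set.toFinite T using Set.Finite.induction_on with
    | empty => intro _; simpa using h
    | @insert g T hg hfin ih =>
      intro hT
      rw [Set.insert_subset_iff] at hT
      have ih := ih hT.2
      set MT := c '' T ∪ (M \ T) with hMT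
      have hgM : g ∈ MT := Or.inr ⟨hT.1, hg⟩
      have hgc : g ∉ c '' T := by
        rintro ⟨g', h1, h2⟩
        have := h.1.eq_of_sim_of_three_le h.2.2 (hT.2 h1) hT.1 (h2 ▸ hc.sim (hT.2 h1))
        exact hg (this ▸ h1)
      have e1 : c '' insert g T ∪ (M \ insert g T) = insert (c g) (MT \ {g}) := by
        ext x
        simp only [Set.image_insert_eq, Set.mem_union, Set.mem_insert_iff, Set.mem_sdiff, hMT,
          Set.mem_singleton_iff]
        constructor
        · rintro ((h1 | h1) | h1)
          · exact Or.inl h1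
          · exact Or.inr ⟨Or.inl h1, fun h2 => hgc (h2 ▸ h1)⟩
          · exact Or.inr ⟨Or.inr ⟨h1.1, by tauto⟩, by tauto⟩
        · tauto
      rw [e1]
      rcases hc g hT.1 with h1 | ⟨h1, h2, h3⟩
      · rwa [h1, Set.insert_sdiff_singleton, Set.insert_eq_of_mem hgM]
      · by_cases h4 : c g ∈ MT
        · have := ih.1.eq_of_sim_of_three_le ih.2.2 hgM h4 h3
          rwa [← this, Set.insert_sdiff_singleton, Set.insert_eq_of_mem hgM]
        · exact ih.swap hgM h4 h3 h2
  simpa using key M subset_rfl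

/-- An edge of the image determines its class, and thereby the edge of `M` that it replaces. -/
theorem LargeSol.exchange_inj {M : Set (Sym2 V)} (h : G.LargeSol M)
    {c c' : Sym2 V → Sym2 V} (hc : G.IsExchange M c) (hc' : G.IsExchange M c')
    (he : c '' M = c' '' M) : ∀ g ∈ M, c g = c' g := by
  intro g hg
  have h1 : c g ∈ c' '' M := he ▸ ⟨g, hg, rfl⟩
  obtain ⟨g', hg', h2⟩ := h1
  have h3 := h.1.eq_of_sim_of_three_le h.2.2 hg hg' ((hc.sim hg).trans (h2 ▸ (hc'.sim hg').symm))
  rw [← h2, h3]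

/-! ### Canonical forms of large solutions -/

section Star

variable (ix : Sym2 V → ℕ)

theorem exists_star (G : SimpleGraph V) (ix : Sym2 V → ℕ) (e : Sym2 V) :
    ∃ g, (¬ G.Loose e → g = e) ∧
      (G.Loose e → G.Loose g ∧ G.Sim g e ∧ ∀ h, G.Loose h → G.Sim h e → ix g ≤ ix h) := by
  by_cases he : G.Loose e
  · obtain ⟨g, h1, h2⟩ := exists_minimal_of_wellFoundedLT
      (fun k => ∃ g, G.Loose g ∧ G.Sim g e ∧ ix g = k) ⟨_, e, he, Or.inl rfl, rfl⟩
    obtain ⟨g, h3, h4, rfl⟩ := h1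
    refine ⟨g, fun h => absurd he h, fun _ => ⟨h3, h4, fun h h5 h6 => ?_⟩⟩
    rcases le_total (ix g) (ix h) with h7 | h7
    · exact h7
    · exact h2 ⟨h, h5, h6, rfl⟩ h7
  · exact ⟨e, fun _ => rfl, fun h => absurd h he⟩

/-- The first loose edge similar to `e`, or `e` itself if it is not free. -/
noncomputable def star (G : SimpleGraph V) (ix : Sym2 V → ℕ) (e : Sym2 V) : Sym2 V :=
  (exists_star G ix e).choose

theorem star_of_not_loose {e : Sym2 V} (h : ¬ G.Loose e) : G.star ix e = e :=
  (exists_star G ix e).choose_spec.1 h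

theorem star_spec {e : Sym2 V} (h : G.Loose e) : G.Loose (G.star ix e) ∧ G.Sim (G.star ix e) e ∧
    ∀ g, G.Loose g → G.Sim g e → ix (G.star ix e) ≤ ix g :=
  (exists_star G ix e).choose_spec.2 h

theorem isExchange_star (M : Set (Sym2 V)) : G.IsExchange M (G.star ix) := by
  intro e _
  by_cases h : G.Loose e
  · have := star_spec ix h
    exact Or.inr ⟨h, this.1, this.2.1.symm⟩
  · exact Or.inl (star_of_not_loose ix h)

theorem not_ctr_star {e : Sym2 V} (h : ¬ G.Br e) : ¬ G.Ctr ix (G.star ix e) := by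
  by_cases he : G.Loose e
  · obtain ⟨h1, h2, h3⟩ := star_spec ix he
    rintro (h4 | ⟨-, g, h4, h5, h6⟩)
    · exact h1.2.1 h4
    · have := h3 g h4 (h5.trans h2)
      omega
  · rw [star_of_not_loose ix he]
    rintro (h4 | h4)
    · exact h h4
    · exact he h4.1

/-- Of two distinct similar loose edges, the one with the larger index is contracted. -/
theorem eq_of_sim_of_not_ctr (hix : Set.InjOn ix G.edgeSet) {e f : Sym2 V} (he : G.Loose e)
    (hf : G.Loose f) (hs : G.Sim e f) (he' : ¬ G.Ctr ix e) (hf' : ¬ G.Ctr ix f) : e = f := by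
  rcases lt_trichotomy (ix e) (ix f) with h | h | h
  · exact absurd (Or.inr ⟨hf, e, he, hs, h⟩) hf'
  · exact hix he.1 hf.1 h
  · exact absurd (Or.inr ⟨he, f, hf, hs.symm, h⟩) he'

theorem star_eq_self (hix : Set.InjOn ix G.edgeSet) {e : Sym2 V} (he : ¬ G.Ctr ix e) :
    G.star ix e = e := by
  by_cases hf : G.Loose e
  · have := star_spec ix hf
    exact eq_of_sim_of_not_ctr ix hix this.1 hf this.2.1 (not_ctr_star ix hf.2.1) he
  · exact star_of_not_loose ix hf

/-- The large solutions with a given set of representatives are given by the exchanges. -/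
theorem largeSol_star_iff [Finite V] (hix : Set.InjOn ix G.edgeSet) {M₀ : Set (Sym2 V)}
    (h₀ : G.LargeSol M₀) (hC : ∀ e ∈ M₀, ¬ G.Ctr ix e) (M : Set (Sym2 V)) :
    (G.LargeSol M ∧ G.star ix '' M = M₀) ↔ ∃ c, G.IsExchange M₀ c ∧ M = c '' M₀ := by
  constructor
  · rintro ⟨h1, h2⟩
    -- The exchange is a section of `star`: it sends a representative in `M₀` back to an edge of `M`
    -- that it represents. Outside `M₀` its value is arbitrary.
    have h3 : ∀ g : Sym2 V, ∃ e, g ∈ M₀ → e ∈ M ∧ G.star ix e = g := by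
      intro g
      by_cases hg : g ∈ M₀
      · rw [← h2] at hg
        obtain ⟨e, he⟩ := hg
        exact ⟨e, fun _ => he⟩
      · exact ⟨g, fun h => absurd h hg⟩
    choose c hc using h3
    refine ⟨c, fun g hg => ?_, ?_⟩
    · obtain ⟨h4, h5⟩ := hc g hg
      rcases isExchange_star ix M (c g) h4 with h6 | h6
      · exact Or.inl (h6.symm.trans h5)
      · rw [h5] at h6
        exact Or.inr ⟨h6.2.1, h6.1, h6.2.2.symm⟩
    · ext e
      constructor
      · intro he
        refine ⟨G.star ix e, h2 ▸ ⟨e, he, rfl⟩, ?_⟩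
        have h4 : G.star ix e ∈ M₀ := h2 ▸ ⟨e, he, rfl⟩
        obtain ⟨h5, h6⟩ := hc _ h4
        have hs := isExchange_star (G := G) ix M
        have h7 := hs.sim h5
        rw [h6] at h7
        exact h1.1.eq_of_sim_of_three_le h1.2.2 h5 he (h7.trans (hs.sim he).symm)
      · rintro ⟨g, hg, rfl⟩
        exact (hc g hg).1
  · rintro ⟨c, hc, rfl⟩
    refine ⟨h₀.exchange hc, ?_⟩
    rw [Set.image_image]
    have : ∀ g ∈ M₀, G.star ix (c g) = g := by
      intro g hg
      rcases hc g hg with h1 | ⟨h1, h2, h3⟩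
      · rw [h1, star_eq_self ix hix (hC g hg)]
      · obtain ⟨h4, h5, h6⟩ := star_spec ix h2
        exact eq_of_sim_of_not_ctr ix hix h4 h1 (h5.trans h3.symm) (not_ctr_star ix h2.2.1)
          (hC g hg)
    rw [Set.image_congr this, Set.image_id']

end Star

/-! ### Walks of contracted edges and sides of bridges -/

theorem Walk.mem_iff_even_countP {K : SimpleGraph V} (hK : K ≤ G) (A : Set V)
    [DecidablePred (· ∈ G.cutEdges A)] {p q : V} (w : K.Walk p q) :
    (p ∈ A ↔ q ∈ A) ↔ Even (w.edges.countP (· ∈ G.cutEdges A)) := by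
  induction w with
  | nil => simp
  | @cons p v q h w ih =>
    rw [Walk.edges_cons, List.countP_cons]
    by_cases h' : s(p, v) ∈ G.cutEdges A
    · simp only [h', decide_true, if_true, Nat.even_add_one, ← ih]
      have := (mem_cutEdges.1 h').2
      tauto
    · simp only [h', decide_false, Bool.false_eq_true, if_false, add_zero, ← ih]
      have : p ∈ A ↔ v ∈ A := by
        by_contra h2
        exact h' (mem_cutEdges.2 ⟨hK h, h2⟩)
      tauto

theorem Reachable.mem_iff {K : SimpleGraph V} {A : Set V}
    (hK : ∀ u v, K.Adj u v → (u ∈ A ↔ v ∈ A)) {p q : V} (h : K.Reachable p q) :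
    p ∈ A ↔ q ∈ A := by
  obtain ⟨w⟩ := h
  induction w with
  | nil => rfl
  | cons h w ih => exact (hK _ _ h).trans ih

/-- The graph of the contracted edges. -/
def ctrGraph (G : SimpleGraph V) (ix : Sym2 V → ℕ) : SimpleGraph V := fromEdgeSet {e | G.Ctr ix e}

theorem Ctr.mem_edgeSet {ix : Sym2 V → ℕ} {e : Sym2 V} (h : G.Ctr ix e) : e ∈ G.edgeSet := by
  rcases h with h | h
  · exact h.subset rfl
  · exact h.1.1

theorem ctrGraph_adj {ix : Sym2 V → ℕ} {u v : V} : (G.ctrGraph ix).Adj u v ↔ G.Ctr ix s(u, v) := by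
  rw [ctrGraph, fromEdgeSet_adj]
  exact ⟨fun h => h.1, fun h => ⟨h, (show G.Adj u v from h.mem_edgeSet).ne⟩⟩

theorem ctrGraph_le (ix : Sym2 V → ℕ) : G.ctrGraph ix ≤ G := by
  intro u v h
  exact (ctrGraph_adj.1 h).mem_edgeSet

/-- `p` and `q` are on the same side of every bridge. -/
def SameSides (G : SimpleGraph V) (p q : V) : Prop :=
  ∀ b A, G.cutEdges A = {b} → (p ∈ A ↔ q ∈ A)

theorem SameSides.symm {p q : V} (h : G.SameSides p q) : G.SameSides q p :=
  fun b A hA => (h b A hA).symm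

theorem SameSides.trans {p q r : V} (h : G.SameSides p q) (h' : G.SameSides q r) :
    G.SameSides p r :=
  fun b A hA => (h b A hA).trans (h' b A hA)

theorem sameSides_of_not_br {p q : V} (h : G.Adj p q) (hb : ¬ G.Br s(p, q)) :
    G.SameSides p q := by
  intro b A hA
  by_contra h2
  have h3 := mem_cutEdges.2 ⟨h, h2⟩
  rw [hA] at h3
  exact hb ⟨A, by rw [hA, show s(p, q) = b from h3]⟩

/-- A path of contracted edges would use a bridge exactly once, and would then end on the other side
of it. Hence all edges of the path are loose, and consecutive ones are adjacent, so similar. The two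
edges are the first and the last one of the path. -/
theorem exists_loose_ends (ix : Sym2 V → ℕ) {p q : V} (hpq : p ≠ q)
    (h : (G.ctrGraph ix).Reachable p q) (hs : G.SameSides p q) :
    ∃ f f', p ∈ f ∧ q ∈ f' ∧ G.Loose f ∧ G.Loose f' ∧ G.Sim f f' ∧ G.Ctr ix f ∧ G.Ctr ix f' := by
  classical
  obtain ⟨w, hw⟩ := h.exists_isPath
  have h1 : ∀ e ∈ w.edges, ¬ G.Br e := by
    rintro b hb ⟨A, hA⟩
    have h2 := w.mem_iff_even_countP (ctrGraph_le ix) A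
    have h3 : w.edges.countP (· ∈ G.cutEdges A) = w.edges.count b := by
      rw [List.count]
      refine List.countP_congr fun e _ => ?_
      rw [← hA]; simp
    rw [h3, List.count_eq_one_of_mem hw.isTrail.edges_nodup hb] at h2
    exact absurd (h2.1 (hs b A hA.symm)) (by decide)
  clear hw hs h
  induction w with
  | nil => exact absurd rfl hpq
  | @cons p v q h w ih =>
    have hc : G.Ctr ix s(p, v) := ctrGraph_adj.1 h
    have hbr : ¬ G.Br s(p, v) := h1 _ (by simp)
    have hfree : G.Loose s(p, v) := (hc.resolve_left hbr).1
    by_cases hvq : v = q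
    · subst hvq
      exact ⟨_, _, Sym2.mem_mk_left _ _, Sym2.mem_mk_right _ _, hfree, hfree, Or.inl rfl, hc, hc⟩
    · obtain ⟨f, f', h2, h3, h4, h5, h6, h7, h8⟩ := ih hvq fun e he => h1 e (by simp [he])
      exact ⟨_, f', Sym2.mem_mk_left _ _, h3, hfree, h5,
        (hfree.2.2 f h4.1 h4.2.1 ⟨v, Sym2.mem_mk_right _ _, h2⟩).trans h6, hc, h8⟩

/-- The simple graph obtained by identifying the vertices with the same image. -/
def quo (G : SimpleGraph V) (π : V → W) : SimpleGraph W where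
  Adj a b := a ≠ b ∧ ∃ p q, π p = a ∧ π q = b ∧ G.Adj p q
  symm := ⟨fun _ _ ⟨h, p, q, h1, h2, h3⟩ => ⟨h.symm, q, p, h2, h1, h3.symm⟩⟩
  loopless := ⟨fun _ h => h.1 rfl⟩

theorem quo_adj {π : V → W} {a b : W} :
    (G.quo π).Adj a b ↔ a ≠ b ∧ ∃ p q, π p = a ∧ π q = b ∧ G.Adj p q := Iff.rfl

theorem cutEdges_quo (π : V → W) (B : Set W) :
    (G.quo π).cutEdges B = Sym2.map π '' G.cutEdges (π ⁻¹' B) := by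
  ext e
  constructor
  · induction e with | _ a b =>
    intro h
    obtain ⟨⟨h1, p, q, rfl, rfl, h2⟩, h3⟩ := mem_cutEdges.1 h
    exact ⟨s(p, q), mem_cutEdges.2 ⟨h2, h3⟩, rfl⟩
  · rintro ⟨e, he, rfl⟩
    induction e with | _ p q =>
    obtain ⟨h1, h2⟩ := mem_cutEdges.1 he
    refine mem_cutEdges.2 ⟨⟨fun h => h2 ?_, p, q, rfl, rfl, h1⟩, h2⟩
    simp only [Set.mem_preimage]
    rw [h]

theorem edgeSet_quo (π : V → W) :
    (G.quo π).edgeSet = Sym2.map π '' {e ∈ G.edgeSet | ¬ (e.map π).IsDiag} := by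
  ext e
  constructor
  · induction e with | _ a b =>
    rintro ⟨h1, p, q, rfl, rfl, h2⟩
    exact ⟨s(p, q), ⟨h2, h1⟩, rfl⟩
  · rintro ⟨e, ⟨h1, h2⟩, rfl⟩
    induction e with | _ p q => exact ⟨h2, p, q, rfl, rfl, h1⟩

/-- No two edges have ends in the same fibre. -/
def PiMat (π : V → W) (M : Set (Sym2 V)) : Prop :=
  ∀ e ∈ M, ∀ f ∈ M, ∀ v ∈ e, ∀ w ∈ f, π v = π w → e = f

/-- `π` is the contraction of the edges `Ctr`. -/
structure IsContraction (G : SimpleGraph V) (ix : Sym2 V → ℕ) (π : V → W) : Prop where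
  conn : G.CutConnected
  inj : Set.InjOn ix G.edgeSet
  eq_iff : ∀ p q, π p = π q ↔ (G.ctrGraph ix).Reachable p q
  surj : Function.Surjective π

/-! ### Cuts, bonds and solutions under contraction -/

section Contraction

variable {ix : Sym2 V → ℕ} {π : V → W} (hπ : G.IsContraction ix π)
include hπ

theorem IsContraction.isDiag_of_ctr {e : Sym2 V} (h : G.Ctr ix e) : (e.map π).IsDiag := by
  induction e with | _ p q =>
  exact (hπ.eq_iff p q).2 (ctrGraph_adj.2 h).reachable

theorem IsContraction.mem_iff {A : Set V} (hA : ∀ e ∈ G.cutEdges A, ¬ G.Ctr ix e) {p q : V}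
    (h : π p = π q) : p ∈ A ↔ q ∈ A := by
  refine ((hπ.eq_iff p q).1 h).mem_iff fun u v huv => ?_
  by_contra h2
  have h3 := ctrGraph_adj.1 huv
  exact hA s(u, v) (mem_cutEdges.2 ⟨h3.mem_edgeSet, h2⟩) h3

theorem IsContraction.not_isDiag {A : Set V} (hA : ∀ e ∈ G.cutEdges A, ¬ G.Ctr ix e)
    {e : Sym2 V} (he : e ∈ G.cutEdges A) : ¬ (e.map π).IsDiag := by
  induction e with | _ p q =>
  exact fun h => (mem_cutEdges.1 he).2 (hπ.mem_iff hA h)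

theorem IsContraction.exists_loose_of_isDiag {p q : V} (hadj : G.Adj p q) (hbr : ¬ G.Br s(p, q))
    (h : π p = π q) : ∃ f f', p ∈ f ∧ q ∈ f' ∧ G.Loose f ∧ G.Loose f' ∧ G.Sim f f' ∧
      G.Ctr ix f ∧ G.Ctr ix f' :=
  exists_loose_ends ix hadj.ne ((hπ.eq_iff p q).1 h) (sameSides_of_not_br hadj hbr)

omit hπ in
/-- An edge is loose if there are similar loose edges at both ends. -/
theorem loose_of_ends {p q : V} (he : G.Adj p q) (hbr : ¬ G.Br s(p, q)) {f g : Sym2 V}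
    (hf : G.Loose f) (hg : G.Loose g) (hpf : p ∈ f) (hqg : q ∈ g) : G.Loose s(p, q) := by
  refine ⟨he, hbr, ?_⟩
  rintro e' he' hbr' ⟨v, hv, hv'⟩
  rcases Sym2.mem_iff.1 hv with rfl | rfl
  · exact (hf.2.2 _ he hbr ⟨v, hpf, Sym2.mem_mk_left _ _⟩).symm.trans (hf.2.2 _ he' hbr' ⟨v, hpf, hv'⟩)
  · exact (hg.2.2 _ he hbr ⟨v, hqg, Sym2.mem_mk_right _ _⟩).symm.trans
      (hg.2.2 _ he' hbr' ⟨v, hqg, hv'⟩)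

/-- Bridges are contracted, so both ends of `b` lie in the same fibre, and this cannot be the fibre
of `p` and also that of `q`. The other one is connected by contracted edges different from `b` and
lies on one side of it. -/
theorem IsContraction.sameSides_or {p p' q q' : V} (hne : π p ≠ π q) (hp : π p = π p')
    (hq : π q = π q') {b : Sym2 V} {A : Set V} (hA : G.cutEdges A = {b}) :
    (p ∈ A ↔ p' ∈ A) ∨ (q ∈ A ↔ q' ∈ A) := by
  induction b with | _ x y =>
  by_cases hx : π x = π p
  · right
    have hxy : π x = π y := hπ.isDiag_of_ctr (Or.inl ⟨A, hA.symm⟩)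
    -- The implication makes membership in `S` invariant along every contracted edge, also outside
    -- the fibre of `q`, as `Reachable.mem_iff` requires.
    let S : Set V := {v | π v = π q → (v ∈ A ↔ q ∈ A)}
    have h1 := ((hπ.eq_iff q q').1 hq).mem_iff (A := S) fun u v huv => by
      have h2 : π u = π v := (hπ.eq_iff u v).2 huv.reachable
      by_cases h3 : π u = π q
      · have h4 : u ∈ A ↔ v ∈ A := by
          by_contra h5
          have h6 := mem_cutEdges.2 ⟨ctrGraph_le ix huv, h5⟩
          rw [hA] at h6
          rcases Sym2.eq_iff.1 (show s(u, v) = s(x, y) from h6) with ⟨rfl, rfl⟩ | ⟨rfl, rfl⟩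
          · exact hne (hx.symm.trans h3)
          · exact hne (hx.symm.trans (hxy.trans h3))
        simp only [S, Set.mem_ofPred_eq, h3, ← h2]
        tauto
      · simp only [S, Set.mem_ofPred_eq, h3, ← h2]
        tauto
    exact ((h1.1 (fun _ => Iff.rfl)) hq.symm).symm
  · left
    have hxy : π x = π y := hπ.isDiag_of_ctr (Or.inl ⟨A, hA.symm⟩)
    let S : Set V := {v | π v = π p → (v ∈ A ↔ p ∈ A)}
    have h1 := ((hπ.eq_iff p p').1 hp).mem_iff (A := S) fun u v huv => by
      have h2 : π u = π v := (hπ.eq_iff u v).2 huv.reachable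
      by_cases h3 : π u = π p
      · have h4 : u ∈ A ↔ v ∈ A := by
          by_contra h5
          have h6 := mem_cutEdges.2 ⟨ctrGraph_le ix huv, h5⟩
          rw [hA] at h6
          rcases Sym2.eq_iff.1 (show s(u, v) = s(x, y) from h6) with ⟨rfl, rfl⟩ | ⟨rfl, rfl⟩
          · exact hx h3
          · exact hx (hxy.trans h3)
        simp only [S, Set.mem_ofPred_eq, h3, ← h2]
        tauto
      · simp only [S, Set.mem_ofPred_eq, h3, ← h2]
        tauto
    exact ((h1.1 (fun _ => Iff.rfl)) hp.symm).symm

/-- If `p ≠ p'`, a path of loose edges joins them, and both edges at `q` are similar to it. Let `g`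
be the representative of this class. If `g` is one of the two edges, the other one is loose as well,
contrary to the choice of a single representative. Otherwise `g` and `s(p, q)` form a cut that
contains no contracted edge and not `s(p', q)`, so that the way from `p` over `p'` to `q` does not
cross it: a contradiction. -/
theorem IsContraction.eq_of_share {p p' q : V} (h : G.Adj p q) (h' : G.Adj p' q)
    (hne : π p ≠ π q) (hp : π p = π p') : p = p' := by
  by_contra hpp
  have hd : ∀ {e : Sym2 V}, ¬ (e.map π).IsDiag → ¬ G.Ctr ix e := fun h h' => h (hπ.isDiag_of_ctr h')
  have hc : ¬ G.Ctr ix s(p, q) := hd hne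
  have hc' : ¬ G.Ctr ix s(p', q) := hd (show π p' ≠ π q from hp ▸ hne)
  have hb : ¬ G.Br s(p, q) := fun h => hc (Or.inl h)
  have hb' : ¬ G.Br s(p', q) := fun h => hc' (Or.inl h)
  have hss : G.SameSides p p' := (sameSides_of_not_br h hb).trans (sameSides_of_not_br h' hb').symm
  obtain ⟨f, f', h1, h2, h3, h4, h5, h6, h7⟩ :=
    exists_loose_ends ix hpp ((hπ.eq_iff p p').1 hp) hss
  have hne' : s(p, q) ≠ s(p', q) := fun h => hpp (Sym2.congr_left.1 h)
  have hef : G.Sim f s(p, q) := h3.2.2 _ h hb ⟨p, h1, Sym2.mem_mk_left _ _⟩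
  have hef' : G.Sim f' s(p', q) := h4.2.2 _ h' hb' ⟨p', h2, Sym2.mem_mk_left _ _⟩
  have hee : G.Sim s(p, q) s(p', q) := (hef.symm.trans h5).trans hef'
  obtain ⟨g1, g2, g3⟩ := star_spec ix h3
  set g := G.star ix f with hg
  have gc : ¬ G.Ctr ix g := not_ctr_star ix h3.2.1
  by_cases hge : g = s(p, q)
  · have hfr : G.Loose s(p', q) :=
      loose_of_ends h' hb' h4 (hge ▸ g1) h2 (Sym2.mem_mk_right _ _)
    exact hne' (eq_of_sim_of_not_ctr ix hπ.inj (hge ▸ g1) hfr hee hc hc')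
  by_cases hge' : g = s(p', q)
  · have hfr : G.Loose s(p, q) :=
      loose_of_ends h hb h3 (hge' ▸ g1) h1 (Sym2.mem_mk_right _ _)
    exact hne' (eq_of_sim_of_not_ctr ix hπ.inj hfr (hge' ▸ g1) hee hc hc')
  obtain ⟨B, hB⟩ := (g2.trans hef).resolve_left hge
  have k1 : p ∈ B ↔ p' ∈ B := hπ.mem_iff (fun e he => by
    rw [← hB] at he
    rcases he with rfl | he
    · exact gc
    · exact (show e = _ from he) ▸ hc) hp
  have k2 : p' ∈ B ↔ q ∈ B := by
    by_contra h8
    have h9 := mem_cutEdges.2 ⟨h', h8⟩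
    rw [← hB] at h9
    rcases h9 with h9 | h9
    · exact hge' h9.symm
    · exact hne' (show _ = _ from h9).symm
  have k3 : s(p, q) ∈ G.cutEdges B := hB ▸ Or.inr rfl
  exact (mem_cutEdges.1 k3).2 (k1.trans k2)

/-- The contracted graph needs no parallel edges, so it is legitimate to take a simple graph as
quotient. When the two edges have no common end, both turn out to be loose and similar, and only one
edge of a loose class remains. -/
theorem IsContraction.injOn : Set.InjOn (Sym2.map π) {e ∈ G.edgeSet | ¬ (e.map π).IsDiag} := by
  have key : ∀ p q p' q', G.Adj p q → G.Adj p' q' → π p ≠ π q → π p = π p' → π q = π q' →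
      s(p, q) = s(p', q') := by
    intro p q p' q' h h' hne hp hq
    by_cases hpp : p = p'
    · subst hpp
      have := hπ.eq_of_share h.symm h'.symm (Ne.symm hne) hq
      rw [this]
    by_cases hqq : q = q'
    · subst hqq
      exact absurd (hπ.eq_of_share h h' hne hp) hpp
    have hd : ∀ {e : Sym2 V}, ¬ (e.map π).IsDiag → ¬ G.Ctr ix e :=
      fun h h' => h (hπ.isDiag_of_ctr h')
    have hc : ¬ G.Ctr ix s(p, q) := hd hne
    have hc' : ¬ G.Ctr ix s(p', q') := hd (show π p' ≠ π q' from hp ▸ hq ▸ hne)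
    have hb : ¬ G.Br s(p, q) := fun h => hc (Or.inl h)
    have hb' : ¬ G.Br s(p', q') := fun h => hc' (Or.inl h)
    have s1 := sameSides_of_not_br h hb
    have s2 := sameSides_of_not_br h' hb'
    -- At each bridge, one of the pairs `p, p'` and `q, q'` is on the same side by
    -- `IsContraction.sameSides_or`. The two edges do not cross the bridge, so the other pair is on
    -- the same side too.
    have s3 : G.SameSides p p' := fun b A hA => by
      have a1 := s1 b A hA
      have a2 := s2 b A hA
      rcases hπ.sameSides_or hne hp hq hA with a3 | a3 <;> tauto
    have s4 : G.SameSides q q' := (s1.symm.trans s3).trans s2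
    obtain ⟨f, f', h1, h2, h3, h4, h5, h6, h7⟩ :=
      exists_loose_ends ix hpp ((hπ.eq_iff p p').1 hp) s3
    obtain ⟨g, g', i1, i2, i3, i4, -⟩ :=
      exists_loose_ends ix hqq ((hπ.eq_iff q q').1 hq) s4
    have e1 : G.Loose s(p, q) := loose_of_ends h hb h3 i3 h1 i1
    have e2 : G.Loose s(p', q') := loose_of_ends h' hb' h4 i4 h2 i2
    have e3 : G.Sim s(p, q) s(p', q') :=
      ((h3.2.2 _ h hb ⟨p, h1, Sym2.mem_mk_left _ _⟩).symm.trans h5).trans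
        (h4.2.2 _ h' hb' ⟨p', h2, Sym2.mem_mk_left _ _⟩)
    exact eq_of_sim_of_not_ctr ix hπ.inj e1 e2 e3 hc hc'
  rintro e ⟨he, hd⟩ e' ⟨he', hd'⟩ hee
  induction e with | _ p q =>
  induction e' with | _ p' q' =>
  rcases Sym2.eq_iff.1 hee with ⟨h1, h2⟩ | ⟨h1, h2⟩
  · exact key p q p' q' he he' hd h1 h2
  · rw [key p q q' p' he (Adj.symm he') hd h1 h2, Sym2.eq_swap]

/-- Cuts pull back along `π` without loops. Conversely, a side of a cut that contains no contracted
edge is a union of fibres. -/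
theorem IsContraction.isCut_quo {N : Set (Sym2 W)} : (G.quo π).IsCut N ↔
    ∃ M, G.IsCut M ∧ (∀ e ∈ M, ¬ (e.map π).IsDiag) ∧ N = Sym2.map π '' M := by
  constructor
  · rintro ⟨B, rfl⟩
    refine ⟨_, ⟨π ⁻¹' B, rfl⟩, fun e he => ?_, cutEdges_quo π B⟩
    induction e with | _ p q =>
    intro h
    refine (mem_cutEdges.1 he).2 ?_
    simp only [Set.mem_preimage]
    rw [show π p = π q from h]
  · rintro ⟨M, ⟨A, rfl⟩, h1, rfl⟩
    refine ⟨π '' A, ?_⟩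
    rw [cutEdges_quo]
    congr 2
    ext p
    constructor
    · exact fun h => ⟨p, h, rfl⟩
    · rintro ⟨q, hq, h⟩
      exact (hπ.mem_iff (fun e he hc => h1 e he (hπ.isDiag_of_ctr hc)) h).1 hq

theorem IsContraction.image_subset {M M' : Set (Sym2 V)} (hM : M ⊆ G.edgeSet)
    (hM' : M' ⊆ G.edgeSet) (hd : ∀ e ∈ M, ¬ (e.map π).IsDiag) (hd' : ∀ e ∈ M', ¬ (e.map π).IsDiag)
    (h : Sym2.map π '' M ⊆ Sym2.map π '' M') : M ⊆ M' := by
  intro e he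
  obtain ⟨e', h1, h2⟩ := h ⟨e, he, rfl⟩
  exact hπ.injOn ⟨hM' h1, hd' e' h1⟩ ⟨hM he, hd e he⟩ h2 ▸ h1

theorem IsContraction.isBond_quo {N : Set (Sym2 W)} : (G.quo π).IsBond N ↔
    ∃ M, G.IsBond M ∧ (∀ e ∈ M, ¬ (e.map π).IsDiag) ∧ N = Sym2.map π '' M := by
  constructor
  · rintro ⟨h1, h2, h3⟩
    obtain ⟨M, h4, h5, rfl⟩ := hπ.isCut_quo.1 h1
    refine ⟨M, ⟨h4, Set.image_nonempty.1 h2, fun N h6 h7 h8 => ?_⟩, h5, rfl⟩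
    have h9 := h3 _ (hπ.isCut_quo.2 ⟨N, h6, fun e he => h5 e (h8 he), rfl⟩) (h7.image _)
      (Set.image_mono h8)
    exact h8.antisymm (hπ.image_subset h4.subset h6.subset h5 (fun e he => h5 e (h8 he)) h9.ge)
  · rintro ⟨M, ⟨h1, h2, h3⟩, h4, rfl⟩
    refine ⟨hπ.isCut_quo.2 ⟨M, h1, h4, rfl⟩, h2.image _, fun N h5 h6 h7 => ?_⟩
    obtain ⟨N, h8, h9, rfl⟩ := hπ.isCut_quo.1 h5
    rw [h3 N h8 (Set.image_nonempty.1 h6) (hπ.image_subset h8.subset h1.subset h9 h4 h7)]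

theorem IsContraction.isMat_image {M : Set (Sym2 V)} (hM : M ⊆ G.edgeSet)
    (hd : ∀ e ∈ M, ¬ (e.map π).IsDiag) : IsMat (Sym2.map π '' M) ↔ PiMat π M := by
  constructor
  · intro h e he f hf v hv w hw hvw
    exact hπ.injOn ⟨hM he, hd e he⟩ ⟨hM hf, hd f hf⟩ (h _ ⟨e, he, rfl⟩ _ ⟨f, hf, rfl⟩ (π v)
      (Sym2.mem_map.2 ⟨v, hv, rfl⟩) (Sym2.mem_map.2 ⟨w, hw, hvw.symm⟩))
  · rintro h _ ⟨e, he, rfl⟩ _ ⟨f, hf, rfl⟩ x hx hx'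
    obtain ⟨v, hv, rfl⟩ := Sym2.mem_map.1 hx
    obtain ⟨w, hw, hvw⟩ := Sym2.mem_map.1 hx'
    rw [h e he f hf v hv w hw hvw.symm]

/-- The solutions of `G` that survive the contraction. -/
def Kept (G : SimpleGraph V) (π : V → W) (M : Set (Sym2 V)) : Prop :=
  G.IsBond M ∧ (∀ e ∈ M, ¬ (e.map π).IsDiag) ∧ PiMat π M

omit hπ in
theorem Kept.isMat {M : Set (Sym2 V)} (h : G.Kept π M) : IsMat M :=
  fun e he f hf v hv hv' => h.2.2 e he f hf v hv v hv' rfl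

theorem IsContraction.sol_quo {N : Set (Sym2 W)} : (G.quo π).IsBond N ∧ IsMat N ↔
    ∃ M, G.Kept π M ∧ N = Sym2.map π '' M := by
  constructor
  · rintro ⟨h1, h2⟩
    obtain ⟨M, h3, h4, rfl⟩ := hπ.isBond_quo.1 h1
    exact ⟨M, ⟨h3, h4, (hπ.isMat_image h3.1.subset h4).1 h2⟩, rfl⟩
  · rintro ⟨M, h, rfl⟩
    exact ⟨hπ.isBond_quo.2 ⟨M, h.1, h.2.1, rfl⟩, (hπ.isMat_image h.1.1.subset h.2.1).2 h.2.2⟩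

theorem IsContraction.kept_inj {M M' : Set (Sym2 V)} (h : G.Kept π M) (h' : G.Kept π M')
    (he : Sym2.map π '' M = Sym2.map π '' M') : M = M' :=
  (hπ.image_subset h.1.1.subset h'.1.1.subset h.2.1 h'.2.1 he.le).antisymm
    (hπ.image_subset h'.1.1.subset h.1.1.subset h'.2.1 h.2.1 he.ge)

omit hπ in
-- Pass to the complement if necessary, so that both ends of `b` lie outside the side `A` of `M`.
-- Then the cut of `A ∩ B` consists of the edges of `M` inside `B`, and minimality of `M` makes it
-- all of `M` or empty.
theorem IsBond.sameSide {M : Set (Sym2 V)} (hM : G.IsBond M) {B : Set V} {b : Sym2 V}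
    (hB : G.cutEdges B = {b}) (hb : b ∉ M) {p q p' q' : V} (h : s(p, q) ∈ M) (h' : s(p', q') ∈ M) :
    p ∈ B ↔ p' ∈ B := by
  have key : ∀ A, M = G.cutEdges A → (∀ v ∈ b, v ∉ A) → ∀ p q p' q', s(p, q) ∈ M → s(p', q') ∈ M →
      p ∈ B → p' ∈ B := by
    intro A hA hbA p q p' q' h h' hp
    have hside : ∀ x y, s(x, y) ∈ M → (x ∈ B ↔ y ∈ B) := by
      intro x y hxy
      by_contra h2
      have h3 := mem_cutEdges.2 ⟨hM.1.subset hxy, h2⟩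
      rw [hB] at h3
      exact hb ((show s(x, y) = b from h3) ▸ hxy)
    have e1 : G.cutEdges (A ∩ B) = {e ∈ M | ∀ v ∈ e, v ∈ B} := by
      ext e
      induction e with | _ x y =>
      simp only [mem_cutEdges, Set.mem_inter_iff, Set.mem_ofPred_eq, Sym2.mem_iff, forall_eq_or_imp,
        forall_eq]
      constructor
      · rintro ⟨h1, h2⟩
        have h3 : x ∈ B ↔ y ∈ B := by
          by_contra h4
          have h5 := mem_cutEdges.2 ⟨h1, h4⟩
          rw [hB] at h5
          have h5 : s(x, y) = b := h5
          have := hbA x (h5 ▸ Sym2.mem_mk_left _ _)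
          have := hbA y (h5 ▸ Sym2.mem_mk_right _ _)
          tauto
        have h4 : s(x, y) ∈ M := hA ▸ mem_cutEdges.2 ⟨h1, by tauto⟩
        exact ⟨h4, by tauto⟩
      · rintro ⟨h1, h2, h3⟩
        have h4 := mem_cutEdges.1 (hA ▸ h1)
        exact ⟨h4.1, by tauto⟩
    have h2 : s(p, q) ∈ G.cutEdges (A ∩ B) := by
      rw [e1]
      have := hside _ _ h
      simp only [Set.mem_ofPred_eq, Sym2.mem_iff, forall_eq_or_imp, forall_eq]
      tauto
    have h3 := hM.2.2 _ ⟨_, rfl⟩ ⟨_, h2⟩ (by rw [e1]; exact Set.sep_subset _ _)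
    rw [← h3, e1] at h'
    exact h'.2 p' (Sym2.mem_mk_left _ _)
  obtain ⟨A, hA⟩ := hM.1
  have h1 : (∀ v ∈ b, v ∉ A) ∨ (∀ v ∈ b, v ∉ Aᶜ) := by
    induction b with | _ x y =>
    have hxy : G.Adj x y := by
      have : s(x, y) ∈ G.cutEdges B := hB ▸ rfl
      exact (mem_cutEdges.1 this).1
    have h2 : x ∈ A ↔ y ∈ A := by
      by_contra h2
      exact hb (hA ▸ mem_cutEdges.2 ⟨hxy, h2⟩)
    simp only [Sym2.mem_iff, forall_eq_or_imp, forall_eq, Set.mem_compl_iff]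
    tauto
  rcases h1 with h1 | h1
  · exact ⟨key A hA h1 p q p' q' h h', key A hA h1 p' q' p q h' h⟩
  · rw [← cutEdges_compl] at hA
    exact ⟨key _ hA h1 p q p' q' h h', key _ hA h1 p' q' p q h' h⟩

/-- Suppose two edges of `M` have distinct ends in the same fibre. `M` lies on one side of every
bridge, so `exists_loose_ends` gives similar loose edges at these ends; the edges of `M` are similar
to those and hence to each other, so they coincide because `M` is large. -/
theorem IsContraction.kept_of_large {M : Set (Sym2 V)} (h : G.LargeSol M)
    (hM : ∀ e ∈ M, ¬ G.Ctr ix e) : G.Kept π M := by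
  refine ⟨h.1, fun e he => ?_, fun e he e' he' p hp p' hp' hpp => ?_⟩
  · obtain ⟨A, rfl⟩ := h.1.1
    exact hπ.not_isDiag hM he
  · by_cases heq : p = p'
    · subst heq
      exact h.2.1 e he e' he' p hp hp'
    obtain ⟨q, rfl⟩ := Sym2.mem_iff_exists.1 hp
    obtain ⟨q', rfl⟩ := Sym2.mem_iff_exists.1 hp'
    have hs : G.SameSides p p' := fun b A hA =>
      h.1.sameSide hA (fun hb => hM b hb (Or.inl ⟨A, hA.symm⟩)) he he'
    obtain ⟨f, f', h1, h2, h3, h4, h5, h6, h7⟩ :=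
      exists_loose_ends ix heq ((hπ.eq_iff p p').1 hpp) hs
    exact h.1.eq_of_sim_of_three_le h.2.2 he he'
      (((h3.2.2 _ (h.1.1.subset he) (h.1.not_br h.2.2 he) ⟨p, h1, hp⟩).symm.trans h5).trans
        (h4.2.2 _ (h.1.1.subset he') (h.1.not_br h.2.2 he') ⟨p', h2, hp'⟩))

theorem IsContraction.cutConnected_quo : (G.quo π).CutConnected := by
  intro B hB
  rw [cutEdges_quo, Set.image_eq_empty] at hB
  rcases hπ.conn _ hB with h | h
  · left
    rwa [Set.preimage_eq_empty_iff, hπ.surj.range_eq, Set.disjoint_univ] at h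
  · right
    rwa [Set.preimage_eq_univ_iff, hπ.surj.range_eq, Set.univ_subset_iff] at h

end Contraction

end SimpleGraph

/-! ## The size and the solutions of the contracted graph -/

namespace SimpleGraph

variable {V W W' : Type*} {G : SimpleGraph V}

theorem IsAcyclic.ncard_edgeSet_lt [Finite V] [Nonempty V] (h : G.IsAcyclic) :
    G.edgeSet.ncard + 1 ≤ Nat.card V := by
  classical
  have := Fintype.ofFinite V
  obtain ⟨T, hGT, -, hT⟩ :=
    (connected_top (V := V)).exists_isTree_le_of_le_of_isAcyclic (H := G) le_top h
  rw [Nat.card_eq_fintype_card, ← hT.card_edgeFinset, Set.ncard_eq_toFinset_card',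
    add_le_add_iff_right]
  exact Finset.card_le_card (edgeFinset_mono hGT)

theorem exists_feedbackEdgeSet [Finite V] (G : SimpleGraph V) :
    ∃ S : Finset (Sym2 V), (S : Set (Sym2 V)) ⊆ G.edgeSet ∧
      (G.deleteEdges (S : Set (Sym2 V))).IsAcyclic ∧ S.card = G.feedbackEdgeNumber := by
  refine Nat.sInf_mem (s := {k | ∃ S : Finset (Sym2 V), (S : Set (Sym2 V)) ⊆ G.edgeSet ∧
    (G.deleteEdges (S : Set (Sym2 V))).IsAcyclic ∧ S.card = k}) ⟨_, (Set.toFinite G.edgeSet).toFinset,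
    by simp, ?_, rfl⟩
  have : G.deleteEdges ((Set.toFinite G.edgeSet).toFinset : Set (Sym2 V)) = ⊥ := by
    ext u v
    simp
  rw [this]
  exact isAcyclic_bot

theorem feedbackEdgeNumber_le {S : Finset (Sym2 V)} (h : (S : Set (Sym2 V)) ⊆ G.edgeSet)
    (h' : (G.deleteEdges (S : Set (Sym2 V))).IsAcyclic) : G.feedbackEdgeNumber ≤ S.card :=
  Nat.sInf_le ⟨S, h, h', rfl⟩

theorem feedbackEdgeNumber_le_ncard [Finite V] (G : SimpleGraph V) :
    G.feedbackEdgeNumber ≤ G.edgeSet.ncard := by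
  obtain ⟨S, h1, -, h3⟩ := exists_feedbackEdgeSet G
  rw [← h3, ← Set.ncard_coe_finset]
  exact Set.ncard_le_ncard h1 (Set.toFinite _)

theorem ncard_edgeSet_le_add_feedbackEdgeNumber [Finite V] [Nonempty V] (G : SimpleGraph V) :
    G.edgeSet.ncard + 1 ≤ Nat.card V + G.feedbackEdgeNumber := by
  obtain ⟨S, h1, h2, h3⟩ := exists_feedbackEdgeSet G
  have h4 := h2.ncard_edgeSet_lt
  rw [edgeSet_deleteEdges, Set.ncard_sdiff h1 (Set.toFinite _), Set.ncard_coe_finset, h3] at h4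
  omega

/-- Let `s` be the sum of the degrees different from 2. Vertices with such a degree number at most
`s / 3`. Every vertex of degree 2 is adjacent to one of them, so there are at most `s` of these. The
degree sum formula combines the two estimates. -/
theorem card_le_of_degree [Fintype W] (H : SimpleGraph W) [DecidableRel H.Adj]
    (h2 : ∀ w, 2 ≤ H.degree w) (h3 : ∀ w, H.degree w = 2 → ∃ x, H.Adj w x ∧ 3 ≤ H.degree x) :
    9 * Fintype.card W ≤ 8 * H.edgeFinset.card := by
  classical
  set A := Finset.univ.filter fun w => H.degree w = 2 with hA
  set B := Finset.univ.filter fun w => ¬ H.degree w = 2 with hB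
  have e1 : A.card + B.card = Fintype.card W := Finset.card_filter_add_card_filter_not _
  have e2 : ∑ w ∈ A, H.degree w + ∑ w ∈ B, H.degree w = 2 * H.edgeFinset.card := by
    rw [← H.sum_degrees_eq_twice_card_edges]
    exact Finset.sum_filter_add_sum_filter_not _ _ _
  have e3 : ∑ w ∈ A, H.degree w = 2 * A.card := by
    rw [Finset.sum_congr rfl fun w hw => (Finset.mem_filter.1 hw).2, Finset.sum_const, smul_eq_mul,
      mul_comm]
  have e4 : B.card * 3 ≤ ∑ w ∈ B, H.degree w := by
    refine Finset.card_nsmul_le_sum B _ 3 fun w hw => ?_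
    have := h2 w
    have := (Finset.mem_filter.1 hw).2
    omega
  have e5 : A.card ≤ ∑ w ∈ B, H.degree w := by
    have : A ⊆ B.biUnion fun w => H.neighborFinset w := by
      intro w hw
      obtain ⟨x, hx, hx3⟩ := h3 w (Finset.mem_filter.1 hw).2
      refine Finset.mem_biUnion.2 ⟨x, Finset.mem_filter.2 ⟨Finset.mem_univ _, by omega⟩, ?_⟩
      simpa using hx.symm
    exact (Finset.card_le_card this).trans (Finset.card_biUnion_le.trans (by simp))
  omega

theorem degree_eq_ncard [Fintype W] (H : SimpleGraph W) [DecidableRel H.Adj] (w : W) :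
    H.degree w = (H.cutEdges {w}).ncard := by
  have h1 : H.cutEdges {w} = (fun x => s(w, x)) '' (H.neighborFinset w : Set W) := by
    ext e
    constructor
    · rintro ⟨u, rfl, v, hv, h, rfl⟩
      exact ⟨v, by simpa using h, rfl⟩
    · rintro ⟨v, hv, rfl⟩
      have hv : H.Adj w v := by simpa using hv
      exact ⟨w, rfl, v, hv.ne', hv, rfl⟩
  rw [h1, Set.ncard_image_of_injective _ fun x y h => Sym2.congr_right.1 h, Set.ncard_coe_finset,
    card_neighborFinset_eq_degree]

/-! ### The size of the contracted graph -/

section Contraction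

variable {ix : Sym2 V → ℕ} {π : V → W} (hπ : G.IsContraction ix π)
include hπ

/-- The contracted edges together with a star that joins representatives of the fibres form a
connected graph on `V`; the star has fewer edges than `W` has elements. -/
theorem IsContraction.card_le [Finite V] [Nonempty V] :
    Nat.card V ≤ {e | G.Ctr ix e}.ncard + Nat.card W := by
  classical
  have hW : Finite W := Finite.of_surjective π hπ.surj
  have := Fintype.ofFinite W
  choose r hr using hπ.surj
  have v₀ : V := Classical.arbitrary V
  set b₀ := π v₀
  set T : Set (Sym2 V) := (fun b => s(r b₀, r b)) '' {b | b ≠ b₀} with hT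
  set K := G.ctrGraph ix ⊔ fromEdgeSet T with hK
  have h1 : ∀ v, K.Reachable (r b₀) v := by
    intro v
    have e1 : K.Reachable (r (π v)) v :=
      ((hπ.eq_iff _ _).1 (hr (π v))).mono le_sup_left
    refine Reachable.trans ?_ e1
    by_cases hv : π v = b₀
    · rw [hv]
    · refine Adj.reachable (Or.inr ?_)
      rw [fromEdgeSet_adj]
      refine ⟨⟨_, hv, rfl⟩, fun h => hv ?_⟩
      rw [← hr (π v), ← h, hr]
  have h2 : K.Connected := connected_iff _ |>.2 ⟨fun u v => (h1 u).symm.trans (h1 v), inferInstance⟩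
  have h3 := h2.card_vert_le_card_edgeSet_add_one
  have h4 : K.edgeSet ⊆ {e | G.Ctr ix e} ∪ T := by
    rw [hK, edgeSet_sup, ctrGraph, edgeSet_fromEdgeSet, edgeSet_fromEdgeSet]
    exact Set.union_subset_union Set.sdiff_subset Set.sdiff_subset
  have h5 : T.ncard + 1 ≤ Nat.card W := by
    have e1 : T.ncard ≤ {b | b ≠ b₀}.ncard := Set.ncard_image_le (Set.toFinite _)
    have e2 : {b | b ≠ b₀} = ({b₀} : Set W)ᶜ := rfl
    have e3 := Set.ncard_add_ncard_compl ({b₀} : Set W) (Set.toFinite _) (Set.toFinite _)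
    rw [Set.ncard_singleton] at e3
    rw [e2] at e1
    omega
  have h6 := (Set.ncard_le_ncard h4 (Set.toFinite _)).trans (Set.ncard_union_le _ _)
  have h7 : Nat.card K.edgeSet = K.edgeSet.ncard := rfl
  omega

/-- Each contracted edge lowers the number of edges by one, and the number of vertices by at most
one. -/
theorem IsContraction.ncard_quo_le [Finite V] [Nonempty V] :
    (G.quo π).edgeSet.ncard + 1 ≤ Nat.card W + G.feedbackEdgeNumber := by
  have h1 := hπ.card_le
  have h2 := ncard_edgeSet_le_add_feedbackEdgeNumber G
  have h3 : (G.quo π).edgeSet.ncard + {e | G.Ctr ix e}.ncard ≤ G.edgeSet.ncard := by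
    rw [edgeSet_quo]
    refine (Nat.add_le_add_right (Set.ncard_image_le (Set.toFinite _)) _).trans ?_
    rw [← Set.ncard_union_eq _ (Set.toFinite _) (Set.toFinite _)]
    · refine Set.ncard_le_ncard (Set.union_subset (Set.sep_subset _ _) fun e he => ?_)
        (Set.toFinite _)
      exact Ctr.mem_edgeSet he
    · rw [Set.disjoint_left]
      exact fun e he hc => he.2 (hπ.isDiag_of_ctr hc)
  omega

/-- A bridge of the quotient pulls back to a bridge of `G` that is not contracted. -/
theorem IsContraction.not_br_quo (x : Sym2 W) : ¬ (G.quo π).Br x := by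
  intro h
  obtain ⟨M, h1, h2, h3⟩ := hπ.isCut_quo.1 h
  have h4 : x ∈ Sym2.map π '' M := h3 ▸ rfl
  obtain ⟨e, he, rfl⟩ := h4
  have h5 : M = {e} := by
    refine (Set.subset_singleton_iff_eq.1 fun f hf => ?_).resolve_left (Set.nonempty_iff_ne_empty.1 ⟨e, he⟩)
    have h6 : Sym2.map π f ∈ ({Sym2.map π e} : Set (Sym2 W)) := h3 ▸ ⟨f, hf, rfl⟩
    exact hπ.injOn ⟨h1.subset hf, h2 f hf⟩ ⟨h1.subset he, h2 e he⟩ h6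
  exact h2 e he (hπ.isDiag_of_ctr (Or.inl (show G.IsCut {e} from h5 ▸ h1)))

/-- As `π` is injective on the surviving edges, exactly two edges leave the fibre, and these two
form a cut. -/
theorem IsContraction.isCut_fiber {w : W} (hw : ((G.quo π).cutEdges {w}).ncard = 2)
    {e f : Sym2 V} (he : e ∈ G.cutEdges (π ⁻¹' {w})) (hf : f ∈ G.cutEdges (π ⁻¹' {w})) :
    G.Sim e f := by
  by_cases hne : e = f
  · exact Or.inl hne
  right
  refine ⟨π ⁻¹' {w}, ?_⟩
  have hd : ∀ g ∈ G.cutEdges (π ⁻¹' {w}), g ∈ {e ∈ G.edgeSet | ¬ (e.map π).IsDiag} := by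
    intro g hg
    refine ⟨cutEdges_subset _ hg, fun h => ?_⟩
    induction g with | _ p q =>
    refine (mem_cutEdges.1 hg).2 ?_
    simp only [Set.mem_preimage]
    rw [show π p = π q from h]
  rw [cutEdges_quo, Set.InjOn.ncard_image fun a ha b hb hab => hπ.injOn (hd a ha) (hd b hb) hab]
    at hw
  have hfin : (G.cutEdges (π ⁻¹' {w})).Finite := Set.finite_of_ncard_pos (by omega)
  exact Set.eq_of_subset_of_ncard_le (by simp [Set.insert_subset_iff, he, hf])
    (by rw [hw, Set.ncard_pair hne]) hfin

omit hπ in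
theorem mem_cutEdges_fiber {v : V} {e : Sym2 V} (h : e ∈ G.edgeSet) (hv : v ∈ e)
    (hne : ¬ (e.map π).IsDiag) : e ∈ G.cutEdges (π ⁻¹' {π v}) := by
  obtain ⟨q, rfl⟩ := Sym2.mem_iff_exists.1 hv
  have hne : π v ≠ π q := hne
  exact mem_cutEdges.2 ⟨h, by simp [hne.symm]⟩

/-- An adjacent non-bridge at `v` may stay inside the fibre of `v`; then there is a loose edge at
`v` to which both edges are similar. Or it leaves the fibre, and then `IsContraction.isCut_fiber`
applies, since the fibres of both ends have degree 2. -/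
theorem IsContraction.loose_of_degree {p q : V} (h : G.Adj p q) (hne : π p ≠ π q)
    (hp : ((G.quo π).cutEdges {π p}).ncard = 2) (hq : ((G.quo π).cutEdges {π q}).ncard = 2) :
    G.Loose s(p, q) := by
  have hbr : ¬ G.Br s(p, q) := fun hb => hne (hπ.isDiag_of_ctr (Or.inl hb))
  refine ⟨h, hbr, ?_⟩
  rintro e' he' hbr' ⟨v, hv, hv'⟩
  have hv2 : ((G.quo π).cutEdges {π v}).ncard = 2 := by
    rcases Sym2.mem_iff.1 hv with rfl | rfl
    · exact hp
    · exact hq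
  by_cases hd : (e'.map π).IsDiag
  · obtain ⟨z, rfl⟩ := Sym2.mem_iff_exists.1 hv'
    obtain ⟨f, f', h1, h2, h3, -⟩ := hπ.exists_loose_of_isDiag he' hbr' hd
    exact (h3.2.2 _ h hbr ⟨v, h1, hv⟩).symm.trans (h3.2.2 _ he' hbr' ⟨v, h1, hv'⟩)
  · exact hπ.isCut_fiber hv2 (mem_cutEdges_fiber h hv hne) (mem_cutEdges_fiber he' hv' hd)

/-- If a vertex of degree 2 had only neighbours of degree 2, its two edges would come from loose,
similar, uncontracted edges of `G`, which have to be equal. So `card_le_of_degree` applies and is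
combined with `IsContraction.ncard_quo_le`. The summand 1 covers the quotient with a single vertex.
-/
theorem IsContraction.card_quo_le [Finite V] [Nonempty V] :
    Nat.card W ≤ 8 * G.feedbackEdgeNumber + 1 := by
  classical
  have hW : Finite W := Finite.of_surjective π hπ.surj
  have := Fintype.ofFinite W
  by_cases hcard : Nat.card W ≤ 1
  · omega
  have hnt : Nontrivial W := by
    rw [Nat.card_eq_fintype_card] at hcard
    exact Fintype.one_lt_card_iff_nontrivial.1 (by omega)
  set H := G.quo π with hH
  have hdeg : ∀ w, 2 ≤ H.degree w := by
    intro w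
    rw [degree_eq_ncard]
    by_contra hlt
    have h1 : (H.cutEdges {w}).ncard = 0 ∨ (H.cutEdges {w}).ncard = 1 := by omega
    rcases h1 with h1 | h1
    · rw [Set.ncard_eq_zero (Set.toFinite _)] at h1
      rcases hπ.cutConnected_quo _ h1 with h2 | h2
      · exact Set.singleton_ne_empty w h2
      · obtain ⟨x, hx⟩ := exists_ne w
        exact hx (show x ∈ ({w} : Set W) from h2 ▸ Set.mem_univ x)
    · obtain ⟨x, hx⟩ := Set.ncard_eq_one.1 h1
      exact hπ.not_br_quo x ⟨{w}, hx.symm⟩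
  have h3 : ∀ w, H.degree w = 2 → ∃ x, H.Adj w x ∧ 3 ≤ H.degree x := by
    intro w hw
    by_contra hcon
    push Not at hcon
    have hcon : ∀ x, H.Adj w x → (H.cutEdges {x}).ncard = 2 := fun x hx => by
      have h1 := hcon x hx
      have h2 := hdeg x
      rw [degree_eq_ncard] at h1 h2
      omega
    have hw' := hw
    rw [degree_eq_ncard] at hw'
    rw [← card_neighborFinset_eq_degree] at hw
    obtain ⟨a, b, hab, hN⟩ := Finset.card_eq_two.1 hw
    have ha : H.Adj w a := by rw [← mem_neighborFinset, hN]; simp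
    have hb : H.Adj w b := by rw [← mem_neighborFinset, hN]; simp
    obtain ⟨hwa, p, q, rfl, rfl, hpq⟩ := ha
    obtain ⟨hwb, p', q', hp', rfl, hpq'⟩ := hb
    have hb : H.Adj (π p) (π q') := ⟨hwb, p', q', hp', rfl, hpq'⟩
    have ha : H.Adj (π p) (π q) := ⟨hwa, p, q, rfl, rfl, hpq⟩
    rw [← hp'] at hwb
    have l1 := hπ.loose_of_degree hpq hwa hw' (hcon _ ha)
    have l2 := hπ.loose_of_degree hpq' hwb (hp' ▸ hw') (hcon _ hb)
    have l3 : G.Sim s(p, q) s(p', q') := hπ.isCut_fiber hw'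
      (mem_cutEdges_fiber hpq (Sym2.mem_mk_left _ _) hwa)
      (hp' ▸ mem_cutEdges_fiber hpq' (Sym2.mem_mk_left _ _) hwb)
    have l4 := eq_of_sim_of_not_ctr ix hπ.inj l1 l2 l3 (fun h => hwa (hπ.isDiag_of_ctr h))
      (fun h => hwb (hπ.isDiag_of_ctr h))
    have l5 : s(π p, π q) = s(π p', π q') := congrArg (Sym2.map π) l4
    rw [hp'] at l5
    exact hab (Sym2.congr_right.1 l5)
  have h4 := card_le_of_degree H hdeg h3
  have h5 := hπ.ncard_quo_le
  rw [Set.ncard_eq_toFinset_card'] at h5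
  rw [Nat.card_eq_fintype_card] at *
  have h6 : (G.quo π).edgeSet.toFinset.card = H.edgeFinset.card := by
    simp only [edgeFinset, hH]
  omega

end Contraction

/-- `H'` arises from `H` by adding the pendant vertex `z` at `w₀`. -/
structure IsPendant (H : SimpleGraph W) (H' : SimpleGraph W') (ι : W → W') (z : W') (w₀ : W) :
    Prop where
  inj : Function.Injective ι
  ne : ∀ w, ι w ≠ z
  cover : ∀ x, x = z ∨ ∃ w, ι w = x
  adj : ∀ a b, H'.Adj (ι a) (ι b) ↔ H.Adj a b
  adj_z : ∀ x, H'.Adj z x ↔ x = ι w₀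

/-! ### Adding a pendant vertex -/

section Pendant

variable {H : SimpleGraph W} {H' : SimpleGraph W'} {ι : W → W'} {z : W'} {w₀ : W}
  (hp : IsPendant H H' ι z w₀)
include hp

theorem IsPendant.map_mem_cutEdges {e : Sym2 W} {A : Set W'} :
    Sym2.map ι e ∈ H'.cutEdges A ↔ e ∈ H.cutEdges (ι ⁻¹' A) := by
  induction e with | _ a b =>
  simp only [Sym2.map_mk, mem_cutEdges, hp.adj, Set.mem_preimage]

theorem IsPendant.edge_cases {x : Sym2 W'} (hx : x ∈ H'.edgeSet) :
    x = s(z, ι w₀) ∨ ∃ e, x = Sym2.map ι e := by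
  induction x with | _ a b =>
  rcases hp.cover a with rfl | ⟨a, rfl⟩
  · exact Or.inl (by rw [(hp.adj_z b).1 hx])
  rcases hp.cover b with rfl | ⟨b, rfl⟩
  · have hx : H'.Adj (ι a) b := hx
    exact Or.inl (by rw [(hp.adj_z _).1 hx.symm, Sym2.eq_swap])
  · exact Or.inr ⟨s(a, b), rfl⟩

theorem IsPendant.map_ne (e : Sym2 W) : Sym2.map ι e ≠ s(z, ι w₀) := by
  intro h
  have h1 : z ∈ Sym2.map ι e := h ▸ Sym2.mem_mk_left _ _
  obtain ⟨w, -, hw⟩ := Sym2.mem_map.1 h1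
  exact hp.ne w hw

theorem IsPendant.cutEdges_eq {A : Set W'} (h : s(z, ι w₀) ∉ H'.cutEdges A) :
    H'.cutEdges A = Sym2.map ι '' H.cutEdges (ι ⁻¹' A) := by
  ext x
  constructor
  · intro hx
    rcases hp.edge_cases (cutEdges_subset _ hx) with rfl | ⟨e, rfl⟩
    · exact absurd hx h
    · exact ⟨e, hp.map_mem_cutEdges.1 hx, rfl⟩
  · rintro ⟨e, he, rfl⟩
    exact hp.map_mem_cutEdges.2 he

theorem IsPendant.isCut_map {M : Set (Sym2 W)} (hM : H.IsCut M) : H'.IsCut (Sym2.map ι '' M) := by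
  obtain ⟨B, rfl⟩ := hM
  refine ⟨ι '' B ∪ {x | x = z ∧ w₀ ∈ B}, ?_⟩
  have h1 : ι ⁻¹' (ι '' B ∪ {x | x = z ∧ w₀ ∈ B}) = B := by
    ext w
    simp [hp.inj.eq_iff, hp.ne]
  rw [hp.cutEdges_eq, h1]
  rw [mem_cutEdges]
  rintro ⟨-, h2⟩
  apply h2
  simp only [Set.mem_union, Set.mem_image, Set.mem_ofPred_eq, hp.ne, and_false, exists_false,
    true_and, false_or, hp.inj.eq_iff, exists_eq_right, false_and, or_false]

theorem IsPendant.isCut_pendant : H'.IsCut {s(z, ι w₀)} := by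
  refine ⟨{z}, ?_⟩
  ext x
  constructor
  · rintro rfl
    exact mem_cutEdges.2 ⟨(hp.adj_z _).2 rfl, by simp [hp.ne]⟩
  · intro hx
    rcases hp.edge_cases (cutEdges_subset _ hx) with h | ⟨e, rfl⟩
    · exact h
    · induction e with | _ a b =>
      have := (mem_cutEdges.1 hx).2
      simp [hp.ne] at this

theorem IsPendant.cutConnected (hH : H.CutConnected) : H'.CutConnected := by
  intro A hA
  have h1 : s(z, ι w₀) ∉ H'.cutEdges A := by simp [hA]
  have h2 : z ∈ A ↔ ι w₀ ∈ A := by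
    by_contra h
    exact h1 (mem_cutEdges.2 ⟨(hp.adj_z _).2 rfl, h⟩)
  have h3 := hp.cutEdges_eq h1
  rw [hA, eq_comm, Set.image_eq_empty] at h3
  rcases hH _ h3 with h4 | h4
  · left
    refine Set.eq_empty_iff_forall_notMem.2 fun x hx => ?_
    have h5 : ∀ w, ι w ∉ A := fun w hw => Set.notMem_empty w (h4 ▸ hw)
    rcases hp.cover x with rfl | ⟨w, rfl⟩
    · exact h5 _ (h2.1 hx)
    · exact h5 w hx
  · right
    refine Set.eq_univ_iff_forall.2 fun x => ?_
    have h5 : ∀ w, ι w ∈ A := fun w => Set.eq_univ_iff_forall.1 h4 w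
    rcases hp.cover x with rfl | ⟨w, rfl⟩
    · exact h2.2 (h5 _)
    · exact h5 w

/-- The pendant edge is a bridge, thus a bond by itself and contained in no other one. Cuts without
it are the images of the cuts of `H`. -/
theorem IsPendant.isBond_iff (N : Set (Sym2 W')) :
    H'.IsBond N ↔ N = {s(z, ι w₀)} ∨ ∃ M, H.IsBond M ∧ N = Sym2.map ι '' M := by
  have hinj : Function.Injective (Sym2.map ι) := Sym2.map.injective hp.inj
  constructor
  · intro hN
    by_cases hz : s(z, ι w₀) ∈ N
    · exact Or.inl (hN.eq_of_br hz hp.isCut_pendant)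
    · right
      obtain ⟨h1, h2, h3⟩ := hN
      obtain ⟨A, rfl⟩ := h1
      rw [hp.cutEdges_eq hz] at h2 h3 ⊢
      refine ⟨_, ⟨⟨_, rfl⟩, Set.image_nonempty.1 h2, fun D h4 h5 h6 => ?_⟩, rfl⟩
      exact hinj.image_injective (h3 _ (hp.isCut_map h4) (h5.image _) (Set.image_mono h6))
  · rintro (rfl | ⟨M, ⟨h1, h2, h3⟩, rfl⟩)
    · exact Br.isBond hp.isCut_pendant
    · refine ⟨hp.isCut_map h1, h2.image _, fun D h4 h5 h6 => ?_⟩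
      have hz : s(z, ι w₀) ∉ D := fun h => by
        obtain ⟨e, -, he⟩ := h6 h
        exact hp.map_ne e he
      obtain ⟨A, rfl⟩ := h4
      rw [hp.cutEdges_eq hz] at h5 h6 ⊢
      rw [h3 _ ⟨_, rfl⟩ (Set.image_nonempty.1 h5) ((Set.image_subset_image_iff hinj).1 h6)]

end Pendant

theorem isMat_map_image {ι : W → W'} (hι : Function.Injective ι) (M : Set (Sym2 W)) :
    IsMat (Sym2.map ι '' M) ↔ IsMat M := by
  constructor
  · intro h e he f hf v hv hv'
    exact Sym2.map.injective hι (h _ ⟨e, he, rfl⟩ _ ⟨f, hf, rfl⟩ (ι v)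
      (Sym2.mem_map.2 ⟨v, hv, rfl⟩) (Sym2.mem_map.2 ⟨v, hv', rfl⟩))
  · rintro h _ ⟨e, he, rfl⟩ _ ⟨f, hf, rfl⟩ x hx hx'
    obtain ⟨v, hv, rfl⟩ := Sym2.mem_map.1 hx
    obtain ⟨w, hw, hvw⟩ := Sym2.mem_map.1 hx'
    rw [h e he f hf v hv (hι hvw ▸ hw)]

/-- The solutions with at most two edges that do not survive the contraction. -/
def LostSol (G : SimpleGraph V) (π : V → W) (M : Set (Sym2 V)) : Prop :=
  G.IsBond M ∧ IsMat M ∧ M.ncard < 3 ∧ ¬ G.Kept π M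

/-- The graph `H'` with the map `k` from the vertices of `G` and the edge set `pend` is a kernel
of `G`. -/
structure IsKernel (G : SimpleGraph V) (ix : Sym2 V → ℕ) (π : V → W) (H' : SimpleGraph W')
    (k : V → W') (pend : Set (Sym2 W')) : Prop where
  contr : G.IsContraction ix π
  sol : ∀ N, H'.IsMinimalMatchingCut N ↔
    (∃ M, G.Kept π M ∧ N = Sym2.map k '' M) ∨ (∃ M, G.LostSol π M) ∧ N = pend
  pend_ne : (∃ M, G.LostSol π M) → ∀ M, Sym2.map k '' M ≠ pend
  inj : ∀ M M', G.Kept π M → G.Kept π M' → Sym2.map k '' M = Sym2.map k '' M' → M = M'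

theorem IsContraction.isKernel_of_pendant {ix : Sym2 V → ℕ} {π : V → W}
    (hπ : G.IsContraction ix π) {H' : SimpleGraph W'} {ι : W → W'} {z : W'} {w₀ : W}
    (hp : IsPendant (G.quo π) H' ι z w₀) (hl : ∃ M, G.LostSol π M) :
    G.IsKernel ix π H' (ι ∘ π) {s(z, ι w₀)} := by
  have hm : ∀ M, Sym2.map (ι ∘ π) '' M = Sym2.map ι '' (Sym2.map π '' M) := fun M => by
    rw [Set.image_image, Sym2.map_comp]; rfl
  refine ⟨hπ, fun N => ?_, fun _ M h => ?_, fun M M' h h' he => ?_⟩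
  · rw [isMinimalMatchingCut_iff (hp.cutConnected hπ.cutConnected_quo), hp.isBond_iff]
    constructor
    · rintro ⟨rfl | ⟨M, h1, rfl⟩, h2⟩
      · exact Or.inr ⟨hl, rfl⟩
      · obtain ⟨M, h3, rfl⟩ := hπ.sol_quo.1 ⟨h1, (isMat_map_image hp.inj M).1 h2⟩
        exact Or.inl ⟨M, h3, (hm M).symm⟩
    · rintro (⟨M, h1, rfl⟩ | ⟨-, rfl⟩)
      · obtain ⟨h2, h3⟩ := hπ.sol_quo.2 ⟨M, h1, rfl⟩
        rw [hm]
        exact ⟨Or.inr ⟨_, h2, rfl⟩, (isMat_map_image hp.inj _).2 h3⟩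
      · exact ⟨Or.inl rfl, by rintro e rfl f rfl _ _ _; rfl⟩
  · have h1 : s(z, ι w₀) ∈ Sym2.map (ι ∘ π) '' M := h ▸ rfl
    rw [hm] at h1
    obtain ⟨e, -, he⟩ := h1
    exact hp.map_ne e he
  · rw [hm, hm] at he
    exact hπ.kept_inj h h' ((Sym2.map.injective hp.inj).image_injective he)

theorem IsContraction.isKernel {ix : Sym2 V → ℕ} {π : V → W}
    (hπ : G.IsContraction ix π) (hl : ¬ ∃ M, G.LostSol π M) :
    G.IsKernel ix π (G.quo π) π ∅ := by
  refine ⟨hπ, fun N => ?_, fun h => absurd h hl, fun M M' h h' he => hπ.kept_inj h h' he⟩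
  rw [isMinimalMatchingCut_iff hπ.cutConnected_quo, hπ.sol_quo]
  simp [hl]

/-! ### The representation of solutions by solutions of the kernel -/

section Kernel

variable {ix : Sym2 V → ℕ} {π : V → W} {H' : SimpleGraph W'} {k : V → W'} {pend : Set (Sym2 W')}

open Classical in
/-- The solution of the kernel that represents a solution of `G`. -/
noncomputable def reprSol (G : SimpleGraph V) (ix : Sym2 V → ℕ) (π : V → W) (k : V → W')
    (pend : Set (Sym2 W')) (M : Set (Sym2 V)) : Set (Sym2 W') :=
  if 3 ≤ M.ncard then Sym2.map k '' (G.star ix '' M) else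
    if G.Kept π M then Sym2.map k '' M else pend

variable (hk : G.IsKernel ix π H' k pend)
include hk

theorem IsKernel.kept_star [Finite V] {M : Set (Sym2 V)} (h : G.LargeSol M) :
    G.Kept π (G.star ix '' M) ∧ 3 ≤ (G.star ix '' M).ncard := by
  have h1 := h.exchange (isExchange_star ix M)
  refine ⟨hk.contr.kept_of_large h1 ?_, h1.2.2⟩
  rintro _ ⟨e, he, rfl⟩
  exact not_ctr_star ix (h.1.not_br h.2.2 he)

theorem Kept.not_ctr {M : Set (Sym2 V)} (h : G.Kept π M) {e : Sym2 V} (he : e ∈ M) :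
    ¬ G.Ctr ix e := fun hc => h.2.1 e he (hk.contr.isDiag_of_ctr hc)

theorem IsKernel.star_image {M : Set (Sym2 V)} (h : G.Kept π M) : G.star ix '' M = M := by
  rw [Set.image_congr fun e he => star_eq_self ix hk.contr.inj (h.not_ctr hk he), Set.image_id']

theorem IsKernel.reprSol_kept {M : Set (Sym2 V)} (h : G.Kept π M) :
    G.reprSol ix π k pend M = Sym2.map k '' M := by
  unfold reprSol
  split_ifs
  · rw [hk.star_image h]
  · rfl

theorem IsKernel.minimalMatchingCut_of_kept {M : Set (Sym2 V)} (h : G.Kept π M) :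
    G.IsMinimalMatchingCut M :=
  (isMinimalMatchingCut_iff hk.contr.conn M).2 ⟨h.1, h.isMat⟩

/-- Once this is known, the fibres of `reprSol` can serve as the classes of the required partition.
-/
theorem IsKernel.reprSol_surj [Finite V] :
    G.reprSol ix π k pend '' {M | G.IsMinimalMatchingCut M} = {N | H'.IsMinimalMatchingCut N} := by
  ext N
  simp only [Set.mem_image, Set.mem_ofPred_eq, hk.sol]
  constructor
  · rintro ⟨M, hM, rfl⟩
    obtain ⟨h1, h2⟩ := (isMinimalMatchingCut_iff hk.contr.conn M).1 hM
    unfold reprSol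
    split_ifs with h3 h4
    · exact Or.inl ⟨_, (hk.kept_star ⟨h1, h2, h3⟩).1, rfl⟩
    · exact Or.inl ⟨M, h4, rfl⟩
    · exact Or.inr ⟨⟨M, h1, h2, by omega, h4⟩, rfl⟩
  · rintro (⟨M, h1, rfl⟩ | ⟨⟨M, h1⟩, rfl⟩)
    · exact ⟨M, hk.minimalMatchingCut_of_kept h1, hk.reprSol_kept h1⟩
    · refine ⟨M, (isMinimalMatchingCut_iff hk.contr.conn M).2 ⟨h1.1, h1.2.1⟩, ?_⟩
      have := h1.2.2.1
      unfold reprSol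
      rw [if_neg (by omega), if_neg h1.2.2.2]

theorem IsKernel.reprSol_eq_pend [Finite V] (hl : ∃ M, G.LostSol π M) {M : Set (Sym2 V)} :
    G.IsMinimalMatchingCut M ∧ G.reprSol ix π k pend M = pend ↔ G.LostSol π M := by
  rw [isMinimalMatchingCut_iff hk.contr.conn M]
  constructor
  · rintro ⟨⟨h1, h2⟩, h3⟩
    unfold reprSol at h3
    split_ifs at h3 with h4 h5
    · exact absurd h3 (hk.pend_ne hl _)
    · exact absurd h3 (hk.pend_ne hl _)
    · exact ⟨h1, h2, by omega, h5⟩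
  · rintro ⟨h1, h2, h3, h4⟩
    refine ⟨⟨h1, h2⟩, ?_⟩
    unfold reprSol
    rw [if_neg (by omega), if_neg h4]

/-- Canonical forms of large solutions are large, and `k` is injective on kept solutions. Hence a
large kept solution represents exactly its exchanges, and a small one only itself. -/
theorem IsKernel.reprSol_eq_image [Finite V] {M₀ : Set (Sym2 V)} (h₀ : G.Kept π M₀)
    {M : Set (Sym2 V)} :
    G.IsMinimalMatchingCut M ∧ G.reprSol ix π k pend M = Sym2.map k '' M₀ ↔
      if 3 ≤ M₀.ncard then ∃ c, G.IsExchange M₀ c ∧ M = c '' M₀ else M = M₀ := by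
  rw [isMinimalMatchingCut_iff hk.contr.conn M]
  by_cases hM₀ : 3 ≤ M₀.ncard
  · rw [if_pos hM₀, ← largeSol_star_iff ix hk.contr.inj ⟨h₀.1, h₀.isMat, hM₀⟩
      fun e he => h₀.not_ctr hk he]
    constructor
    · rintro ⟨⟨h1, h2⟩, h3⟩
      unfold reprSol at h3
      split_ifs at h3 with h4 h5
      · exact ⟨⟨h1, h2, h4⟩, hk.inj _ _ (hk.kept_star ⟨h1, h2, h4⟩).1 h₀ h3⟩
      · exact absurd hM₀ (hk.inj _ _ h5 h₀ h3 ▸ h4)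
      · exact absurd h3.symm (hk.pend_ne ⟨M, h1, h2, by omega, h5⟩ _)
    · rintro ⟨h1, h2⟩
      refine ⟨⟨h1.1, h1.2.1⟩, ?_⟩
      unfold reprSol
      rw [if_pos h1.2.2, h2]
  · rw [if_neg hM₀]
    constructor
    · rintro ⟨⟨h1, h2⟩, h3⟩
      unfold reprSol at h3
      split_ifs at h3 with h4 h5
      · have h6 := hk.kept_star ⟨h1, h2, h4⟩
        rw [hk.inj _ _ h6.1 h₀ h3] at h6
        exact absurd h6.2 hM₀
      · exact hk.inj _ _ h5 h₀ h3
      · exact absurd h3.symm (hk.pend_ne ⟨M, h1, h2, by omega, h5⟩ _)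
    · rintro rfl
      exact ⟨⟨h₀.1, h₀.isMat⟩, hk.reprSol_kept h₀⟩

end Kernel

end SimpleGraph

theorem isPartitionBy_image {α : Type*} {X : Set α} {Y : Set (List Bool)} (enc : α → List Bool)
    (henc : Set.InjOn enc X) (r : α → List Bool) (hr : r '' X = Y) :
    IsPartitionBy Y (enc '' X) fun s => enc '' {a ∈ X | r a = s} := by
  refine ⟨?_, ?_, ?_⟩
  · intro s hs
    rw [← hr] at hs
    obtain ⟨a, ha, rfl⟩ := hs
    exact ⟨enc a, a, ⟨ha, rfl⟩, rfl⟩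
  · intro s _ t _ hst
    rw [Set.disjoint_left]
    rintro _ ⟨a, ⟨ha, rfl⟩, rfl⟩ ⟨b, ⟨hb, rfl⟩, h⟩
    exact hst (congrArg r (henc hb ha h)).symm
  · ext w
    simp only [Set.mem_iUnion, exists_prop]
    constructor
    · rintro ⟨s, -, a, ⟨ha, -⟩, rfl⟩
      exact ⟨a, ha, rfl⟩
    · rintro ⟨a, ha, rfl⟩
      exact ⟨r a, hr ▸ ⟨a, ha, rfl⟩, a, ⟨ha, rfl⟩, rfl⟩

/-! ## Whole programs -/

namespace RAM

/-- The input strings in the arrays `0`, `1`, `2`, and their lengths in the array `3`. -/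
def initMem (ws : List (List Bool)) : Mem := fun a i j =>
  if i = 0 then if (a : ℕ) = 3 then if j < 3 then (ws.getD j []).length else 0
    else ((ws.getD a []).getD j false).toNat else 0

/-- The bound for all loops. -/
def bnd (ws : List (List Bool)) : ℕ :=
  3 * ((ws.getD 0 []).length + (ws.getD 1 []).length + (ws.getD 2 []).length) + 10

def totalLength : Expr := .plus (.reg 0) (.plus (.reg 1) (.reg 2))

/-- Sets up the memory of the data-parallel language. -/
def prelude : Prog :=
  .seq (.store (.lit 3) (.lit 0) (.reg 0)) (.seq (.store (.lit 3) (.lit 1) (.reg 1))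
    (.seq (.store (.lit 3) (.lit 2) (.reg 2))
      (.seq (.assign 0 (.plus totalLength (.plus totalLength (.plus totalLength (.lit 10)))))
        (.assign 1 (.lit 0)))))

/-- Row 0 of array `a` is the machine array `a`, so the input strings are already in place. The
lengths are saved before register 0 is overwritten with the loop bound and register 1 with the
common initial value 0 of the local variables. -/
theorem exe_prelude (ws : List (List Bool)) (hws : ws.length ≤ 3) {p : Prog} {o T Q}
    (h : ∀ σ, Rel (bnd ws) (initMem ws) σ → Vars (fun _ => 0) (fun _ => 1) 2 σ → Exe p σ o T Q) :
    Exe (.seq prelude p) (start ws) o (5 + T) Q := by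
  have : Exe prelude (start ws) [] (1 + (1 + (1 + (1 + 1)))) fun σ =>
      Rel (bnd ws) (initMem ws) σ ∧ Vars (fun _ => 0) (fun _ => 1) 2 σ := by
    refine Exe.seq_nil (Exe.store (Exe.seq_nil (Exe.store (Exe.seq_nil (Exe.store
      (Exe.seq_nil (Exe.assign (Exe.assign ⟨⟨?_, ?_⟩, ?_⟩))))))))
    · simp only [State.setReg, State.setCell, Expr.eval, totalLength, start, bnd]
      simp only [Function.update_of_ne (show (0 : ℕ) ≠ 1 by decide), Function.update_self]
      ring
    · intro a i j
      simp only [State.setReg, State.setCell, Expr.eval, start, initMem]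
      by_cases h3 : (a : ℕ) + 64 * i = 3
      · have h4 : (a : ℕ) = 3 := by omega
        have h5 : i = 0 := by omega
        have h6 : ws.getD 3 [] = [] := by
          rw [List.getD_eq_default]; exact hws
        simp only [h4, h5, Function.update_self, if_true, Function.update_apply, h6]
        by_cases e0 : j = 0
        · subst e0; simp
        by_cases e1 : j = 1
        · subst e1; simp
        by_cases e2 : j = 2
        · subst e2; simp
        simp [e0, e1, e2, (show ¬ j < 3 by omega)]
      · simp only [Function.update_of_ne h3]
        by_cases hi : i = 0
        · subst hi
          simp only [mul_zero, add_zero] at h3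
          simp [h3]
        · have h6 : ws.getD (a + 64 * i) [] = [] := by
            rw [List.getD_eq_default]; omega
          rw [h6]
          simp [hi]
    · intro v
      simp [State.setReg, Expr.eval]
  exact Exe.seq_nil (Exe.mono this le_rfl fun σ hσ => h σ hσ.1 hσ.2)

/-- The program that runs a command. -/
def Cmd.prog (c : Cmd) : Prog := .seq prelude (c.comp (fun _ => 1) 2)

theorem Cmd.exe_prog (c : Cmd) (ws : List (List Bool)) (hws : ws.length ≤ 3) :
    Exe c.prog (start ws) (c.out (bnd ws) (fun _ => 0) (initMem ws))
      (5 + c.cost.eval (bnd ws)) fun _ => True :=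
  exe_prelude ws hws fun _ h1 h2 =>
    Exe.mono (c.exe _ _ _ _ _ _ one_le_two h1 h2) le_rfl fun _ _ => trivial

/-- All delays are at most `B`, if `d` steps have been made before. -/
def DelaysLe (d B : ℕ) (τ : List Event) : Prop := ∀ x ∈ delaysFrom d τ, x ≤ B

theorem DelaysLe.append {B : ℕ} {τ' : List Event} : ∀ {τ : List Event} {d : ℕ},
    d + time τ ≤ B → (∀ d' ≤ d + time τ, DelaysLe d' B τ') → DelaysLe d B (τ ++ τ')
  | [], d, _, h' => h' d (Nat.le_add_right _ _)
  | .tick :: τ, d, h, h' => by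
    simp only [time] at h h'
    have := DelaysLe.append (τ := τ) (d := d + 1) (by omega) fun d' hd => h' d' (by omega)
    exact this
  | .out w :: τ, d, h, h' => by
    simp only [time] at h h'
    have := DelaysLe.append (τ := τ) (d := 0) (by omega) fun d' hd => h' d' (by omega)
    intro x hx
    rcases List.mem_cons.1 hx with rfl | hx
    · omega
    · exact this x hx

/-- An output inside `τ` resets the delay, so what `τ'` inherits is bounded by the duration of `τ`,
whatever the value of `d`. -/
theorem DelaysLe.append_of_outputs {B : ℕ} {τ' : List Event} : ∀ {τ : List Event} {d : ℕ},
    outputs τ ≠ [] → d + time τ ≤ B → (∀ d' ≤ time τ, DelaysLe d' B τ') → DelaysLe d B (τ ++ τ')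
  | [], d, h0, _, _ => absurd rfl h0
  | .tick :: τ, d, h0, h, h' => by
    simp only [time] at h h'
    have := DelaysLe.append_of_outputs (τ := τ) (d := d + 1) h0 (by omega)
      fun d' hd => h' d' (by omega)
    exact this
  | .out w :: τ, d, h0, h, h' => by
    simp only [time] at h h'
    have := DelaysLe.append (τ := τ) (d := 0) (by omega) fun d' hd => h' d' (by omega)
    intro x hx
    rcases List.mem_cons.1 hx with rfl | hx
    · omega
    · exact this x hx

/-- The cell `(0, 0)` of the array `31` controls the main loop. -/
def flag : Expr := .cell (.lit 31) (.lit 0)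

/-- The iteration of a command from the memory `u` as long as the flag is set outputs `l`, and
each round has an output. -/
inductive Enumerates (N : ℕ) (c : Cmd) : Mem → List (List Bool) → Prop where
  | finish (u) : u 31 0 0 = 0 → Enumerates N c u []
  | step (u l) : u 31 0 0 ≠ 0 → c.out N (fun _ => 0) u ≠ [] →
      Enumerates N c (c.st N (fun _ => 0) u) l → Enumerates N c u (c.out N (fun _ => 0) u ++ l)

/-- Every round has an output and takes at most `D` steps, so the time between two outputs is
covered by the end of one round, a test, and the beginning of the next round. -/
theorem Enumerates.exec {N : ℕ} {c : Cmd} {u : Mem} {l : List (List Bool)}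
    (h : Enumerates N c u l) {D : ℕ} (hD : c.cost.eval N ≤ D) : ∀ σ, Rel N u σ →
      Vars (fun _ => 0) (fun _ => 1) 2 σ →
      ∃ τ σ', Exec (.loop flag (c.comp (fun _ => 1) 2)) σ τ σ' ∧ outputs τ = l ∧
        ∀ d ≤ D, DelaysLe d (2 * D + 1) τ := by
  have hf : ∀ u σ, Rel N u σ → flag.eval σ = u 31 0 0 := fun u σ h => by
    simpa [flag, Expr.eval] using h.arr 31 0 0
  induction h with
  | finish u h =>
    intro σ hR hV
    refine ⟨[.tick], σ, .loop_false ((hf u σ hR).trans h), rfl, fun d hd x hx => ?_⟩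
    simp only [delaysFrom, List.mem_singleton] at hx
    omega
  | step u l h1 h2 _ ih =>
    intro σ hR hV
    obtain ⟨τ, σ', h4, h5, h6, h7, h8⟩ := c.exe N u _ _ 2 σ one_le_two hR hV
    obtain ⟨τ', σ'', h9, h10, h11⟩ := ih σ' h7 (hV.congr h8 le_rfl)
    refine ⟨_, σ'', .loop_true (by rw [hf u σ hR]; exact h1) h4 h9, ?_, fun d hd => ?_⟩
    · simp [outputs, h5, h10]
    · have : DelaysLe (d + 1) (2 * D + 1) (τ ++ τ') :=
        DelaysLe.append_of_outputs (by rw [h5]; exact h2) (by omega)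
          fun d' hd' => h11 d' (by omega)
      exact this

/-- The program that runs the command `c₁` and then iterates `c₂`. -/
def iterProg (c₁ c₂ : Cmd) : Prog :=
  .seq prelude (.seq (c₁.comp (fun _ => 1) 2) (.loop flag (c₂.comp (fun _ => 1) 2)))

theorem iterProg_run (c₁ c₂ : Cmd) (ws : List (List Bool)) (hws : ws.length ≤ 3)
    (h₁ : c₁.out (bnd ws) (fun _ => 0) (initMem ws) = []) {l : List (List Bool)}
    (h₂ : Enumerates (bnd ws) c₂ (c₁.st (bnd ws) (fun _ => 0) (initMem ws)) l) :
    ∃ τ, (iterProg c₁ c₂).Run ws τ ∧ outputs τ = l ∧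
      ∀ d ∈ delays τ, d ≤ 2 * (5 + c₁.cost.eval (bnd ws) + c₂.cost.eval (bnd ws)) + 1 := by
  set D := 5 + c₁.cost.eval (bnd ws) + c₂.cost.eval (bnd ws) with hD
  have h3 : Exe prelude (start ws) [] 5 fun σ =>
      Rel (bnd ws) (initMem ws) σ ∧ Vars (fun _ => 0) (fun _ => 1) 2 σ := by
    obtain ⟨τ, σ, a, b, c, d⟩ := exe_prelude ws hws (p := .skip) (o := []) (T := 1)
      (Q := fun σ => Rel (bnd ws) (initMem ws) σ ∧ Vars (fun _ => 0) (fun _ => 1) 2 σ)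
      fun σ x y => ⟨_, _, .skip _, rfl, le_rfl, x, y⟩
    cases a with
    | seq a₁ a₂ =>
      cases a₂
      simp only [outputs_append, outputs, List.append_nil, time_append, time] at b c
      exact ⟨_, _, a₁, b, by omega, d⟩
  obtain ⟨τ₁, σ₁, a1, a2, a3, a4, a5⟩ := h3
  obtain ⟨τ₂, σ₂, b1, b2, b3, b4, b5⟩ := c₁.exe _ _ _ _ 2 σ₁ one_le_two a4 a5
  obtain ⟨τ₃, σ₃, c1, c2, c3⟩ := h₂.exec (D := D) (by omega) σ₂ b4 (a5.congr b5 le_rfl)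
  refine ⟨_, ⟨σ₃, .seq a1 (.seq b1 c1)⟩, ?_, ?_⟩
  · simp [a2, b2, h₁, c2]
  · refine DelaysLe.append (d := 0) (by omega) fun d hd => DelaysLe.append (by omega)
      fun d' hd' => c3 d' (by omega)

/-! ### Derived terms -/

namespace Tm

variable (N : ℕ) (u : Mem) (ρ : ℕ → ℕ)

/-- A term is true if its value is not zero. -/
def Holds (t : Tm) : Prop := t.val N u ρ ≠ 0

instance (t : Tm) : Decidable (t.Holds N u ρ) := inferInstanceAs (Decidable (_ ≠ _))

def not (t : Tm) : Tm := .sub (.lit 1) t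
def and (s t : Tm) : Tm := .ite s t (.lit 0)
def or (s t : Tm) : Tm := .add s t
def lt (s t : Tm) : Tm := .sub t s
def eq (s t : Tm) : Tm := not (.add (.sub s t) (.sub t s))
def ex (v : ℕ) (t : Tm) : Tm := .sum v t
def all (v : ℕ) (t : Tm) : Tm := not (ex v (not t))
def count (v : ℕ) (t : Tm) : Tm := .sum v (.ite t (.lit 1) (.lit 0))

@[simp] theorem holds_not (t : Tm) : (not t).Holds N u ρ ↔ ¬ t.Holds N u ρ := by
  simp [Holds, not, val]; omega

@[simp] theorem holds_and (s t : Tm) :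
    (and s t).Holds N u ρ ↔ s.Holds N u ρ ∧ t.Holds N u ρ := by
  simp [Holds, and, val]

@[simp] theorem holds_or (s t : Tm) : (or s t).Holds N u ρ ↔ s.Holds N u ρ ∨ t.Holds N u ρ := by
  simp only [Holds, or, val]; omega

@[simp] theorem holds_lt (s t : Tm) : (lt s t).Holds N u ρ ↔ s.val N u ρ < t.val N u ρ := by
  simp only [Holds, lt, val]; omega

@[simp] theorem holds_eq (s t : Tm) : (eq s t).Holds N u ρ ↔ s.val N u ρ = t.val N u ρ := by
  simp only [Holds, eq, not, val]; omega

@[simp] theorem holds_ex (v : ℕ) (t : Tm) :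
    (ex v t).Holds N u ρ ↔ ∃ i < N, t.Holds N u (Function.update ρ v i) := by
  simp [Holds, ex, val]

@[simp] theorem holds_all (v : ℕ) (t : Tm) :
    (all v t).Holds N u ρ ↔ ∀ i < N, t.Holds N u (Function.update ρ v i) := by
  simp [all]

@[simp] theorem holds_cell (a : Fin 32) (s t : Tm) :
    (cell a s t).Holds N u ρ ↔ u a (s.val N u ρ) (t.val N u ρ) ≠ 0 := Iff.rfl

@[simp] theorem val_count (v : ℕ) (t : Tm) : (count v t).val N u ρ =
    ((Finset.range N).filter fun i => t.Holds N u (Function.update ρ v i)).card := by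
  rw [Finset.card_filter]
  rfl

@[simp] theorem val_ite (c s t : Tm) : (Tm.ite c s t).val N u ρ =
    if c.Holds N u ρ then s.val N u ρ else t.val N u ρ := rfl

theorem holds_ite (c s t : Tm) : (Tm.ite c s t).Holds N u ρ ↔
    if c.Holds N u ρ then s.Holds N u ρ else t.Holds N u ρ := by
  by_cases h : c.val N u ρ = 0 <;> simp [Holds, val, h]

/-- The arrays that occur in a term. -/
def reads : Tm → List (Fin 32)
  | .lit _ | .var _ | .top => []
  | .cell a s t => a :: (s.reads ++ t.reads)
  | .add s t | .sub s t => s.reads ++ t.reads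
  | .ite c s t => c.reads ++ (s.reads ++ t.reads)
  | .sum _ t => t.reads

variable {N u ρ}

theorem val_congr {u' : Mem} : ∀ (t : Tm) {ρ : ℕ → ℕ}, (∀ a ∈ t.reads, u a = u' a) →
    t.val N u ρ = t.val N u' ρ
  | .lit _, _, _ => rfl
  | .var _, _, _ => rfl
  | .top, _, _ => rfl
  | .cell a s t, ρ, h => by
    simp only [reads, List.mem_cons, List.mem_append] at h
    simp only [val, val_congr s fun a ha => h a (.inr (.inl ha)),
      val_congr t fun a ha => h a (.inr (.inr ha)), h a (.inl rfl)]
  | .add s t, ρ, h => by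
    simp only [reads, List.mem_append] at h
    simp only [val, val_congr s fun a ha => h a (.inl ha), val_congr t fun a ha => h a (.inr ha)]
  | .sub s t, ρ, h => by
    simp only [reads, List.mem_append] at h
    simp only [val, val_congr s fun a ha => h a (.inl ha), val_congr t fun a ha => h a (.inr ha)]
  | .ite c s t, ρ, h => by
    simp only [reads, List.mem_append] at h
    simp only [val, val_congr c fun a ha => h a (.inl ha),
      val_congr s fun a ha => h a (.inr (.inl ha)), val_congr t fun a ha => h a (.inr (.inr ha))]
  | .sum v t, ρ, h => by
    simp only [val]
    exact Finset.sum_congr rfl fun i _ => val_congr t h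

end Tm

/-! ### Sequences of assignments -/

theorem Cmd.st_par_of_ne {N ρ u} {a b : Fin 32} (h : b ≠ a) (t : Tm) :
    (Cmd.par a t).st N ρ u b = u b := by
  funext i j
  simp [Cmd.st, h]

/-- The arrays that a command changes. -/
def Cmd.writes : Cmd → List (Fin 32)
  | .nop | .emit _ _ => []
  | .par a _ => [a]
  | .seq c d | .ite _ c d => c.writes ++ d.writes
  | .rep _ c => c.writes

theorem Cmd.st_of_notMem {N : ℕ} {b : Fin 32} : ∀ (c : Cmd) {ρ : ℕ → ℕ} {u : Mem},
    b ∉ c.writes → c.st N ρ u b = u b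
  | .nop, _, _, _ => rfl
  | .emit _ _, _, _, _ => rfl
  | .par a t, _, _, h => Cmd.st_par_of_ne (by simpa [writes] using h) t
  | .seq c d, _, _, h => by
    simp only [writes, List.mem_append, not_or] at h
    rw [st, st_of_notMem d h.2, st_of_notMem c h.1]
  | .ite t c d, _, _, h => by
    simp only [writes, List.mem_append, not_or] at h
    rw [st]
    split_ifs
    · exact st_of_notMem c h.1
    · exact st_of_notMem d h.2
  | .rep v c, ρ, u, h => by
    simp only [writes] at h
    have : ∀ k, (Nat.rec u (fun i w => c.st N (Function.update ρ v i) w) k : Mem) b = u b := by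
      intro k
      induction k with
      | zero => rfl
      | succ k ih =>
        change c.st N _ _ b = _
        rw [st_of_notMem c h, ih]
    exact this N

/-- Assignments to arrays, one after the other. -/
def parList : List (Fin 32 × Tm) → Cmd
  | [] => .nop
  | (a, t) :: l => .seq (.par a t) (parList l)

/-- Each array is assigned once, and not read before. -/
def ssa : List (Fin 32 × Tm) → Bool
  | [] => true
  | (a, t) :: l => !(t.reads.contains a) && l.all (fun p => p.1 != a && !(t.reads.contains p.1)) &&
      ssa l

theorem parList_st_of_notMem {N : ℕ} {b : Fin 32} : ∀ (l : List (Fin 32 × Tm)) {ρ : ℕ → ℕ} {u : Mem},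
    (∀ p ∈ l, p.1 ≠ b) → (parList l).st N ρ u b = u b
  | [], _, _, _ => rfl
  | (a, t) :: l, ρ, u, h => by
    rw [parList, Cmd.st, parList_st_of_notMem l fun p hp => h p (List.mem_cons_of_mem _ hp),
      Cmd.st_par_of_ne (h (a, t) List.mem_cons_self).symm]

theorem parList_out {N : ℕ} : ∀ (l : List (Fin 32 × Tm)) {ρ : ℕ → ℕ} {u : Mem},
    (parList l).out N ρ u = []
  | [], _, _ => rfl
  | (a, t) :: l, ρ, u => by rw [parList, Cmd.out, parList_out l]; rfl

/-- The assignments hold as equations in the final memory. -/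
theorem parList_spec {N : ℕ} : ∀ (l : List (Fin 32 × Tm)) {ρ : ℕ → ℕ} {u : Mem}, ssa l = true →
    ∀ p ∈ l, ∀ i < N, ∀ j < N, (parList l).st N ρ u p.1 i j =
      p.2.val N ((parList l).st N ρ u) (Function.update (Function.update ρ 0 i) 1 j)
  | [], _, _, _ => by simp
  | (a, t) :: l, ρ, u, h => by
    simp only [ssa, Bool.and_eq_true, List.all_eq_true, Bool.not_eq_true', bne_iff_ne,
      List.contains_eq_mem, decide_eq_false_iff_not] at h
    obtain ⟨⟨h1, h2⟩, h3⟩ := h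
    intro p hp i hi j hj
    rcases List.mem_cons.1 hp with rfl | hp
    · rw [parList, Cmd.st, parList_st_of_notMem l fun q hq => (h2 q hq).1]
      have e : (Cmd.par a t).st N ρ u a i j =
          t.val N u (Function.update (Function.update ρ 0 i) 1 j) := by
        simp only [Cmd.st, hi, hj, and_self, if_true]
      rw [e]
      refine Tm.val_congr t fun b hb => ?_
      rw [parList_st_of_notMem l fun q hq hqb => (h2 q hq).2 (hqb ▸ hb), Cmd.st_par_of_ne]
      rintro rfl
      exact h1 hb
    · exact parList_spec l h3 p hp i hi j hj

/-! ### Closures -/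

/-- `R` is the closure of `S` under `E`. -/
structure IsClosure (S : ℕ → Prop) (E : ℕ → ℕ → Prop) (R : ℕ → Prop) : Prop where
  start : ∀ v, S v → R v
  closed : ∀ w v, R w → E w v → R v
  least : ∀ P : ℕ → Prop, (∀ v, S v → P v) → (∀ w v, P w → E w v → P v) → ∀ v, R v → P v

/-- Until it becomes stable, the set grows by at least one element in each step. It stays inside `n
< N` elements, so it is stable after `N` steps. -/
theorem isClosure_iterate {N n : ℕ} (hn : n < N) {S : ℕ → Prop} {E : ℕ → ℕ → Prop}
    {R : ℕ → ℕ → Prop} (hS : ∀ v, S v → v < n) (hE : ∀ w v, E w v → w < n ∧ v < n)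
    (h0 : ∀ v < N, (R 0 v ↔ S v))
    (hR : ∀ k, ∀ v < N, (R (k + 1) v ↔ R k v ∨ ∃ w < N, R k w ∧ E w v)) :
    IsClosure S E fun v => v < N ∧ R N v := by
  classical
  have hlt : ∀ k, ∀ v < N, R k v → v < n := by
    intro k
    induction k with
    | zero => exact fun v hv h => hS v ((h0 v hv).1 h)
    | succ k ih =>
      intro v hv h
      rcases (hR k v hv).1 h with h | ⟨w, -, -, h⟩
      · exact ih v hv h
      · exact (hE w v h).2
  have hstab : ∀ k, (∀ j ≥ k, ∀ v < N, (R j v ↔ R k v)) ∨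
      k ≤ ((Finset.range n).filter (R k)).card := by
    intro k
    induction k with
    | zero => exact Or.inr (Nat.zero_le _)
    | succ k ih =>
      rcases ih with ih | ih
      · left
        intro j hj v hv
        rw [ih j (by omega) v hv, ih (k + 1) (by omega) v hv]
      · by_cases hsame : ∀ v < N, (R (k + 1) v ↔ R k v)
        · left
          have hstep : ∀ j, ∀ v < N, (R (k + j) v ↔ R k v) := by
            intro j
            induction j with
            | zero => exact fun v _ => Iff.rfl
            | succ j ihj =>
              intro v hv
              rw [← add_assoc, hR _ v hv, ← hsame v hv, hR _ v hv, ihj v hv]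
              refine or_congr Iff.rfl (exists_congr fun w => and_congr_right fun hw => ?_)
              rw [ihj w hw]
          intro j hj v hv
          rw [show j = k + (j - k) by omega, hstep _ v hv, hsame v hv]
        · right
          push Not at hsame
          obtain ⟨v, hv, h⟩ := hsame
          have h : R (k + 1) v ∧ ¬ R k v := by
            rcases h with h | h
            · exact h
            · exact absurd ((hR k v hv).2 (Or.inl h.2)) h.1
          have : (Finset.range n).filter (R k) ⊂ (Finset.range n).filter (R (k + 1)) := by
            rw [Finset.ssubset_iff_of_subset]
            · exact ⟨v, Finset.mem_filter.2 ⟨Finset.mem_range.2 (hlt _ v hv h.1), h.1⟩,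
                fun h' => h.2 (Finset.mem_filter.1 h').2⟩
            · intro w hw
              obtain ⟨hw1, hw2⟩ := Finset.mem_filter.1 hw
              have := Finset.mem_range.1 hw1
              exact Finset.mem_filter.2 ⟨hw1, (hR k w (by omega)).2 (Or.inl hw2)⟩
          have := Finset.card_lt_card this
          omega
  refine ⟨fun v hv => ?_, ?_, ?_⟩
  · have := hS v hv
    have h1 : ∀ k, R k v := by
      intro k
      induction k with
      | zero => exact (h0 v (by omega)).2 hv
      | succ k ih => exact (hR k v (by omega)).2 (Or.inl ih)
    exact ⟨by omega, h1 N⟩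
  · rintro w v ⟨hw, hRw⟩ hwv
    have hv : v < N := by have := hE w v hwv; omega
    refine ⟨hv, ?_⟩
    rcases hstab N with h | h
    · exact (h (N + 1) (by omega) v hv).1 ((hR N v hv).2 (Or.inr ⟨w, hw, hRw, hwv⟩))
    · have := h.trans (Finset.card_filter_le _ _)
      rw [Finset.card_range] at this
      omega
  · rintro P hP hPE v ⟨hv, hRv⟩
    have h1 : ∀ k, ∀ v < N, R k v → P v := by
      intro k
      induction k with
      | zero => exact fun v hv h => hP v ((h0 v hv).1 h)
      | succ k ih =>
        intro v hv h
        rcases (hR k v hv).1 h with h | ⟨w, hw, h2, h3⟩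
        · exact ih v hv h
        · exact hPE w v (ih w hw h2) h3
    exact h1 N v hv hRv

end RAM

/-! ## The commands of the kernelization -/

namespace RAM

theorem parList_holds {N : ℕ} {l : List (Fin 32 × Tm)} {ρ : ℕ → ℕ} {u : Mem} (h : ssa l = true)
    {a : Fin 32} {t : Tm} (hp : (a, t) ∈ l) {i j : ℕ} (hi : i < N) (hj : j < N) :
    (parList l).st N ρ u a i j ≠ 0 ↔
      t.Holds N ((parList l).st N ρ u) (Function.update (Function.update ρ 0 i) 1 j) := by
  rw [parList_spec l h (a, t) hp i hi j hj]
  rfl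

/-- The iterated assignment changes only the array `a`; therefore `ht` is asked for in every memory
that agrees with `u` on all other arrays. -/
theorem isClosure_rep {N n : ℕ} (hn : n < N) {a : Fin 32} {t : Tm} {y : ℕ} {ρ : ℕ → ℕ} {u : Mem}
    {S : ℕ → Prop} {E : ℕ → ℕ → Prop} {i : ℕ} (hi : i < N)
    (ht : ∀ w : Mem, (∀ b ≠ a, w b = u b) → ∀ k, ∀ j < N,
      (t.Holds N w (Function.update (Function.update (Function.update ρ y k) 0 i) 1 j) ↔
        w a i j ≠ 0 ∨ ∃ z < N, w a i z ≠ 0 ∧ E z j))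
    (hu : ∀ j < N, (u a i j ≠ 0 ↔ S j)) (hS : ∀ v, S v → v < n) (hE : ∀ w v, E w v → w < n ∧ v < n) :
    IsClosure S E fun v => v < N ∧ (Cmd.rep y (.par a t)).st N ρ u a i v ≠ 0 := by
  set f : ℕ → Mem := fun k => Nat.rec u (fun i w => (Cmd.par a t).st N (Function.update ρ y i) w) k
    with hf
  have hframe : ∀ k, ∀ b ≠ a, f k b = u b := by
    intro k
    induction k with
    | zero => exact fun _ _ => rfl
    | succ k ih =>
      intro b hb
      change (Cmd.par a t).st N _ (f k) b = _
      rw [Cmd.st_par_of_ne hb, ih b hb]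
  refine isClosure_iterate hn (R := fun k v => f k a i v ≠ 0) hS hE hu fun k v hv => ?_
  rw [← ht (f k) (hframe k) k v hv]
  have : f (k + 1) a i v = t.val N (f k)
      (Function.update (Function.update (Function.update ρ y k) 0 i) 1 v) := by
    change (Cmd.par a t).st N _ (f k) a i v = _
    simp only [Cmd.st, hi, hv, and_self, if_true]
  rw [this]
  rfl

end RAM

namespace MatchingCutKernel

open RAM RAM.Tm

abbrev v (k : ℕ) : Tm := .var k

/-- A scalar. -/
abbrev sc (a : Fin 32) : Tm := .cell a (.lit 0) (.lit 0)

/-- The cell `t` of a one-dimensional array. -/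
abbrev ar (a : Fin 32) (t : Tm) : Tm := .cell a t (.lit 0)

def le (s t : Tm) : Tm := not (lt t s)

@[simp] theorem holds_le (N : ℕ) (u : Mem) (ρ : ℕ → ℕ) (s t : Tm) :
    (le s t).Holds N u ρ ↔ s.val N u ρ ≤ t.val N u ρ := by
  simp [le]

/-- The number of vertices of the graph, its adjacency matrix, and the edges as numbers. -/
def readGraph : List (Fin 32 × Tm) :=
  [(6, .sum 2 (.ite (lt (v 2) (v 0)) (v 1) (.lit 0))),
   (4, count 2 (and (lt (.lit 0) (v 2)) (le (.cell 6 (v 2) (v 2)) (sc 3)))),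
   (7, and (and (lt (v 0) (sc 4)) (lt (v 1) (sc 4)))
        (.cell 0 (.lit 0) (.add (.cell 6 (v 0) (sc 4)) (v 1)))),
   (5, and (eq (sc 3) (.cell 6 (sc 4) (sc 4)))
        (and (all 2 (all 3 (or (not (.cell 7 (v 2) (v 3))) (.cell 7 (v 3) (v 2)))))
          (all 2 (not (.cell 7 (v 2) (v 2)))))),
   (8, count 2 (and (lt (.lit 0) (v 2)) (le (.cell 6 (v 2) (sc 4)) (v 0)))),
   (9, .sub (v 0) (.cell 6 (ar 8 (v 0)) (sc 4))),
   (13, and (lt (ar 8 (v 0)) (ar 9 (v 0))) (.cell 7 (ar 8 (v 0)) (ar 9 (v 0))))]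

theorem ssa_readGraph : ssa readGraph = true := by decide

/-- The language has neither division nor roots; quotients, and below integer square roots, are
obtained by counting the positive `k` that are not too large. -/
theorem card_filter_mul_le {N e n : ℕ} (hn : 0 < n) (he : e < N) :
    ((Finset.range N).filter fun k => 0 < k ∧ k * n ≤ e).card = e / n := by
  have : (Finset.range N).filter (fun k => 0 < k ∧ k * n ≤ e) = Finset.Icc 1 (e / n) := by
    ext k
    simp only [Finset.mem_filter, Finset.mem_range, Finset.mem_Icc, Nat.le_div_iff_mul_le hn]
    constructor
    · rintro ⟨-, h1, h2⟩
      exact ⟨h1, h2⟩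
    · rintro ⟨h1, h2⟩
      exact ⟨by nlinarith, h1, h2⟩
  rw [this, Nat.card_Icc, Nat.add_sub_cancel]

theorem card_filter_sq_le {N L : ℕ} (h : L < N) :
    ((Finset.range N).filter fun k => 0 < k ∧ k * k ≤ L).card = Nat.sqrt L := by
  have : (Finset.range N).filter (fun k => 0 < k ∧ k * k ≤ L) = Finset.Icc 1 (Nat.sqrt L) := by
    ext k
    simp only [Finset.mem_filter, Finset.mem_range, Finset.mem_Icc, Nat.le_sqrt]
    constructor
    · rintro ⟨-, h1, h2⟩
      exact ⟨h1, h2⟩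
    · rintro ⟨h1, h2⟩
      exact ⟨by nlinarith, h1, h2⟩
  rw [this, Nat.card_Icc]; omega

/-- Multiplication as repeated addition; with it array 6 becomes a multiplication table. -/
theorem sum_ite_lt {N a b : ℕ} (h : a ≤ N) :
    (∑ k ∈ Finset.range N, if k < a then b else 0) = a * b := by
  rw [← Finset.sum_filter, Finset.sum_const, smul_eq_mul]
  congr 1
  have : (Finset.range N).filter (fun k => k < a) = Finset.range a := by
    ext k; simp; omega
  rw [this, Finset.card_range]

/-- The meaning of the adjacency matrix `x`. -/
def AdjBit (x : List Bool) (p q : ℕ) : Prop :=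
  p < x.length.sqrt ∧ q < x.length.sqrt ∧ x.getD (p * x.length.sqrt + q) false = true

section ReadGraph

variable {N : ℕ} {u : Mem} {x : List Bool}

/-- The memory contains the input `x`, and the bound is large enough. -/
structure HasInput (x : List Bool) (N : ℕ) (u : Mem) : Prop where
  bound : 3 * x.length + 10 ≤ N
  input : ∀ j, u 0 0 j = (x.getD j false).toNat
  length : u 3 0 0 = x.length

/-- The memory after `readGraph`. -/
structure HasGraph (x : List Bool) (N : ℕ) (u : Mem) : Prop where
  bound : 3 * x.length + 10 ≤ N
  mul : ∀ i < N, ∀ j < N, u 6 i j = i * j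
  n : ∀ i < N, ∀ j < N, u 4 i j = x.length.sqrt
  adj : ∀ i < N, ∀ j < N, (u 7 i j ≠ 0 ↔ AdjBit x i j)
  valid : u 5 0 0 ≠ 0 ↔ x.length = x.length.sqrt * x.length.sqrt ∧
    (∀ p q, AdjBit x p q → AdjBit x q p) ∧ ∀ p, ¬ AdjBit x p p
  hd : 0 < x.length.sqrt → ∀ e < N, ∀ j < N, u 8 e j = e / x.length.sqrt
  tl : 0 < x.length.sqrt → ∀ e < N, ∀ j < N, u 9 e j = e % x.length.sqrt
  isE : 0 < x.length.sqrt → ∀ e < N, ∀ j < N, (u 13 e j ≠ 0 ↔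
    e / x.length.sqrt < e % x.length.sqrt ∧ AdjBit x (e / x.length.sqrt) (e % x.length.sqrt))

theorem HasInput.hasGraph (h : HasInput x N u) :
    HasGraph x N ((parList readGraph).st N (fun _ => 0) u) := by
  have hN := h.bound
  set n := x.length.sqrt with hn
  have hnL : n ≤ x.length := Nat.sqrt_le_self _
  have hnn : n * n ≤ x.length := Nat.sqrt_le _
  set w := (parList readGraph).st N (fun _ => 0) u with hw
  have h0 : w 0 = u 0 := parList_st_of_notMem _ (by decide)
  have h3 : w 3 = u 3 := parList_st_of_notMem _ (by decide)
  have mul : ∀ i < N, ∀ j < N, w 6 i j = i * j := by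
    intro i hi j hj
    rw [hw, parList_spec _ ssa_readGraph (6, _) (List.getElem_mem (l := readGraph) (n := 0) (by decide)) i hi j hj]
    simp only [val, lt, Function.update_apply, Nat.sub_ne_zero_iff_lt]
    simpa using sum_ite_lt hi.le
  have hn4 : ∀ i < N, ∀ j < N, w 4 i j = n := by
    intro i hi j hj
    rw [hw, parList_spec _ ssa_readGraph (4, _) (List.getElem_mem (l := readGraph) (n := 1) (by decide)) i hi j hj]
    rw [← hw]
    simp only [val_count, holds_and, holds_lt, holds_le, val, v, h3, h.length,
      Function.update_self]
    rw [hn, ← card_filter_sq_le (show x.length < N by omega)]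
    congr 1
    refine Finset.filter_congr fun k hk => ?_
    rw [mul k (Finset.mem_range.1 hk) k (Finset.mem_range.1 hk)]
  have adj : ∀ i < N, ∀ j < N, (w 7 i j ≠ 0 ↔ AdjBit x i j) := by
    intro i hi j hj
    rw [hw, parList_holds ssa_readGraph (List.getElem_mem (l := readGraph) (n := 2) (by decide)) hi hj]
    rw [← hw]
    simp only [holds_and, holds_lt, holds_cell, val, v, Function.update_apply, h0, h.input,
      hn4 0 (by omega) 0 (by omega)]
    simp only [zero_ne_one, if_false, if_true]
    rw [mul i hi n (by omega), AdjBit, and_assoc, ← hn]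
    simp
  have adj_lt : ∀ {p q}, AdjBit x p q → p < N ∧ q < N := by
    rintro p q ⟨h1, h2, -⟩
    omega
  have valid : w 5 0 0 ≠ 0 ↔ x.length = n * n ∧
      (∀ p q, AdjBit x p q → AdjBit x q p) ∧ ∀ p, ¬ AdjBit x p p := by
    rw [hw, parList_holds ssa_readGraph (List.getElem_mem (l := readGraph) (n := 3) (by decide)) (by omega)
      (by omega)]
    rw [← hw]
    simp only [holds_and, holds_eq, holds_all, holds_or, holds_not, holds_cell, val, v, h3, h.length,
      hn4 0 (by omega) 0 (by omega), mul n (by omega) n (by omega), Function.update_apply]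
    refine and_congr Iff.rfl (and_congr ?_ ?_)
    · simp only [if_true, Nat.reduceEqDiff, if_false]
      constructor
      · intro h4 p q hpq
        obtain ⟨h5, h6⟩ := adj_lt hpq
        rcases h4 p h5 q h6 with h7 | h7
        · exact absurd ((adj p h5 q h6).2 hpq) h7
        · exact (adj q h6 p h5).1 h7
      · intro h4 p hp q hq
        by_cases h7 : w 7 p q ≠ 0
        · exact Or.inr ((adj q hq p hp).2 (h4 p q ((adj p hp q hq).1 h7)))
        · exact Or.inl h7
    · simp only [if_true]
      constructor
      · intro h4 p hp
        have h5 := (adj_lt hp).1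
        exact h4 p h5 ((adj p h5 p h5).2 hp)
      · exact fun h4 p hp h7 => h4 p ((adj p hp p hp).1 h7)
  have hd : 0 < n → ∀ e < N, ∀ j < N, w 8 e j = e / n := by
    intro hn0 e he j hj
    rw [hw, parList_spec _ ssa_readGraph (8, _) (List.getElem_mem (l := readGraph) (n := 4) (by decide)) e he j hj]
    rw [← hw]
    simp only [val_count, holds_and, holds_lt, holds_le, val, v, Function.update_apply,
      hn4 0 (by omega) 0 (by omega)]
    rw [← card_filter_mul_le hn0 he]
    congr 1
    refine Finset.filter_congr fun k hk => ?_
    simp [mul k (Finset.mem_range.1 hk) n (by omega)]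
  have tl : 0 < n → ∀ e < N, ∀ j < N, w 9 e j = e % n := by
    intro hn0 e he j hj
    rw [hw, parList_spec _ ssa_readGraph (9, _) (List.getElem_mem (l := readGraph) (n := 5) (by decide)) e he j hj]
    rw [← hw]
    simp only [val, Function.update_apply, hn4 0 (by omega) 0 (by omega)]
    simp only [zero_ne_one, if_false, if_true]
    rw [hd hn0 e he 0 (by omega), mul _ ((Nat.div_le_self _ _).trans_lt he) n (by omega)]
    have := Nat.div_add_mod' e n
    omega
  refine ⟨hN, mul, hn4, adj, valid, hd, tl, fun hn0 e he j hj => ?_⟩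
  rw [hw, parList_holds ssa_readGraph (List.getElem_mem (l := readGraph) (n := 6) (by decide)) he hj]
  rw [← hw]
  simp only [holds_and, holds_lt, holds_cell, val, v, Function.update_apply]
  simp only [zero_ne_one, if_false, if_true]
  rw [hd hn0 e he 0 (by omega), tl hn0 e he 0 (by omega),
    adj _ ((Nat.div_le_self _ _).trans_lt he) _ ((Nat.mod_le _ _).trans_lt he)]

end ReadGraph

/-- `w v` are the ends of the edge number `e`. -/
def same (e w v : Tm) : Tm :=
  or (and (eq w (ar 8 e)) (eq v (ar 9 e))) (and (eq w (ar 9 e)) (eq v (ar 8 e)))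

def reachStep : Tm :=
  or (.cell 12 (v 0) (v 1)) (ex 2 (and (.cell 12 (v 0) (v 2)) (and (.cell 7 (v 2) (v 1))
    (and (not (same (v 0) (v 2) (v 1))) (not (same (v 5) (v 2) (v 1)))))))

/-- Tests for each pair of edges if the graph becomes disconnected when they are deleted. -/
def disconnect : Cmd :=
  .rep 5 (.seq (.par 12 (eq (v 1) (.lit 0))) (.seq (.rep 6 (.par 12 reachStep))
    (.par 10 (.ite (eq (v 1) (v 5)) (ex 2 (and (lt (v 2) (sc 4)) (not (.cell 12 (v 0) (v 2)))))
      (.cell 10 (v 0) (v 1))))))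

theorem disconnect_out (N : ℕ) (ρ : ℕ → ℕ) (u : Mem) : disconnect.out N ρ u = [] := by
  simp [disconnect, Cmd.out]

/-- `w v` are the ends of the edge number `e`. -/
def SameEnds (n e w v : ℕ) : Prop := w = e / n ∧ v = e % n ∨ w = e % n ∧ v = e / n

/-- Round `k` computes, for all numbers `e` in parallel, the vertices reachable from vertex 0 after
the deletion of `e` and `k`, and stores the result of the test in column `k` of array 10. Later
rounds do not change this column. -/
theorem HasGraph.disconnect_spec {x : List Bool} {N : ℕ} {u : Mem} (h : HasGraph x N u)
    {e f : ℕ} (he : e < N) (hf : f < N) : ∃ R : ℕ → Prop,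
      (0 < x.length.sqrt → IsClosure (· = 0) (fun w v => AdjBit x w v ∧
        ¬ SameEnds x.length.sqrt e w v ∧ ¬ SameEnds x.length.sqrt f w v) R) ∧
      (disconnect.st N (fun _ => 0) u 10 e f ≠ 0 ↔ ∃ v < x.length.sqrt, ¬ R v) := by
  have hN := h.bound
  set n := x.length.sqrt with hn
  have hnL : n ≤ x.length := Nat.sqrt_le_self _
  set body : Cmd := .seq (.par 12 (eq (v 1) (.lit 0))) (.seq (.rep 6 (.par 12 reachStep))
    (.par 10 (.ite (eq (v 1) (v 5)) (ex 2 (and (lt (v 2) (sc 4)) (not (.cell 12 (v 0) (v 2)))))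
      (.cell 10 (v 0) (v 1))))) with hbody
  set g : ℕ → Mem := fun k =>
    Nat.rec u (fun i w => body.st N (Function.update (fun _ => 0) 5 i) w) k with hg
  have hframe : ∀ k, ∀ b, b ≠ 12 → b ≠ 10 → g k b = u b := by
    intro k
    induction k with
    | zero => exact fun _ _ _ => rfl
    | succ k ih =>
      intro b hb hb'
      change body.st N _ (g k) b = _
      rw [Cmd.st_of_notMem body (by simp [hbody, Cmd.writes, hb, hb']), ih b hb hb']
  have hround : ∀ k < N, ∃ R : ℕ → Prop,
      (0 < n → IsClosure (· = 0) (fun w v => AdjBit x w v ∧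
        ¬ SameEnds n e w v ∧ ¬ SameEnds n k w v) R) ∧
      ∀ f < N, (g (k + 1) 10 e f ≠ 0 ↔ if f = k then ∃ v < n, ¬ R v else g k 10 e f ≠ 0) := by
    intro k hk
    set ρ : ℕ → ℕ := Function.update (fun _ => 0) 5 k with hρ
    set u₁ := (Cmd.par 12 (eq (v 1) (.lit 0))).st N ρ (g k) with hu₁
    set u₂ := (Cmd.rep 6 (.par 12 reachStep)).st N ρ u₁ with hu₂
    have hu₁' : ∀ b, b ≠ 12 → b ≠ 10 → u₁ b = u b := fun b hb hb' => by
      rw [hu₁, Cmd.st_par_of_ne hb, hframe k b hb hb']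
    have hu₂' : ∀ b, b ≠ 12 → b ≠ 10 → u₂ b = u b := fun b hb hb' => by
      rw [hu₂, Cmd.st_of_notMem _ (by simpa [Cmd.writes] using hb), hu₁' b hb hb']
    refine ⟨fun j => j < N ∧ u₂ 12 e j ≠ 0, fun hn0 => ?_, fun f hf => ?_⟩
    · refine isClosure_rep (n := n) (by omega) he (fun w hw z j hj => ?_) (fun j hj => ?_)
        (fun v hv => by omega) (fun w v hv => ⟨hv.1.1, hv.1.2.1⟩)
      · simp only [reachStep, same, holds_or, holds_cell, holds_ex, holds_and, holds_not, holds_eq,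
          val, Function.update_apply, hρ]
        simp only [zero_ne_one, if_false, if_true, Nat.reduceEqDiff, OfNat.ofNat_ne_zero,
          OfNat.zero_ne_ofNat, OfNat.ofNat_ne_one, OfNat.one_ne_ofNat]
        simp only [hw 7 (by decide), hw 8 (by decide), hw 9 (by decide),
          hu₁' 7 (by decide) (by decide), hu₁' 8 (by decide) (by decide),
          hu₁' 9 (by decide) (by decide)]
        refine or_congr Iff.rfl (exists_congr fun q => and_congr_right fun hq => ?_)
        rw [h.adj q hq j hj, h.hd hn0 e he 0 (by omega), h.tl hn0 e he 0 (by omega),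
          h.hd hn0 k hk 0 (by omega), h.tl hn0 k hk 0 (by omega)]
        rfl
      · have : u₁ 12 e j = (eq (v 1) (.lit 0)).val N (g k)
            (Function.update (Function.update ρ 0 e) 1 j) := by
          simp only [hu₁, Cmd.st, he, hj, and_self, if_true]
        rw [this]
        change Holds _ _ _ _ ↔ _
        simp [val]
    · have : g (k + 1) 10 e f = (Tm.ite (eq (v 1) (v 5)) (ex 2 (and (lt (v 2) (sc 4))
          (not (.cell 12 (v 0) (v 2))))) (.cell 10 (v 0) (v 1))).val N u₂
            (Function.update (Function.update ρ 0 e) 1 f) := by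
        change body.st N ρ (g k) 10 e f = _
        simp only [hbody, Cmd.st, he, hf, and_self, if_true]
        rfl
      rw [this]
      change Holds _ _ _ _ ↔ _
      simp only [holds_ite, holds_eq, holds_ex, holds_and, holds_lt, holds_not, holds_cell, val,
        Function.update_apply, hρ, hu₂' 4 (by decide) (by decide), h.n 0 (by omega) 0 (by omega)]
      simp only [zero_ne_one, if_false, if_true, Nat.reduceEqDiff, OfNat.ofNat_ne_zero,
          OfNat.zero_ne_ofNat, OfNat.ofNat_ne_one, OfNat.one_ne_ofNat]
      split_ifs
      · constructor
        · rintro ⟨z, h1, h2, h3⟩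
          exact ⟨z, h2, fun h4 => h3 h4.2⟩
        · rintro ⟨z, h2, h3⟩
          exact ⟨z, by omega, h2, fun h4 => h3 ⟨by omega, h4⟩⟩
      · rw [hu₂, Cmd.st_of_notMem _ (by simp [Cmd.writes]), hu₁, Cmd.st_par_of_ne (by decide)]
  obtain ⟨R, hR, hR'⟩ := hround f hf
  have hkeep : ∀ k, f < k → k ≤ N → (g k 10 e f ≠ 0 ↔ ∃ v < n, ¬ R v) := by
    intro k hk
    induction k, hk using Nat.le_induction with
    | base =>
      intro _
      simpa using hR' f hf
    | succ k hk ih =>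
      intro hkN
      obtain ⟨_, _, h2⟩ := hround k (by omega)
      rw [h2 f hf, if_neg (by omega), ih (by omega)]
  exact ⟨R, hR, hkeep N hf le_rfl⟩

end MatchingCutKernel

/-! ## The meaning of the arrays for the encoding of a graph -/

namespace SimpleGraph

variable {n : ℕ} {G : SimpleGraph (Fin n)}

theorem getD_encode {p q : ℕ} (hp : p < n) (hq : q < n) :
    G.encode.getD (p * n + q) false = true ↔ G.Adj ⟨p, hp⟩ ⟨q, hq⟩ := by
  have h : p * n + q < n * n := by nlinarith
  have h1 : (⟨p * n + q, h⟩ : Fin (n * n)).divNat = ⟨p, hp⟩ := by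
    apply Fin.ext
    simp only [Fin.divNat]
    rw [mul_comm, Nat.mul_add_div (by omega), Nat.div_eq_of_lt hq, add_zero]
  have h2 : (⟨p * n + q, h⟩ : Fin (n * n)).modNat = ⟨q, hq⟩ := by
    apply Fin.ext
    simp only [Fin.modNat]
    rw [mul_comm, Nat.mul_add_mod, Nat.mod_eq_of_lt hq]
  rw [List.getD_eq_getElem _ _ (by rw [length_encode]; exact h)]
  simp only [encode, List.getElem_ofFn, h1, h2, decide_eq_true_eq]

theorem sqrt_length_encode : G.encode.length.sqrt = n := by
  rw [length_encode, Nat.sqrt_eq]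

/-- The edge with the number `e`. -/
def ed (n : ℕ) [NeZero n] (e : ℕ) : Sym2 (Fin n) := s(Fin.ofNat n (e / n), Fin.ofNat n e)

/-- The number of an edge. -/
def ix (n : ℕ) : Sym2 (Fin n) → ℕ :=
  Sym2.lift ⟨fun p q => min (p : ℕ) q * n + max (p : ℕ) q, fun p q => by
    simp only [min_comm (p : ℕ), max_comm (p : ℕ)]⟩

@[simp] theorem ix_mk (p q : Fin n) : ix n s(p, q) = min (p : ℕ) q * n + max (p : ℕ) q := rfl

theorem ix_lt (e : Sym2 (Fin n)) : ix n e < n * n := by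
  induction e with | _ p q =>
  rw [ix_mk]
  have h1 : min (p : ℕ) q + 1 ≤ n := by have := p.2; omega
  have h2 : max (p : ℕ) q < n := by have := p.2; have := q.2; omega
  nlinarith

/-- `e` is the number of an edge of `G`. -/
def IsE [NeZero n] (G : SimpleGraph (Fin n)) (e : ℕ) : Prop := ed n e ∈ G.edgeSet ∧ ix n (ed n e) = e

variable [NeZero n]

theorem ed_ix (e : Sym2 (Fin n)) : ed n (ix n e) = e := by
  induction e with | _ p q =>
  wlog h : p ≤ q generalizing p q
  · rw [Sym2.eq_swap]
    exact this q p (le_of_not_ge h)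
  have hp := p.2
  have hq := q.2
  have h' : (p : ℕ) ≤ q := h
  rw [ix_mk, min_eq_left h', max_eq_right h', ed]
  have h1 : ((p : ℕ) * n + q) / n = p := by
    rw [mul_comm, Nat.mul_add_div (by omega), Nat.div_eq_of_lt hq, add_zero]
  have h2 : ((p : ℕ) * n + q) % n = q := by
    rw [mul_comm, Nat.mul_add_mod, Nat.mod_eq_of_lt hq]
  have h3 : Fin.ofNat n ((p * n + q) / n) = p := by
    apply Fin.ext
    simp [h1]
  have h4 : Fin.ofNat n (p * n + q) = q := by
    apply Fin.ext
    simp [h2]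
  rw [h3, h4]

theorem ix_injective : Function.Injective (ix n) := fun e f h => by
  rw [← ed_ix e, h, ed_ix]

theorem isE_ix {e : Sym2 (Fin n)} (h : e ∈ G.edgeSet) : G.IsE (ix n e) := by
  rw [IsE, ed_ix]
  exact ⟨h, rfl⟩

theorem IsE.lt {e : ℕ} (h : G.IsE e) : e < n * n := h.2 ▸ ix_lt _

theorem IsE.div_lt {e : ℕ} (h : G.IsE e) : e / n < n :=
  Nat.div_lt_of_lt_mul h.lt

theorem IsE.eq {e f : ℕ} (he : G.IsE e) (hf : G.IsE f) : ed n e = ed n f ↔ e = f := by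
  constructor
  · intro h
    rw [← he.2, ← hf.2, h]
  · rintro rfl; rfl

theorem ed_eq {e : ℕ} (h : e < n * n) :
    ed n e = s(⟨e / n, Nat.div_lt_of_lt_mul h⟩, ⟨e % n, Nat.mod_lt _ (NeZero.pos n)⟩) := by
  rw [ed]
  congr 2
  apply Fin.ext
  simp [Nat.mod_eq_of_lt (Nat.div_lt_of_lt_mul h)]

theorem isE_iff {e : ℕ} : G.IsE e ↔ ∃ (h : e / n < n), e / n < e % n ∧
    G.Adj ⟨e / n, h⟩ ⟨e % n, Nat.mod_lt _ (NeZero.pos n)⟩ := by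
  have h0 := Nat.div_add_mod' e n
  have h1 := Nat.mod_lt e (NeZero.pos n)
  constructor
  · intro h
    have h2 := h.2
    have h3 : s(_, _) ∈ G.edgeSet := ed_eq h.lt ▸ h.1
    rw [ed_eq h.lt, ix_mk] at h2
    refine ⟨h.div_lt, ?_, h3⟩
    have h4 : e / n ≠ e % n := fun h4 => by
      have := G.ne_of_adj h3
      exact this (Fin.ext h4)
    by_contra h5
    simp only [min_eq_right (not_lt.1 h5), max_eq_left (not_lt.1 h5)] at h2
    have : e % n + 1 ≤ e / n := by omega
    have h6 : (e % n + 1) * n ≤ (e / n) * n := Nat.mul_le_mul_right _ this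
    have := h.div_lt
    rw [Nat.add_mul] at h6
    omega
  · rintro ⟨h2, h3, h4⟩
    have h5 : e < n * n := (Nat.div_lt_iff_lt_mul (NeZero.pos n)).1 h2
    rw [IsE, ed_eq h5, ix_mk]
    refine ⟨h4, ?_⟩
    simp only [min_eq_left h3.le, max_eq_right h3.le]
    exact h0

/-- The deletion of the edges in `S` disconnects the graph. -/
def Separates {V : Type*} (G : SimpleGraph V) (S : Set (Sym2 V)) : Prop :=
  ∃ A : Set V, A ≠ ∅ ∧ A ≠ Set.univ ∧ G.cutEdges A ⊆ S

section

variable {V : Type*} {G : SimpleGraph V}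

/-- The pair `s(v, v)` is not an edge, so its deletion changes nothing. In this way the test for
pairs of edges also decides connectedness. -/
theorem not_cutConnected_iff {v : V} : ¬ G.CutConnected ↔ G.Separates {s(v, v)} := by
  have h : ∀ A, G.cutEdges A ⊆ {s(v, v)} ↔ G.cutEdges A = ∅ := by
    intro A
    refine ⟨fun h => Set.eq_empty_of_forall_notMem fun e he => ?_, fun h => by simp [h]⟩
    have h1 := cutEdges_subset A he
    rw [Set.mem_singleton_iff.1 (h he)] at h1
    exact G.ne_of_adj h1 rfl
  simp only [CutConnected, Separates, h, not_forall, not_or]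
  constructor
  · rintro ⟨A, h1, h2, h3⟩
    exact ⟨A, h2, h3, h1⟩
  · rintro ⟨A, h2, h3, h1⟩
    exact ⟨A, h1, h2, h3⟩

theorem IsCut.separates {M S : Set (Sym2 V)} (h : G.IsCut M) (h0 : M.Nonempty) (hS : M ⊆ S) :
    G.Separates S := by
  obtain ⟨A, rfl⟩ := h
  refine ⟨A, ?_, ?_, hS⟩
  · rintro rfl
    obtain ⟨_, _, h, -⟩ := h0
    exact h
  · rintro rfl
    obtain ⟨_, _, -, _, h, -⟩ := h0
    exact h trivial

theorem CutConnected.exists_isCut (hG : G.CutConnected) {S : Set (Sym2 V)} (h : G.Separates S) :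
    ∃ M, G.IsCut M ∧ M.Nonempty ∧ M ⊆ S := by
  obtain ⟨A, h1, h2, h3⟩ := h
  refine ⟨_, ⟨A, rfl⟩, Set.nonempty_iff_ne_empty.2 fun h => ?_, h3⟩
  rcases hG A h with h | h
  · exact h1 h
  · exact h2 h

theorem CutConnected.separates_singleton (hG : G.CutConnected) {e : Sym2 V} :
    G.Separates {e} ↔ G.Br e := by
  constructor
  · intro h
    obtain ⟨M, h1, h2, h3⟩ := hG.exists_isCut h
    rwa [(Set.subset_singleton_iff_eq.1 h3).resolve_left h2.ne_empty] at h1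
  · exact fun h => h.separates ⟨e, rfl⟩ subset_rfl

theorem CutConnected.separates_pair (hG : G.CutConnected) {e f : Sym2 V} (he : ¬ G.Br e)
    (hf : ¬ G.Br f) : G.Separates {e, f} ↔ G.IsCut {e, f} := by
  constructor
  · intro h
    obtain ⟨M, h1, h2, h3⟩ := hG.exists_isCut h
    rcases Set.subset_pair_iff_eq.1 h3 with rfl | rfl | rfl | rfl
    · exact absurd rfl h2.ne_empty
    · exact absurd h1 he
    · exact absurd h1 hf
    · exact h1
  · exact fun h => h.separates ⟨e, by simp⟩ subset_rfl

end

end SimpleGraph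

namespace MatchingCutKernel

open RAM RAM.Tm SimpleGraph

variable {n : ℕ} {G : SimpleGraph (Fin n)}

theorem adjBit_encode {p q : ℕ} :
    AdjBit G.encode p q ↔ ∃ (hp : p < n) (hq : q < n), G.Adj ⟨p, hp⟩ ⟨q, hq⟩ := by
  rw [AdjBit, sqrt_length_encode]
  constructor
  · rintro ⟨h1, h2, h3⟩
    exact ⟨h1, h2, (getD_encode h1 h2).1 h3⟩
  · rintro ⟨h1, h2, h3⟩
    exact ⟨h1, h2, (getD_encode h1 h2).2 h3⟩

theorem sameEnds_iff [NeZero n] {e w v : ℕ} (he : e < n * n) (hw : w < n) (hv : v < n) :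
    SameEnds n e w v ↔ s(⟨w, hw⟩, ⟨v, hv⟩) = ed n e := by
  rw [ed_eq he, Sym2.eq_iff, SameEnds]
  simp only [Fin.mk.injEq]

/-- Only deleted edges leave the set of vertices reachable from 0. Conversely, a separating side,
chosen such that it contains 0, is closed under the remaining edges and therefore contains the
closure. -/
theorem isClosure_separates [NeZero n] {e f : ℕ} (he : e < n * n) (hf : f < n * n) {R : ℕ → Prop}
    (h : IsClosure (· = 0) (fun w v => AdjBit G.encode w v ∧ ¬ SameEnds n e w v ∧
      ¬ SameEnds n f w v) R) : (∃ v < n, ¬ R v) ↔ G.Separates {ed n e, ed n f} := by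
  have h0 := NeZero.pos n
  constructor
  · rintro ⟨v, hv, hR⟩
    refine ⟨{p | R p}, ?_, ?_, ?_⟩
    · intro h1
      have : (⟨0, h0⟩ : Fin n) ∈ {p : Fin n | R p} := h.start 0 rfl
      rw [h1] at this
      exact this
    · intro h1
      have : (⟨v, hv⟩ : Fin n) ∈ {p : Fin n | R p} := h1 ▸ trivial
      exact hR this
    · rintro _ ⟨p, hp, q, hq, hpq, rfl⟩
      by_contra h1
      refine hq (h.closed p q hp ⟨adjBit_encode.2 ⟨p.2, q.2, hpq⟩, ?_, ?_⟩)
      · rw [sameEnds_iff he p.2 q.2]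
        exact fun h2 => h1 (Or.inl h2)
      · rw [sameEnds_iff hf p.2 q.2]
        exact fun h2 => h1 (Or.inr h2)
  · rintro ⟨A, h1, h2, h3⟩
    wlog hA : (⟨0, h0⟩ : Fin n) ∈ A generalizing A
    · refine this Aᶜ ?_ ?_ (by rwa [cutEdges_compl]) hA
      · rwa [Ne, Set.compl_empty_iff]
      · rwa [Ne, Set.compl_univ_iff]
    obtain ⟨v, hv⟩ := (Set.ne_univ_iff_exists_notMem A).1 h2
    refine ⟨v, v.2, fun hR => ?_⟩
    have := h.least (fun p => ∃ hp : p < n, (⟨p, hp⟩ : Fin n) ∈ A)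
      (by rintro _ rfl; exact ⟨h0, hA⟩) ?_ v hR
    · exact hv this.2
    · rintro p q ⟨hp, hpA⟩ ⟨h4, h5, h6⟩
      obtain ⟨_, hq, h4'⟩ := adjBit_encode.1 h4
      refine ⟨hq, ?_⟩
      by_contra hqA
      rw [sameEnds_iff he hp hq] at h5
      rw [sameEnds_iff hf hp hq] at h6
      rcases h3 ⟨_, hpA, _, hqA, h4', rfl⟩ with h7 | h7
      · exact h5 h7
      · exact h6 h7

/-! ### Equivalence classes -/

/-- `u` is the least element of its class. -/
def IsRoot (n : ℕ) (Q : ℕ → ℕ → Prop) (u : ℕ) : Prop := u < n ∧ ∀ w < u, ¬ Q w u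

-- Each class is given by its least element and numbered by its rank among these; vertex 0 gets the
-- number 0. The counts over `range N` are those that the programs evaluate, while `m` and `d` do
-- not depend on `N`.
open Classical in
theorem exists_numbering {n : ℕ} {Q : ℕ → ℕ → Prop} (hr : ∀ u < n, Q u u)
    (hs : ∀ u v, Q u v → Q v u) (ht : ∀ u v w, Q u v → Q v w → Q u w) (hQ : ∀ u v, Q u v → u < n) :
    ∃ (m : ℕ) (d : ℕ → ℕ), (∀ N, n ≤ N → ((Finset.range N).filter (IsRoot n Q)).card = m ∧
        ∀ u < n, ((Finset.range N).filter fun r => IsRoot n Q r ∧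
          ∃ w < N, IsRoot n Q w ∧ Q w u ∧ r < w).card = d u) ∧
      (∀ u < n, ∀ v < n, (d u = d v ↔ Q u v)) ∧ (∀ u < n, d u < m) ∧
      (∀ k < m, ∃ u < n, d u = k) ∧ (0 < n → d 0 = 0) := by
  have hex : ∀ u, ∃ r, u < n → IsRoot n Q r ∧ Q r u := by
    intro u
    by_cases hu : u < n
    · have h1 : ∃ r, Q r u := ⟨u, hr u hu⟩
      refine ⟨Nat.find h1, fun _ => ⟨⟨hQ _ _ (Nat.find_spec h1), fun w hw hwr => ?_⟩,
        Nat.find_spec h1⟩⟩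
      exact Nat.find_min h1 hw (ht _ _ _ hwr (Nat.find_spec h1))
    · exact ⟨0, fun h => absurd h hu⟩
  choose rep hrep using hex
  have huniq : ∀ r r', IsRoot n Q r → IsRoot n Q r' → Q r r' → r = r' := by
    intro r r' h h' hrr
    rcases lt_trichotomy r r' with h1 | h1 | h1
    · exact absurd hrr (h'.2 r h1)
    · exact h1
    · exact absurd (hs _ _ hrr) (h.2 r' h1)
  have hcard : ∀ k, ((Finset.range k).filter (IsRoot n Q)).card = Nat.count (IsRoot n Q) k := fun k =>
    (Nat.count_eq_card_filter_range _ _).symm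
  have hall : ∀ N, n ≤ N → ((Finset.range N).filter (IsRoot n Q)).card =
      ((Finset.range n).filter (IsRoot n Q)).card := by
    intro N hN
    congr 1
    ext r
    simp only [Finset.mem_filter, Finset.mem_range]
    exact ⟨fun h => ⟨h.2.1, h.2⟩, fun h => ⟨by omega, h.2⟩⟩
  refine ⟨_, fun u => Nat.count (IsRoot n Q) (rep u), fun N hN => ⟨hall N hN, fun u hu => ?_⟩,
    fun u hu v hv => ?_, fun u hu => ?_, fun k hk => ?_, fun h0 => ?_⟩
  · obtain ⟨h1, h2⟩ := hrep u hu
    simp only [← hcard]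
    congr 1
    ext r
    simp only [Finset.mem_filter, Finset.mem_range]
    constructor
    · rintro ⟨h3, h4, w, h5, h6, h7, h8⟩
      rw [huniq _ _ h1 h6 (ht _ _ _ h2 (hs _ _ h7))]
      exact ⟨h8, h4⟩
    · rintro ⟨h3, h4⟩
      have := h1.1
      exact ⟨by omega, h4, rep u, by omega, h1, h2, h3⟩
  · obtain ⟨h1, h2⟩ := hrep u hu
    obtain ⟨h3, h4⟩ := hrep v hv
    constructor
    · intro h
      have := Nat.count_injective h1 h3 h
      rw [← this] at h4
      exact ht _ _ _ (hs _ _ h2) h4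
    · intro h
      have : rep u = rep v := huniq _ _ h1 h3 (ht _ _ _ h2 (ht _ _ _ h (hs _ _ h4)))
      simp only [this]
  · rw [hcard]
    obtain ⟨h1, -⟩ := hrep u hu
    exact Nat.count_strict_mono h1 h1.1
  · rw [hcard] at hk
    have h1 : IsRoot n Q (Nat.nth (IsRoot n Q) k) :=
      Nat.nth_mem k fun hf => hk.trans_le (by
        rw [← hcard]
        exact Finset.card_le_card fun r hr => by simpa using (Finset.mem_filter.1 hr).2)
    refine ⟨_, h1.1, ?_⟩
    have h2 := hrep _ h1.1
    simp only [huniq _ _ h2.1 h1 h2.2]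
    exact Nat.count_nth fun hf => hk.trans_le (by
        rw [← hcard]
        exact Finset.card_le_card fun r hr => by simpa using (Finset.mem_filter.1 hr).2)
  · obtain ⟨h1, h2⟩ := hrep 0 h0
    have : rep 0 = 0 := by
      by_contra h
      exact h1.2 0 (Nat.pos_of_ne_zero h) (hs _ _ h2)
    simp [this]

end MatchingCutKernel

/-! ## The analysis of the graph -/

namespace MatchingCutKernel

open RAM RAM.Tm SimpleGraph

/-- One of `s`, `t` equals one of `s'`, `t'`. -/
def meet (s t s' t' : Tm) : Tm := or (or (eq s s') (eq s t')) (or (eq t s') (eq t t'))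

/-- The edges number `e` and `f` have a common end. -/
def share (e f : Tm) : Tm := meet (ar 8 e) (ar 9 e) (ar 8 f) (ar 9 f)

/-- The edge number `e` is a bridge. -/
def br (e : Tm) : Tm := .cell 10 e e

/-- The edges number `e` and `f`, if they are not bridges, are similar. -/
def sim (e f : Tm) : Tm := or (eq e f) (.cell 10 e f)

/-- The loose edges, the contracted edges, and the adjacency of the contracted edges. -/
def classify : List (Fin 32 × Tm) :=
  [(14, and (and (ar 13 (v 0)) (not (br (v 0)))) (all 2 (or (not (and (and (ar 13 (v 2))
      (not (br (v 2)))) (share (v 0) (v 2)))) (sim (v 0) (v 2))))),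
   (15, or (and (ar 13 (v 0)) (br (v 0))) (and (ar 14 (v 0)) (ex 2 (and (ar 14 (v 2))
      (and (sim (v 2) (v 0)) (lt (v 2) (v 0))))))),
   (16, ex 2 (and (ar 15 (v 2)) (same (v 2) (v 0) (v 1))))]

theorem ssa_classify : ssa classify = true := by decide

def joinStep : Tm := or (.cell 17 (v 0) (v 1)) (ex 2 (and (.cell 17 (v 0) (v 2)) (.cell 16 (v 2) (v 1))))

/-- The reachability by contracted edges. -/
def join : Cmd := .seq (.par 17 (and (eq (v 0) (v 1)) (lt (v 0) (sc 4)))) (.rep 6 (.par 17 joinStep))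

/-- The number of the class of a vertex. -/
def cl (p : Tm) : Tm := ar 19 p

/-- Both ends of the edge number `e` are in the same class. -/
def loop (e : Tm) : Tm := eq (cl (ar 8 e)) (cl (ar 9 e))

/-- The classes, their numbers, the lost solutions, and the size of the kernel. -/
def number : List (Fin 32 × Tm) :=
  [(18, and (lt (v 0) (sc 4)) (all 2 (or (not (lt (v 2) (v 0))) (not (.cell 17 (v 2) (v 0)))))),
   (19, count 2 (and (ar 18 (v 2)) (ex 3 (and (ar 18 (v 3)) (and (.cell 17 (v 3) (v 0))
      (lt (v 2) (v 3))))))),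
   (20, count 2 (ar 18 (v 2))),
   (21, and (and (ar 13 (v 0)) (ar 13 (v 1))) (or (and (eq (v 0) (v 1)) (br (v 0)))
      (and (and (lt (v 0) (v 1)) (and (and (not (br (v 0))) (not (br (v 1)))) (.cell 10 (v 0) (v 1))))
        (and (not (share (v 0) (v 1))) (or (or (loop (v 0)) (loop (v 1)))
          (meet (cl (ar 8 (v 0))) (cl (ar 9 (v 0))) (cl (ar 8 (v 1))) (cl (ar 9 (v 1))))))))),
   (22, ex 2 (ex 3 (.cell 21 (v 2) (v 3)))),
   (23, .add (sc 20) (.ite (sc 22) (.lit 1) (.lit 0)))]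

theorem ssa_number : ssa number = true := by decide

def analyse : Cmd :=
  .seq (parList readGraph) (.seq disconnect (.seq (parList classify) (.seq join (parList number))))

theorem analyse_out (N : ℕ) (ρ : ℕ → ℕ) (u : Mem) : analyse.out N ρ u = [] := by
  simp [analyse, join, Cmd.out, parList_out, disconnect_out]

/-- The memory after the analysis, for any input. -/
structure HasReading (x : List Bool) (N : ℕ) (u w : Mem) : Prop where
  graph : HasGraph x N w
  frame : ∀ a : Fin 32, a ∉ analyse.writes → w a = u a

section

variable {N n : ℕ} {u : Mem} {G : SimpleGraph (Fin n)}

theorem HasGraph.congr {x : List Bool} {w : Mem} (h : HasGraph x N w) {w' : Mem}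
    (hw : ∀ a ∈ [(6 : Fin 32), 4, 7, 5, 8, 9, 13], w' a = w a) : HasGraph x N w' := by
  obtain ⟨h1, h2, h3, h4, h5, h6, h7, h8⟩ := h
  refine ⟨h1, ?_, ?_, ?_, ?_, ?_, ?_, ?_⟩
  · rwa [hw 6 (by decide)]
  · rwa [hw 4 (by decide)]
  · rwa [hw 7 (by decide)]
  · rwa [hw 5 (by decide)]
  · rwa [hw 8 (by decide)]
  · rwa [hw 9 (by decide)]
  · rwa [hw 13 (by decide)]

theorem HasInput.hasReading {x : List Bool} (h : HasInput x N u) :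
    HasReading x N u (analyse.st N (fun _ => 0) u) := by
  refine ⟨h.hasGraph.congr fun a ha => ?_, fun a ha => Cmd.st_of_notMem _ ha⟩
  have h1 : a ∉ (Cmd.seq disconnect (.seq (parList classify) (.seq join (parList number)))).writes := by
    revert a
    decide
  exact Cmd.st_of_notMem _ h1

variable [NeZero n]

/-- The meaning of the arrays that describe the edges. -/
structure HasEdges (G : SimpleGraph (Fin n)) (N : ℕ) (w : Mem) : Prop where
  bound : 3 * (n * n) + 10 ≤ N
  size : w 4 0 0 = n
  isE : ∀ e < N, ∀ j < N, (w 13 e j ≠ 0 ↔ G.IsE e)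
  hd : ∀ e < N, w 8 e 0 = e / n
  tl : ∀ e < N, w 9 e 0 = e % n
  sep : ∀ e f, e < n * n → f < n * n → (w 10 e f ≠ 0 ↔ G.Separates {ed n e, ed n f})

theorem HasEdges.lt (h : HasEdges G N u) {e : ℕ} (he : G.IsE e) : e < N := by
  have := he.lt
  have := h.bound
  omega

theorem HasEdges.sq_le (h : HasEdges G N u) : n * n ≤ N := by
  have := h.bound
  omega

theorem HasEdges.lt_bound (h : HasEdges G N u) : n < N := by
  have := h.bound
  have : n ≤ n * n := Nat.le_mul_self n
  omega

theorem HasInput.hasEdges (h : HasInput G.encode N u) {w : Mem}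
    (hw : ∀ a ∈ [(4 : Fin 32), 13, 8, 9, 10], w a =
      (Cmd.seq (parList readGraph) disconnect).st N (fun _ => 0) u a) : HasEdges G N w := by
  have h0 := NeZero.pos n
  have hg := h.hasGraph
  have hs := sqrt_length_encode (G := G)
  have hb := hg.bound
  rw [length_encode] at hb
  have hd : ∀ a ∈ [(4 : Fin 32), 13, 8, 9], w a = (parList readGraph).st N (fun _ => 0) u a := by
    intro a ha
    rw [hw a (by revert a; decide)]
    exact Cmd.st_of_notMem disconnect (by revert a; decide)
  refine ⟨hb, ?_, ?_, ?_, ?_, ?_⟩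
  · rw [hd 4 (by decide), hg.n 0 (by omega) 0 (by omega), hs]
  · intro e he j hj
    rw [hd 13 (by decide), hg.isE (by rwa [hs]) e he j hj, hs, isE_iff, adjBit_encode]
    constructor
    · rintro ⟨h1, h2, h3, h4⟩
      exact ⟨h2, h1, h4⟩
    · rintro ⟨h2, h1, h4⟩
      exact ⟨h1, h2, Nat.mod_lt _ h0, h4⟩
  · intro e he
    rw [hd 8 (by decide), hg.hd (by rwa [hs]) e he 0 (by omega), hs]
  · intro e he
    rw [hd 9 (by decide), hg.tl (by rwa [hs]) e he 0 (by omega), hs]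
  · intro e f he hf
    obtain ⟨R, h1, h2⟩ := hg.disconnect_spec (e := e) (f := f) (by omega) (by omega)
    rw [hw 10 (by decide)]
    change disconnect.st N _ _ 10 e f ≠ 0 ↔ _
    rw [h2, hs]
    rw [hs] at h1
    exact isClosure_separates he hf (h1 h0)

/-- The number 0 stands for the pair of vertex 0 with itself, so the cell `(0, 0)` of array 10 tests
the graph without any deletion. -/
theorem HasEdges.not_cutConnected (h : HasEdges G N u) : u 10 0 0 ≠ 0 ↔ ¬ G.CutConnected := by
  have h0 := NeZero.pos n
  have h1 : 0 < n * n := Nat.mul_pos h0 h0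
  have h2 : ed n 0 = s(Fin.ofNat n 0, Fin.ofNat n 0) := by simp [ed]
  rw [h.sep 0 0 h1 h1, Set.pair_eq_singleton, h2, not_cutConnected_iff]

theorem HasEdges.br (h : HasEdges G N u) (hG : G.CutConnected) {e : ℕ} (he : G.IsE e) :
    u 10 e e ≠ 0 ↔ G.Br (ed n e) := by
  rw [h.sep e e he.lt he.lt, Set.pair_eq_singleton, hG.separates_singleton]

theorem HasEdges.isCut (h : HasEdges G N u) (hG : G.CutConnected) {e f : ℕ} (he : G.IsE e)
    (hf : G.IsE f) (he' : ¬ G.Br (ed n e)) (hf' : ¬ G.Br (ed n f)) :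
    u 10 e f ≠ 0 ↔ G.IsCut {ed n e, ed n f} := by
  rw [h.sep e f he.lt hf.lt, hG.separates_pair he' hf']

theorem HasEdges.sim (h : HasEdges G N u) (hG : G.CutConnected) {e f : ℕ} (he : G.IsE e)
    (hf : G.IsE f) (he' : ¬ G.Br (ed n e)) (hf' : ¬ G.Br (ed n f)) :
    e = f ∨ u 10 e f ≠ 0 ↔ G.Sim (ed n e) (ed n f) := by
  rw [h.isCut hG he hf he' hf', Sim, he.eq hf]

/-- The ends of the edges `e` and `f`, mapped by `c`, meet. -/
def Meet (n : ℕ) (c : ℕ → ℕ) (e f : ℕ) : Prop :=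
  (c (e / n) = c (f / n) ∨ c (e / n) = c (f % n)) ∨ (c (e % n) = c (f / n) ∨ c (e % n) = c (f % n))

theorem meet_iff {e f : ℕ} (he : e < n * n) (hf : f < n * n) {c : ℕ → ℕ} {W : Type*} {π : Fin n → W}
    (hc : ∀ p q : Fin n, c p = c q ↔ π p = π q) :
    Meet n c e f ↔ ∃ v ∈ ed n e, ∃ w ∈ ed n f, π v = π w := by
  rw [ed_eq he, ed_eq hf]
  simp only [Sym2.mem_iff, exists_eq_or_imp, exists_eq_left]
  simp only [← hc]
  rfl

theorem HasEdges.holds_share (h : HasEdges G N u) {ρ : ℕ → ℕ} {s t : Tm} (hs : s.val N u ρ < N)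
    (ht : t.val N u ρ < N) :
    (share s t).Holds N u ρ ↔ Meet n id (s.val N u ρ) (t.val N u ρ) := by
  simp only [share, meet, holds_or, holds_eq, val, h.hd _ hs, h.tl _ hs, h.hd _ ht, h.tl _ ht]
  rfl

theorem HasEdges.meet_id {e f : ℕ} (he : G.IsE e) (hf : G.IsE f) :
    Meet n id e f ↔ ∃ v, v ∈ ed n e ∧ v ∈ ed n f := by
  rw [meet_iff he.lt hf.lt (π := id) (by simp [Fin.ext_iff])]
  simp

end

end MatchingCutKernel

/-! ### Correctness of the classification of the edges and of the fibres -/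

namespace MatchingCutKernel

open RAM RAM.Tm SimpleGraph

variable {N n : ℕ} {u : Mem} {G : SimpleGraph (Fin n)} [NeZero n]

theorem HasEdges.forall_isE (h : HasEdges G N u) {P : Sym2 (Fin n) → Prop} :
    (∀ e < N, G.IsE e → P (ed n e)) ↔ ∀ e ∈ G.edgeSet, P e := by
  constructor
  · intro h1 e he
    have := h1 (ix n e) ((ix_lt e).trans_le h.sq_le) (isE_ix he)
    rwa [ed_ix] at this
  · exact fun h1 e _ he => h1 _ he.1

/-- The meaning of the arrays that describe the contracted edges. -/
structure HasClasses (G : SimpleGraph (Fin n)) (N : ℕ) (w : Mem) : Prop extends HasEdges G N w where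
  conn : G.CutConnected
  loose : ∀ e < N, ∀ j < N, (w 14 e j ≠ 0 ↔ G.IsE e ∧ G.Loose (ed n e))
  ctr : ∀ e < N, ∀ j < N, (w 15 e j ≠ 0 ↔ G.IsE e ∧ G.Ctr (ix n) (ed n e))
  adj : ∀ p < N, ∀ q < N, (w 16 p q ≠ 0 ↔ ∃ (hp : p < n) (hq : q < n),
    (G.ctrGraph (ix n)).Adj ⟨p, hp⟩ ⟨q, hq⟩)

theorem HasEdges.hasClasses (h : HasEdges G N u) (hG : G.CutConnected) :
    HasClasses G N ((parList classify).st N (fun _ => 0) u) := by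
  have hlt := h.lt_bound
  set w := (parList classify).st N (fun _ => 0) u with hw
  have hw' : ∀ a : Fin 32, a ∉ (parList classify).writes → w a = u a := fun a ha =>
    Cmd.st_of_notMem _ ha
  have hE : HasEdges G N w := by
    obtain ⟨h1, h2, h3, h4, h5, h6⟩ := h
    refine ⟨h1, ?_, ?_, ?_, ?_, ?_⟩
    · rwa [hw' 4 (by decide)]
    · rwa [hw' 13 (by decide)]
    · rwa [hw' 8 (by decide)]
    · rwa [hw' 9 (by decide)]
    · rwa [hw' 10 (by decide)]
  have loose : ∀ e < N, ∀ j < N, (w 14 e j ≠ 0 ↔ G.IsE e ∧ G.Loose (ed n e)) := by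
    intro e he j hj
    rw [hw, parList_holds ssa_classify (List.getElem_mem (l := classify) (n := 0) (by decide)) he hj,
      ← hw]
    simp only [holds_and, holds_not, holds_all, holds_or, holds_cell, val, MatchingCutKernel.br, MatchingCutKernel.sim,
      holds_eq]
    have hsh : ∀ i < N, ((share (v 0) (v 2)).Holds N w
        (Function.update (Function.update (Function.update (fun _ => 0) 0 e) 1 j) 2 i) ↔
        Meet n id e i) := by
      intro i hi
      rw [hE.holds_share (by simpa [val] using he) (by simpa [val] using hi)]
      simp [val]
    simp only [Function.update_apply]
    simp only [zero_ne_one, if_false, if_true, OfNat.ofNat_ne_zero,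
      OfNat.zero_ne_ofNat, OfNat.ofNat_ne_one]
    rw [hE.isE e he 0 (by omega)]
    constructor
    · rintro ⟨⟨h1, h2⟩, h3⟩
      rw [hE.br hG h1] at h2
      refine ⟨h1, h1.1, h2, ?_⟩
      rw [← hE.forall_isE]
      rintro f hf hf' hf2 hv
      have h4 := h3 f hf
      rw [hE.isE f hf 0 (by omega), hE.br hG hf', hsh f hf, HasEdges.meet_id h1 hf'] at h4
      rw [← hE.sim hG h1 hf' h2 hf2]
      exact h4.resolve_left fun h5 => h5 ⟨⟨hf', hf2⟩, hv⟩
    · rintro ⟨h1, -, h2, h3⟩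
      refine ⟨⟨h1, by rwa [hE.br hG h1]⟩, fun f hf => ?_⟩
      rw [hsh f hf, hE.isE f hf 0 (by omega)]
      by_contra h4
      rw [not_or, not_not] at h4
      obtain ⟨⟨⟨h5, h6⟩, h7⟩, h8⟩ := h4
      rw [hE.br hG h5] at h6
      rw [HasEdges.meet_id h1 h5] at h7
      rw [hE.sim hG h1 h5 h2 h6] at h8
      exact h8 (h3 _ h5.1 h6 h7)
  have ctr : ∀ e < N, ∀ j < N, (w 15 e j ≠ 0 ↔ G.IsE e ∧ G.Ctr (ix n) (ed n e)) := by
    intro e he j hj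
    rw [hw, parList_holds ssa_classify (List.getElem_mem (l := classify) (n := 1) (by decide)) he hj,
      ← hw]
    simp only [holds_and, holds_ex, holds_lt, holds_or, holds_cell, val, MatchingCutKernel.br, MatchingCutKernel.sim,
      holds_eq, Function.update_apply]
    simp only [zero_ne_one, if_false, if_true, OfNat.ofNat_ne_zero,
      OfNat.zero_ne_ofNat, OfNat.ofNat_ne_one]
    rw [hE.isE e he 0 (by omega), loose e he 0 (by omega)]
    constructor
    · rintro (⟨h1, h2⟩ | ⟨⟨h1, h2⟩, f, h3, h4, h5, h6⟩)
      · exact ⟨h1, Or.inl ((hE.br hG h1).1 h2)⟩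
      · rw [loose f h3 0 (by omega)] at h4
        refine ⟨h1, Or.inr ⟨h2, _, h4.2, (hE.sim hG h4.1 h1 h4.2.2.1 h2.2.1).1 h5, ?_⟩⟩
        rwa [h4.1.2, h1.2]
    · rintro ⟨h1, h2 | ⟨h2, g, h3, h4, h5⟩⟩
      · exact Or.inl ⟨h1, (hE.br hG h1).2 h2⟩
      · have hg := isE_ix h3.1
        refine Or.inr ⟨⟨h1, h2⟩, ix n g, hE.lt hg, ?_, ?_, by rwa [h1.2] at h5⟩
        · rw [loose _ (hE.lt hg) 0 (by omega), ed_ix]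
          exact ⟨hg, h3⟩
        · rw [hE.sim hG hg h1 (by rw [ed_ix]; exact h3.2.1) h2.2.1, ed_ix]
          exact h4
  refine ⟨hE, hG, loose, ctr, fun p hp q hq => ?_⟩
  rw [hw, parList_holds ssa_classify (List.getElem_mem (l := classify) (n := 2) (by decide)) hp hq,
      ← hw]
  simp only [same, holds_and, holds_ex, holds_or, holds_cell, val, holds_eq, Function.update_apply]
  simp only [zero_ne_one, if_false, if_true, OfNat.ofNat_ne_zero,
      OfNat.zero_ne_ofNat, OfNat.ofNat_ne_one, OfNat.one_ne_ofNat, one_ne_zero]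
  simp only [ctrGraph_adj]
  constructor
  · rintro ⟨e, h1, h2, h3⟩
    rw [ctr e h1 0 (by omega)] at h2
    rw [hE.hd e h1, hE.tl e h1] at h3
    have hd := h2.1.div_lt
    have ht := Nat.mod_lt e (NeZero.pos n)
    have hp : p < n := by rcases h3 with ⟨rfl, rfl⟩ | ⟨rfl, rfl⟩ <;> assumption
    have hq : q < n := by rcases h3 with ⟨rfl, rfl⟩ | ⟨rfl, rfl⟩ <;> assumption
    refine ⟨hp, hq, ?_⟩
    rw [(sameEnds_iff h2.1.lt hp hq).1 h3]
    exact h2.2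
  · rintro ⟨hp, hq, h1⟩
    have h2 := isE_ix h1.mem_edgeSet
    refine ⟨_, hE.lt h2, ?_, ?_⟩
    · rw [ctr _ (hE.lt h2) 0 (by omega), ed_ix]
      exact ⟨h2, h1⟩
    · rw [hE.hd _ (hE.lt h2), hE.tl _ (hE.lt h2)]
      exact (sameEnds_iff h2.lt hp hq).2 (ed_ix _).symm

theorem HasClasses.join (h : HasClasses G N u) {p q : ℕ} (hp : p < N) (hq : q < N) :
    MatchingCutKernel.join.st N (fun _ => 0) u 17 p q ≠ 0 ↔
      ∃ (hp : p < n) (hq : q < n), (G.ctrGraph (ix n)).Reachable ⟨p, hp⟩ ⟨q, hq⟩ := by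
  have hlt := h.lt_bound
  set u₁ := (Cmd.par 17 (and (eq (v 0) (v 1)) (lt (v 0) (sc 4)))).st N (fun _ => 0) u with hu₁
  have hu₁' : ∀ b ≠ 17, u₁ b = u b := fun b hb => by rw [hu₁, Cmd.st_par_of_ne hb]
  have hc := isClosure_rep (N := N) (n := n) hlt (a := 17) (t := joinStep) (y := 6) (ρ := fun _ => 0)
    (u := u₁) (S := fun q => p = q ∧ p < n) (E := fun a b => ∃ (ha : a < n) (hb : b < n),
      (G.ctrGraph (ix n)).Adj ⟨a, ha⟩ ⟨b, hb⟩) hp (fun w hw z j hj => ?_) (fun j hj => ?_)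
      (by rintro q ⟨rfl, h⟩; exact h) (by rintro a b ⟨ha, hb, -⟩; exact ⟨ha, hb⟩)
  · have h1 : MatchingCutKernel.join.st N (fun _ => 0) u 17 p q ≠ 0 ↔
        (q < N ∧ (Cmd.rep 6 (.par 17 joinStep)).st N (fun _ => 0) u₁ 17 p q ≠ 0) :=
      ⟨fun h => ⟨hq, h⟩, fun h => h.2⟩
    rw [h1]
    constructor
    · intro h2
      refine hc.least (fun q => ∃ (hp : p < n) (hq : q < n),
        (G.ctrGraph (ix n)).Reachable ⟨p, hp⟩ ⟨q, hq⟩) ?_ ?_ q h2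
      · rintro _ ⟨rfl, h⟩
        exact ⟨h, h, .refl _⟩
      · rintro a b ⟨hp, ha, h3⟩ ⟨_, hb, h4⟩
        exact ⟨hp, hb, h3.trans h4.reachable⟩
    · rintro ⟨hp, hq, ⟨W⟩⟩
      have key : ∀ a b : Fin n, (G.ctrGraph (ix n)).Walk a b →
          (a < N ∧ (Cmd.rep 6 (.par 17 joinStep)).st N (fun _ => 0) u₁ 17 p a ≠ 0) →
          (b < N ∧ (Cmd.rep 6 (.par 17 joinStep)).st N (fun _ => 0) u₁ 17 p b ≠ 0) := by
        intro a b W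
        induction W with
        | nil => exact id
        | cons hadj W ih => exact fun h3 => ih (hc.closed _ _ h3 ⟨_, _, hadj⟩)
      exact key _ _ W (hc.start p ⟨rfl, hp⟩)
  · simp only [joinStep, holds_or, holds_cell, holds_ex, holds_and, val, Function.update_apply]
    simp only [zero_ne_one, if_false, if_true, Nat.reduceEqDiff, OfNat.ofNat_ne_zero,
      OfNat.zero_ne_ofNat, OfNat.ofNat_ne_one, OfNat.one_ne_ofNat]
    refine or_congr Iff.rfl (exists_congr fun q => and_congr_right fun hq => ?_)
    rw [hw 16 (by decide), hu₁' 16 (by decide), h.adj q hq j hj]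
  · have : u₁ 17 p j = (and (eq (v 0) (v 1)) (lt (v 0) (sc 4))).val N u
        (Function.update (Function.update (fun _ => 0) 0 p) 1 j) := by
      simp only [hu₁, Cmd.st, hp, hj, and_self, if_true]
    rw [this]
    change Holds _ _ _ _ ↔ _
    simp [val, h.size]

/-- The meaning of the arrays after the analysis of a connected graph; `m` is the number of the
contracted vertices and `π` the contraction. -/
structure HasKernel (G : SimpleGraph (Fin n)) (N : ℕ) {m : ℕ} (π : Fin n → Fin m) (w : Mem) : Prop
    extends HasClasses G N w where
  contr : G.IsContraction (ix n) π
  le : m ≤ n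
  cl : ∀ p : Fin n, w 19 p 0 = π p
  zero : (π 0 : ℕ) = 0
  lost : ∀ e < N, ∀ f < N, (w 21 e f ≠ 0 ↔ G.IsE e ∧ G.IsE f ∧ e ≤ f ∧ G.LostSol π {ed n e, ed n f})
  pend : w 22 0 0 ≠ 0 ↔ ∃ M, G.LostSol π M
  count : w 20 0 0 = m
  card : w 23 0 0 = m + if w 22 0 0 ≠ 0 then 1 else 0

end MatchingCutKernel

/-! ### A description of the lost solutions by single edges and pairs -/

namespace SimpleGraph

variable {V W : Type*} {G : SimpleGraph V} {ix : Sym2 V → ℕ} {π : V → W}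

/-- A bridge is always a solution, and always lost, because it is contracted. -/
theorem IsContraction.lostSol_singleton (hπ : G.IsContraction ix π) {a : Sym2 V} :
    G.LostSol π {a} ↔ G.Br a := by
  constructor
  · exact fun h => h.1.1
  · refine fun h => ⟨h.isBond, ?_, by simp, fun hk => ?_⟩
    · rintro e rfl f rfl _ _ _
      rfl
    · exact hk.2.1 a rfl (hπ.isDiag_of_ctr (Or.inl h))

theorem lostSol_pair {a b : Sym2 V} (hab : a ≠ b) : G.LostSol π {a, b} ↔
    (¬ G.Br a ∧ ¬ G.Br b ∧ G.IsCut {a, b}) ∧ (¬ ∃ v, v ∈ a ∧ v ∈ b) ∧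
      (((a.map π).IsDiag ∨ (b.map π).IsDiag) ∨ ∃ v ∈ a, ∃ w ∈ b, π v = π w) := by
  have hbr : G.IsBond {a, b} ↔ ¬ G.Br a ∧ ¬ G.Br b ∧ G.IsCut {a, b} := by
    constructor
    · refine fun h => ⟨fun h' => ?_, fun h' => ?_, h.1⟩
      · have := h.eq_of_br (by simp) h'
        have h2 : b ∈ ({a, b} : Set (Sym2 V)) := by simp
        rw [this] at h2
        exact hab h2.symm
      · have := h.eq_of_br (by simp) h'
        have h2 : a ∈ ({a, b} : Set (Sym2 V)) := by simp
        rw [this] at h2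
        exact hab h2
    · exact fun h => isBond_pair h.1 h.2.1 hab (Or.inr h.2.2)
  have hmat : IsMat {a, b} ↔ ¬ ∃ v, v ∈ a ∧ v ∈ b := by
    constructor
    · rintro h ⟨v, h1, h2⟩
      exact hab (h a (by simp) b (by simp) v h1 h2)
    · intro h e he f hf v h1 h2
      rcases he with rfl | rfl <;> rcases hf with rfl | rfl
      · rfl
      · exact absurd ⟨v, h1, h2⟩ h
      · exact absurd ⟨v, h2, h1⟩ h
      · rfl
  have hpi : PiMat π {a, b} ↔ ¬ ∃ v ∈ a, ∃ w ∈ b, π v = π w := by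
    constructor
    · rintro h ⟨v, h1, w, h2, h3⟩
      exact hab (h a (by simp) b (by simp) v h1 w h2 h3)
    · intro h e he f hf v h1 w h2 h3
      rcases he with rfl | rfl <;> rcases hf with rfl | rfl
      · rfl
      · exact absurd ⟨v, h1, w, h2, h3⟩ h
      · exact absurd ⟨w, h2, v, h1, h3.symm⟩ h
      · rfl
  have hdiag : (∀ e ∈ ({a, b} : Set (Sym2 V)), ¬ (e.map π).IsDiag) ↔
      ¬ (a.map π).IsDiag ∧ ¬ (b.map π).IsDiag := by simp
  rw [LostSol, Kept, hdiag, hpi, hmat, Set.ncard_pair hab, ← hbr]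
  have : (2 : ℕ) < 3 := by norm_num
  simp only [this, true_and]
  clear hbr hmat hpi hdiag
  generalize G.IsBond {a, b} = p₁, (a.map π).IsDiag = p₂, (b.map π).IsDiag = p₃,
    (∃ v ∈ a, ∃ w ∈ b, π v = π w) = p₄
  tauto

theorem LostSol.cases [Finite V] {M : Set (Sym2 V)} (h : G.LostSol π M) :
    (∃ a, M = {a}) ∨ ∃ a b, a ≠ b ∧ M = {a, b} := by
  have h1 := (Set.ncard_pos (Set.toFinite M)).2 h.1.2.1
  have h2 := h.2.2.1
  rcases (show M.ncard = 1 ∨ M.ncard = 2 by omega) with h3 | h3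
  · exact Or.inl (Set.ncard_eq_one.1 h3)
  · exact Or.inr (Set.ncard_eq_two.1 h3)

end SimpleGraph

/-! ### The analysis of a connected graph -/

namespace MatchingCutKernel

open RAM RAM.Tm SimpleGraph

variable {N n : ℕ} {u : Mem} {G : SimpleGraph (Fin n)} [NeZero n]

theorem HasEdges.exists_lostSol (h : HasEdges G N u) {W : Type*} {π : Fin n → W} :
    (∃ M, G.LostSol π M) ↔ ∃ e < N, ∃ f < N, G.IsE e ∧ G.IsE f ∧ e ≤ f ∧
      G.LostSol π {ed n e, ed n f} := by
  constructor
  · rintro ⟨M, hM⟩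
    rcases hM.cases with ⟨a, rfl⟩ | ⟨a, b, hab, rfl⟩
    · have ha := isE_ix (hM.1.1.subset rfl)
      refine ⟨ix n a, h.lt ha, ix n a, h.lt ha, ha, ha, le_rfl, ?_⟩
      rwa [ed_ix, Set.pair_eq_singleton]
    · wlog hle : ix n a ≤ ix n b generalizing a b
      · exact this b a hab.symm (by rwa [Set.pair_comm]) (le_of_not_ge hle)
      have ha := isE_ix (G := G) (e := a) (hM.1.1.subset (by simp))
      have hb := isE_ix (G := G) (e := b) (hM.1.1.subset (by simp))
      refine ⟨ix n a, h.lt ha, ix n b, h.lt hb, ha, hb, hle, ?_⟩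
      rwa [ed_ix, ed_ix]
  · rintro ⟨e, -, f, -, -, -, -, h1⟩
    exact ⟨_, h1⟩

theorem map_ed_isDiag {e : ℕ} (he : e < n * n) {c : ℕ → ℕ} {W : Type*} {π : Fin n → W}
    (hc : ∀ p q : Fin n, c p = c q ↔ π p = π q) :
    c (e / n) = c (e % n) ↔ ((ed n e).map π).IsDiag := by
  rw [ed_eq he, Sym2.map_mk, Sym2.mk_isDiag_iff, ← hc]

-- The contraction is fixed before the bound and the memory: kernelization and lifting run with
-- different bounds, but have to number the fibres in the same way.
open Classical in
theorem exists_hasKernel (hG : G.CutConnected) : ∃ (m : ℕ) (π : Fin n → Fin m),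
    ∀ N u, HasClasses G N u →
      HasKernel G N π ((Cmd.seq MatchingCutKernel.join (parList number)).st N (fun _ => 0) u) := by
  have h0 := NeZero.pos n
  set Q : ℕ → ℕ → Prop := fun p q => ∃ (hp : p < n) (hq : q < n),
    (G.ctrGraph (ix n)).Reachable ⟨p, hp⟩ ⟨q, hq⟩ with hQ
  obtain ⟨m, d, hd, hdQ, hdlt, hdsurj, hd0⟩ := exists_numbering (Q := Q)
    (fun p hp => ⟨hp, hp, .refl _⟩) (fun p q ⟨hp, hq, h⟩ => ⟨hq, hp, h.symm⟩)
    (fun p q r ⟨hp, hq, h⟩ ⟨_, hr, h'⟩ => ⟨hp, hr, h.trans h'⟩) (fun p q h => h.1)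
  let π : Fin n → Fin m := fun p => ⟨d p, hdlt p p.2⟩
  have hc : ∀ p q : Fin n, d p = d q ↔ π p = π q := fun p q => Fin.mk.inj_iff.symm
  have hcon : G.IsContraction (ix n) π := by
    refine ⟨hG, ix_injective.injOn, fun p q => ?_, fun k => ?_⟩
    · rw [← hc, hdQ p p.2 q q.2]
      exact ⟨fun ⟨_, _, h⟩ => h, fun h => ⟨p.2, q.2, h⟩⟩
    · obtain ⟨p, hp, hpk⟩ := hdsurj k k.2
      exact ⟨⟨p, hp⟩, Fin.ext hpk⟩
  refine ⟨m, π, fun N u h => ?_⟩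
  have hlt := h.lt_bound
  set u₁ := MatchingCutKernel.join.st N (fun _ => 0) u with hu₁
  set w := (parList number).st N (fun _ => 0) u₁ with hw
  have h17 : ∀ p < N, ∀ q < N, (w 17 p q ≠ 0 ↔ Q p q) := by
    intro p hp q hq
    rw [hw, Cmd.st_of_notMem (b := 17) _ (by decide)]
    exact h.join hp hq
  have hw' : ∀ a : Fin 32, a ∉ (Cmd.seq MatchingCutKernel.join (parList number)).writes → w a = u a :=
    fun a ha => Cmd.st_of_notMem (Cmd.seq MatchingCutKernel.join (parList number)) ha
  have hC : HasClasses G N w := by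
    obtain ⟨⟨h1, h2, h3, h4, h5, h6⟩, h7, h8, h9, h10⟩ := h
    refine ⟨⟨h1, ?_, ?_, ?_, ?_, ?_⟩, h7, ?_, ?_, ?_⟩
    · rwa [hw' 4 (by decide)]
    · rwa [hw' 13 (by decide)]
    · rwa [hw' 8 (by decide)]
    · rwa [hw' 9 (by decide)]
    · rwa [hw' 10 (by decide)]
    · rwa [hw' 14 (by decide)]
    · rwa [hw' 15 (by decide)]
    · rwa [hw' 16 (by decide)]
  have root : ∀ p < N, ∀ j < N, (w 18 p j ≠ 0 ↔ IsRoot n Q p) := by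
    intro p hp j hj
    rw [hw, parList_holds ssa_number (List.getElem_mem (l := number) (n := 0) (by decide)) hp hj, ← hw]
    simp only [holds_and, holds_lt, holds_all, holds_or, holds_not, holds_cell, val,
      Function.update_apply]
    simp only [zero_ne_one, if_false, if_true, OfNat.ofNat_ne_zero,
      OfNat.zero_ne_ofNat, OfNat.ofNat_ne_one]
    rw [hC.size]
    refine and_congr_right fun hpn => ⟨fun h1 q hq => ?_, fun h1 q hq => ?_⟩
    · rw [← h17 q (by omega) p hp]
      exact (h1 q (by omega)).resolve_left fun h2 => h2 hq
    · rw [h17 q hq p hp]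
      by_cases hqp : q < p
      · exact Or.inr (h1 q hqp)
      · exact Or.inl hqp
  have cl : ∀ p < n, ∀ j < N, w 19 p j = d p := by
    intro p hp j hj
    rw [hw, parList_spec _ ssa_number (19, _) (List.getElem_mem (l := number) (n := 1) (by decide)) p
      (by omega) j hj, ← hw]
    simp only [val_count, holds_and, holds_lt, holds_ex, holds_cell, val, Function.update_apply]
    simp only [zero_ne_one, if_false, if_true, Nat.reduceEqDiff, OfNat.ofNat_ne_zero,
      OfNat.zero_ne_ofNat, OfNat.ofNat_ne_one]
    refine Eq.trans ?_ ((hd N hlt.le).2 p hp)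
    congr 1
    ext r
    simp only [Finset.mem_filter, Finset.mem_range]
    refine and_congr_right fun hr => ?_
    rw [root r hr 0 (by omega)]
    refine and_congr_right fun _ => exists_congr fun q => and_congr_right fun hq => ?_
    rw [root q hq 0 (by omega), h17 q hq p (by omega)]
  have count : w 20 0 0 = m := by
    rw [hw, parList_spec _ ssa_number (20, _) (List.getElem_mem (l := number) (n := 2) (by decide)) 0
      (by omega) 0 (by omega), ← hw]
    simp only [val_count, holds_cell, val, Function.update_apply]
    simp only [if_true]
    rw [← (hd N hlt.le).1]
    congr 1
    refine Finset.filter_congr fun r hr => ?_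
    exact root r (Finset.mem_range.1 hr) 0 (by omega)
  have lost : ∀ e < N, ∀ f < N,
      (w 21 e f ≠ 0 ↔ G.IsE e ∧ G.IsE f ∧ e ≤ f ∧ G.LostSol π {ed n e, ed n f}) := by
    intro e he f hf
    rw [hw, parList_holds ssa_number (List.getElem_mem (l := number) (n := 3) (by decide)) he hf, ← hw]
    have hsh : (share (v 0) (v 1)).Holds N w
        (Function.update (Function.update (fun _ => 0) 0 e) 1 f) ↔ Meet n id e f := by
      rw [hC.holds_share (by simpa [val] using he) (by simpa [val] using hf)]
      simp [val]
    simp only [holds_and, holds_lt, holds_or, holds_not, holds_cell, holds_eq, val, loop,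
      MatchingCutKernel.br, MatchingCutKernel.cl, meet, Function.update_apply, hsh]
    simp only [zero_ne_one, if_false, if_true, one_ne_zero]
    rw [hC.isE e he 0 (by omega), hC.isE f hf 0 (by omega)]
    rw [← and_assoc (b := G.IsE f)]
    refine and_congr_right fun ⟨hE, hF⟩ => ?_
    have hde := hE.div_lt
    have hdf := hF.div_lt
    have hte := Nat.mod_lt e h0
    have htf := Nat.mod_lt f h0
    rw [hC.hd e he, hC.tl e he, hC.hd f hf, hC.tl f hf, cl _ hde 0 (by omega), cl _ hte 0 (by omega),
      cl _ hdf 0 (by omega), cl _ htf 0 (by omega), hC.br h.conn hE, hC.br h.conn hF]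
    -- Lost solutions are recorded with `e ≤ f`; the diagonal stands for bridges, and `e < f` for
    -- cuts with two edges.
    rcases lt_trichotomy e f with h1 | h1 | h1
    · have hne : ed n e ≠ ed n f := fun h2 => h1.ne ((hE.eq hF).1 h2)
      rw [lostSol_pair hne, HasEdges.meet_id hE hF, map_ed_isDiag hE.lt hc, map_ed_isDiag hF.lt hc]
      have h3 := meet_iff hE.lt hF.lt hc
      rw [Meet] at h3
      rw [h3]
      have h4 : ∀ X : Prop, ((¬ G.Br (ed n e) ∧ ¬ G.Br (ed n f)) ∧ w 10 e f ≠ 0) ∧ X ↔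
          (¬ G.Br (ed n e) ∧ ¬ G.Br (ed n f) ∧ G.IsCut {ed n e, ed n f}) ∧ X := by
        intro X
        refine and_congr_left fun _ => ?_
        rw [and_assoc]
        refine and_congr_right fun h5 => and_congr_right fun h6 => ?_
        exact hC.isCut h.conn hE hF h5 h6
      simp only [h1, h1.ne, h1.le, false_and, true_and, false_or]
      exact h4 _
    · subst h1
      rw [Set.pair_eq_singleton, hcon.lostSol_singleton]
      simp
    · simp [h1.ne', h1.not_gt, h1.not_ge]
  have pend : w 22 0 0 ≠ 0 ↔ ∃ M, G.LostSol π M := by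
    rw [hw, parList_holds ssa_number (List.getElem_mem (l := number) (n := 4) (by decide)) (by omega)
      (by omega), ← hw]
    simp only [holds_ex, holds_cell, val, Function.update_apply]
    simp only [Nat.reduceEqDiff, if_true, if_false]
    rw [hC.exists_lostSol]
    refine exists_congr fun e => and_congr_right fun he => exists_congr fun f =>
      and_congr_right fun hf => ?_
    exact lost e he f hf
  refine ⟨hC, hcon, ?_, fun p => cl p p.2 0 (by omega), hd0 h0, lost, pend, count, ?_⟩
  · have := Fintype.card_le_of_surjective π hcon.surj
    simpa using this
  · change w 23 0 0 = _
    rw [hw, parList_spec _ ssa_number (23, _) (List.getElem_mem (l := number) (n := 5) (by decide)) 0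
      (by omega) 0 (by omega), ← hw]
    simp only [val, count]
    rfl

theorem HasInput.hasEdges_analyse (h : HasInput G.encode N u) :
    HasEdges G N (analyse.st N (fun _ => 0) u) := by
  refine h.hasEdges fun a ha => ?_
  change (Cmd.seq (parList classify) (.seq MatchingCutKernel.join (parList number))).st N (fun _ => 0)
    ((Cmd.seq (parList readGraph) disconnect).st N (fun _ => 0) u) a = _
  exact Cmd.st_of_notMem _ (by revert a; decide)

theorem HasInput.hasKernel (hG : G.CutConnected) : ∃ (m : ℕ) (π : Fin n → Fin m),
    ∀ N u, HasInput G.encode N u → HasKernel G N π (analyse.st N (fun _ => 0) u) := by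
  obtain ⟨m, π, h⟩ := exists_hasKernel hG
  exact ⟨m, π, fun N u hu => h N _ ((hu.hasEdges fun _ _ => rfl).hasClasses hG)⟩

end MatchingCutKernel

/-! ## The kernelization algorithm -/

namespace SimpleGraph

theorem map_range_eq_encode {k : ℕ} (H : SimpleGraph (Fin k)) (f : ℕ → ℕ)
    (h : ∀ a b : Fin k, f (a * k + b) ≠ 0 ↔ H.Adj a b) :
    ((List.range (k * k)).map fun i => decide (f i ≠ 0)) = H.encode := by
  apply List.ext_getElem
  · simp [encode]
  · intro i h1 h2
    simp only [List.getElem_map, List.getElem_range, encode, List.getElem_ofFn]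
    have h3 := h (Fin.divNat ⟨i, by simpa using h1⟩) (Fin.modNat ⟨i, by simpa using h1⟩)
    simp only [Fin.divNat, Fin.modNat, Nat.div_add_mod'] at h3
    exact decide_eq_decide.2 h3

/-- The graph with an additional vertex adjacent to `w₀`. -/
def addPendant {m : ℕ} (H : SimpleGraph (Fin m)) (w₀ : Fin m) : SimpleGraph (Fin (m + 1)) where
  Adj a b := (∃ a' b', a = Fin.castSucc a' ∧ b = Fin.castSucc b' ∧ H.Adj a' b') ∨
    (a = Fin.last m ∧ b = Fin.castSucc w₀ ∨ b = Fin.last m ∧ a = Fin.castSucc w₀)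
  symm := ⟨by
    rintro a b (⟨a', b', h1, h2, h3⟩ | h)
    · exact Or.inl ⟨b', a', h2, h1, h3.symm⟩
    · exact Or.inr h.symm⟩
  loopless := ⟨by
    rintro a (⟨a', b', h1, h2, h3⟩ | ⟨h1, h2⟩ | ⟨h1, h2⟩)
    · exact H.ne_of_adj h3 (Fin.castSucc_injective m (h1.symm.trans h2))
    · exact (Fin.castSucc_lt_last w₀).ne (h2.symm.trans h1)
    · exact (Fin.castSucc_lt_last w₀).ne (h2.symm.trans h1)⟩

theorem isPendant_addPendant {m : ℕ} (H : SimpleGraph (Fin m)) (w₀ : Fin m) :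
    IsPendant H (H.addPendant w₀) Fin.castSucc (Fin.last m) w₀ := by
  have hl : ∀ a : Fin m, Fin.castSucc a ≠ Fin.last m := fun a => (Fin.castSucc_lt_last a).ne
  refine ⟨Fin.castSucc_injective m, hl, fun x => ?_, fun a b => ?_, fun x => ?_⟩
  · induction x using Fin.lastCases with
    | last => exact Or.inl rfl
    | cast a => exact Or.inr ⟨a, rfl⟩
  · constructor
    · rintro (⟨a', b', h1, h2, h3⟩ | ⟨h, -⟩ | ⟨h, -⟩)
      · rwa [Fin.castSucc_injective m h1, Fin.castSucc_injective m h2]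
      · exact absurd h (hl a)
      · exact absurd h (hl b)
    · exact fun h => Or.inl ⟨a, b, rfl, rfl, h⟩
  · constructor
    · rintro (⟨a', b', h1, -, -⟩ | ⟨-, h⟩ | ⟨-, h⟩)
      · exact absurd h1.symm (hl a')
      · exact h
      · exact absurd h.symm (hl w₀)
    · exact fun h => Or.inr (Or.inl ⟨rfl, h⟩)

end SimpleGraph

namespace MatchingCutKernel

open RAM RAM.Tm SimpleGraph

/-- The kernel of a connected graph as a graph with the vertices `0, …, m' - 1`. -/
structure IsNumbered {n m : ℕ} [NeZero n] (G : SimpleGraph (Fin n)) (π : Fin n → Fin m) {m' : ℕ}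
    (H' : SimpleGraph (Fin m')) (k : Fin n → Fin m') (pend : Set (Sym2 (Fin m'))) : Prop where
  isKernel : G.IsKernel (ix n) π H' k pend
  card : (¬ (∃ M, G.LostSol π M) ∧ m' = m) ∨ (∃ M, G.LostSol π M) ∧ m' = m + 1
  map : ∀ p, (k p : ℕ) = π p
  pend_eq : (∃ M, G.LostSol π M) → ∃ (h : m < m') (h₀ : 0 < m'), pend = {s(⟨m, h⟩, ⟨0, h₀⟩)}
  adj : ∀ a b : Fin m', H'.Adj a b ↔
    ((a : ℕ) ≠ b ∧ ∃ p q, (π p : ℕ) = a ∧ (π q : ℕ) = b ∧ G.Adj p q) ∨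
      (∃ M, G.LostSol π M) ∧ ((a : ℕ) = m ∧ (b : ℕ) = 0 ∨ (b : ℕ) = m ∧ (a : ℕ) = 0)

variable {n : ℕ} {G : SimpleGraph (Fin n)}

theorem valid_encode : (∀ p q, AdjBit G.encode p q → AdjBit G.encode q p) ∧
    (∀ p, ¬ AdjBit G.encode p p) := by
  constructor
  · intro p q h
    obtain ⟨hp, hq, h⟩ := adjBit_encode.1 h
    exact adjBit_encode.2 ⟨hq, hp, h.symm⟩
  · intro p h
    obtain ⟨hp, hq, h⟩ := adjBit_encode.1 h
    exact G.ne_of_adj h rfl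

theorem HasInput.valid {N : ℕ} {u : Mem} (h : HasInput G.encode N u) :
    analyse.st N (fun _ => 0) u 5 0 0 ≠ 0 ∧ analyse.st N (fun _ => 0) u 4 0 0 = n := by
  have hg := h.hasReading.graph
  have hb := h.bound
  rw [hg.valid, hg.n 0 (by omega) 0 (by omega), sqrt_length_encode]
  exact ⟨⟨length_encode G, valid_encode⟩, rfl⟩

variable [NeZero n]

/-- The pendant vertex receives the last number `m` and is attached to vertex 0, the image of vertex
0 of `G`. This fixed position is what the lifting algorithm looks up. -/
theorem exists_isNumbered {m : ℕ} {π : Fin n → Fin m} (hπ : G.IsContraction (ix n) π)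
    (h0 : (π 0 : ℕ) = 0) : ∃ (m' : ℕ) (H' : SimpleGraph (Fin m')) (k : Fin n → Fin m')
      (pend : Set (Sym2 (Fin m'))), IsNumbered G π H' k pend := by
  have hm : 0 < m := (π 0).pos
  by_cases hl : ∃ M, G.LostSol π M
  · refine ⟨m + 1, (G.quo π).addPendant (π 0), Fin.castSucc ∘ π, _,
      hπ.isKernel_of_pendant (isPendant_addPendant (G.quo π) (π 0)) hl, Or.inr ⟨hl, rfl⟩,
      fun p => rfl, fun _ => ⟨Nat.lt_succ_self m, Nat.succ_pos m, ?_⟩, fun a b => ?_⟩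
    · congr 3
      apply Fin.ext
      exact h0
    · simp only [hl, true_and]
      change (_ ∨ _) ↔ _
      refine or_congr ?_ ?_
      · constructor
        · rintro ⟨a', b', rfl, rfl, h1, p, q, h2, h3, h4⟩
          exact ⟨fun h => h1 (Fin.ext h), p, q, congrArg Fin.val h2, congrArg Fin.val h3, h4⟩
        · rintro ⟨h1, p, q, h2, h3, h4⟩
          refine ⟨π p, π q, Fin.ext h2.symm, Fin.ext h3.symm, fun h5 => h1 ?_, p, q, rfl, rfl, h4⟩
          rw [← h2, ← h3, h5]
      · simp only [Fin.ext_iff, Fin.val_last, Fin.val_castSucc, h0]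
  · refine ⟨m, G.quo π, π, ∅, hπ.isKernel hl, Or.inl ⟨hl, rfl⟩, fun p => rfl, fun h => absurd h hl,
      fun a b => ?_⟩
    simp only [hl, false_and, or_false, quo_adj, Ne, Fin.ext_iff]

/-- The adjacency matrix of the kernel, and its rows one after the other. -/
def flatten : List (Fin 32 × Tm) :=
  [(24, or (and (not (eq (v 0) (v 1))) (ex 2 (ex 3 (and (.cell 7 (v 2) (v 3))
      (and (eq (cl (v 2)) (v 0)) (eq (cl (v 3)) (v 1)))))))
      (and (sc 22) (or (and (eq (v 0) (sc 20)) (eq (v 1) (.lit 0)))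
        (and (eq (v 1) (sc 20)) (eq (v 0) (.lit 0)))))),
   (25, count 2 (and (lt (.lit 0) (v 2)) (le (.cell 6 (v 2) (sc 23)) (v 1)))),
   (26, .cell 24 (.cell 25 (.lit 0) (v 1)) (.sub (v 1) (.cell 6 (.cell 25 (.lit 0) (v 1)) (sc 23))))]

theorem ssa_flatten : ssa flatten = true := by decide

def kernelize : Cmd :=
  .seq analyse (.seq (parList flatten) (.ite (and (sc 5) (lt (.lit 0) (sc 4)))
    (.ite (sc 10) (.emit 30 (.lit 4)) (.emit 26 (.cell 6 (sc 23) (sc 23)))) (.emit 30 (.lit 0))))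

/-- The memory at the start contains the input. -/
theorem hasInput_initMem (x : List Bool) (ws : List (List Bool)) :
    HasInput x (bnd (x :: ws)) (initMem (x :: ws)) := by
  refine ⟨?_, fun j => ?_, ?_⟩
  · simp only [bnd, List.getD_cons_zero]
    omega
  · simp [initMem]
  · simp [initMem]

/-- The output of the kernelization algorithm. -/
def kernelOf (x : List Bool) : List Bool :=
  (kernelize.out (bnd [x]) (fun _ => 0) (initMem [x])).headD []

theorem kernelize_out (x : List Bool) :
    kernelize.out (bnd [x]) (fun _ => 0) (initMem [x]) = [kernelOf x] := by
  have : ∃ y, kernelize.out (bnd [x]) (fun _ => 0) (initMem [x]) = [y] := by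
    simp only [kernelize, Cmd.out, analyse_out, parList_out, List.nil_append]
    split_ifs <;> exact ⟨_, rfl⟩
  obtain ⟨y, hy⟩ := this
  rw [kernelOf, hy]
  rfl

theorem kernelOf_cases (x : List Bool) {N : ℕ} {u w : Mem} (hN : N = bnd [x]) (hu : u = initMem [x])
    (hw : w = (parList flatten).st N (fun _ => 0) (analyse.st N (fun _ => 0) u)) : kernelOf x =
      if w 5 0 0 ≠ 0 ∧ 0 < w 4 0 0 then if w 10 0 0 ≠ 0 then List.replicate 4 false else
        (List.range (min (w 6 (w 23 0 0) (w 23 0 0)) N)).map fun i => decide (w 26 0 i ≠ 0)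
      else [] := by
  subst hN hu
  have h4 : 4 ≤ bnd [x] := by simp only [bnd]; omega
  have h30 : ∀ i, w 30 0 i = 0 := by
    intro i
    rw [hw, Cmd.st_of_notMem (b := 30) _ (by decide), Cmd.st_of_notMem (b := 30) analyse (by decide)]
    simp [initMem]
  have h1 : kernelize.out (bnd [x]) (fun _ => 0) (initMem [x]) =
      if (and (sc 5) (lt (.lit 0) (sc 4))).Holds (bnd [x]) w (fun _ => 0) then
        if (sc 10).Holds (bnd [x]) w (fun _ => 0) then (Cmd.emit 30 (.lit 4)).out (bnd [x]) (fun _ => 0) w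
        else (Cmd.emit 26 (.cell 6 (sc 23) (sc 23))).out (bnd [x]) (fun _ => 0) w
      else (Cmd.emit 30 (.lit 0)).out (bnd [x]) (fun _ => 0) w := by
    rw [hw]
    simp only [kernelize, Cmd.out, analyse_out, parList_out, List.nil_append]
    rfl
  rw [kernelOf, h1]
  simp only [holds_and, holds_lt, holds_cell, val, Cmd.out, h30]
  split_ifs
  · rw [min_eq_left h4]
    rfl
  · rfl
  · simp

/-- If the validity test succeeded with a positive number of vertices, the string would be the
adjacency matrix of a graph. The hypothesis also admits the graph without vertices. -/
theorem kernelOf_of_invalid {x : List Bool} (h : ∀ (n : ℕ) (G : SimpleGraph (Fin n)), G.encode = x → n = 0) :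
    kernelOf x = [] := by
  have hg := ((hasInput_initMem x []).hasReading).graph
  have h4 : 0 < bnd [x] := by simp only [bnd]; omega
  rw [kernelOf_cases x rfl rfl rfl, if_neg]
  rintro ⟨h1, h2⟩
  rw [Cmd.st_of_notMem (b := 5) _ (by decide), hg.valid] at h1
  rw [Cmd.st_of_notMem (b := 4) _ (by decide), hg.n 0 h4 0 h4] at h2
  obtain ⟨h3, h5, h6⟩ := h1
  set n := x.length.sqrt with hn
  let G : SimpleGraph (Fin n) :=
    { Adj := fun p q => AdjBit x p q
      symm := ⟨fun p q hpq => h5 p q hpq⟩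
      loopless := ⟨fun p hp => h6 p hp⟩ }
  refine h2.ne' (h n G ?_)
  apply List.ext_getElem
  · rw [length_encode]; exact h3.symm
  · intro i h7 h8
    have hi : i < n * n := by rwa [← h3]
    simp only [encode, List.getElem_ofFn]
    have : G.Adj (Fin.divNat ⟨i, hi⟩) (Fin.modNat ⟨i, hi⟩) ↔ x[i] = true := by
      change AdjBit x (i / n) (i % n) ↔ _
      rw [AdjBit, ← hn, Nat.div_add_mod', List.getD_eq_getElem _ _ h8]
      exact ⟨fun h => h.2.2, fun h => ⟨Nat.div_lt_of_lt_mul hi, Nat.mod_lt _ h2, h⟩⟩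
    exact Bool.eq_iff_iff.2 ((@decide_eq_true_iff _ (_)).trans this)

theorem kernelOf_of_not_cutConnected (hG : ¬ G.CutConnected) :
    kernelOf G.encode = (⊥ : SimpleGraph (Fin 2)).encode := by
  have hi := hasInput_initMem G.encode []
  have hE := hi.hasEdges_analyse
  have hv := hi.valid
  rw [kernelOf_cases G.encode rfl rfl rfl, Cmd.st_of_notMem (b := 5) _ (by decide),
    Cmd.st_of_notMem (b := 4) _ (by decide), Cmd.st_of_notMem (b := 10) _ (by decide), hv.2,
    if_pos ⟨hv.1, NeZero.pos n⟩, if_pos (hE.not_cutConnected.2 hG)]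
  simp [encode]

theorem IsNumbered.card_eq {N m : ℕ} {π : Fin n → Fin m} {w : Mem} (h : HasKernel G N π w) {m' : ℕ}
    {H' : SimpleGraph (Fin m')} {k : Fin n → Fin m'} {pend : Set (Sym2 (Fin m'))}
    (hn : IsNumbered G π H' k pend) : w 23 0 0 = m' := by
  rw [h.card]
  rcases hn.card with ⟨h1, rfl⟩ | ⟨h1, rfl⟩
  · rw [if_neg (fun h2 => h1 (h.pend.1 h2)), add_zero]
  · rw [if_pos (h.pend.2 h1)]

theorem kernelOf_of_isNumbered {m : ℕ} {π : Fin n → Fin m}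
    (hk : ∀ N u, HasInput G.encode N u → HasKernel G N π (analyse.st N (fun _ => 0) u)) {m' : ℕ}
    {H' : SimpleGraph (Fin m')} {k : Fin n → Fin m'} {pend : Set (Sym2 (Fin m'))}
    (hn : IsNumbered G π H' k pend) : kernelOf G.encode = H'.encode := by
  have hi := hasInput_initMem G.encode []
  have hK := hk _ _ hi
  have hv := hi.valid
  have hg := hi.hasReading.graph
  rw [kernelOf_cases G.encode rfl rfl rfl]
  set N := bnd [G.encode] with hN
  set u := analyse.st N (fun _ => 0) (initMem [G.encode]) with hu
  set w := (parList flatten).st N (fun _ => 0) u with hw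
  have hw' : ∀ a : Fin 32, a ∉ (parList flatten).writes → w a = u a := fun a ha =>
    Cmd.st_of_notMem _ ha
  have hb := hK.bound
  have hm' : m' ≤ n + 1 := by
    have := hK.le
    rcases hn.card with h | h <;> omega
  -- The kernel may have one vertex more than `G`; the factor 3 in the loop bound leaves room for
  -- its adjacency matrix.
  have hmm : m' * m' < N := by
    have h1 := Nat.mul_le_mul hm' hm'
    have h2 := Nat.le_mul_self n
    have h3 : (n + 1) * (n + 1) = n * n + 2 * n + 1 := by ring
    omega
  have hmN : m' < N := by nlinarith
  have h23 : w 23 0 0 = m' := by rw [hw' 23 (by decide), IsNumbered.card_eq hK hn]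
  have h6 : ∀ i < N, ∀ j < N, w 6 i j = i * j := by
    rw [hw' 6 (by decide)]; exact hg.mul
  rw [hw' 5 (by decide), hw' 4 (by decide), hw' 10 (by decide), hv.2, if_pos ⟨hv.1, NeZero.pos n⟩,
    if_neg (fun h => hK.not_cutConnected.1 h hK.conn), h23, h6 m' hmN m' hmN, min_eq_left hmm.le]
  refine map_range_eq_encode H' _ fun a b => ?_
  have ha := a.2
  have hb' := b.2
  have hab : (a : ℕ) * m' + b < m' * m' := by nlinarith
  have h0 : 0 < m' := by omega
  have h25 : w 25 0 (a * m' + b) = a := by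
    rw [hw, parList_spec _ ssa_flatten (25, _) (List.getElem_mem (l := flatten) (n := 1) (by decide)) 0
      (by omega) _ (by omega), ← hw]
    simp only [val_count, holds_and, holds_lt, holds_le, val, Function.update_apply, h23]
    have h1 : (a * m' + b) / m' = a := by
      rw [mul_comm, Nat.mul_add_div h0, Nat.div_eq_of_lt hb', add_zero]
    refine Eq.trans ?_ ((card_filter_mul_le (N := N) h0 (by omega)).trans h1)
    congr 1
    refine Finset.filter_congr fun q hq => ?_
    simp [h6 q (Finset.mem_range.1 hq) m' hmN]
  have h26 : w 26 0 (a * m' + b) = w 24 a b := by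
    rw [hw, parList_spec _ ssa_flatten (26, _) (List.getElem_mem (l := flatten) (n := 2) (by decide)) 0
      (by omega) _ (by omega), ← hw]
    simp only [val, Function.update_apply]
    simp only [if_true]
    rw [h25, h23, h6 a (by omega) m' hmN, Nat.add_sub_cancel_left]
  rw [h26, hw, parList_holds ssa_flatten (List.getElem_mem (l := flatten) (n := 0) (by decide))
    (by omega) (by omega), ← hw]
  simp only [holds_or, holds_and, holds_not, holds_eq, holds_ex, holds_cell, val, cl,
    Function.update_apply]
  simp only [zero_ne_one, if_false, if_true, Nat.reduceEqDiff, OfNat.ofNat_ne_zero,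
      OfNat.zero_ne_ofNat, OfNat.ofNat_ne_one, OfNat.one_ne_ofNat, one_ne_zero]
  rw [hw' 22 (by decide), hw' 20 (by decide), hw' 19 (by decide), hw' 7 (by decide), hK.pend, hK.count,
    hn.adj]
  refine or_congr (and_congr Iff.rfl ?_) Iff.rfl
  constructor
  · rintro ⟨p, h1, q, h2, h3, h4, h5⟩
    rw [hg.adj p h1 q h2] at h3
    obtain ⟨hp, hq, h3⟩ := adjBit_encode.1 h3
    refine ⟨⟨p, hp⟩, ⟨q, hq⟩, ?_, ?_, h3⟩
    · rw [← h4, ← hK.cl]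
    · rw [← h5, ← hK.cl]
  · rintro ⟨p, q, h1, h2, h3⟩
    have hlt := hK.lt_bound
    have hp := p.2
    have hq := q.2
    refine ⟨p, by omega, q, by omega, ?_, ?_, ?_⟩
    · rw [hg.adj p (by omega) q (by omega)]
      exact adjBit_encode.2 ⟨p.2, q.2, h3⟩
    · rw [← h1, hK.cl]
    · rw [← h2, hK.cl]

end MatchingCutKernel

/-! ### The bound for the kernel size -/

namespace MatchingCutKernel

open RAM RAM.Tm SimpleGraph

theorem feedbackEdgeNumber_le_sq {m : ℕ} (H : SimpleGraph (Fin m)) : H.feedbackEdgeNumber ≤ m * m := by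
  classical
  refine (feedbackEdgeNumber_le_ncard H).trans ?_
  have h1 := H.card_edgeFinset_le_card_choose_two
  rw [Fintype.card_fin, Nat.choose_two_right] at h1
  rw [← coe_edgeFinset, Set.ncard_coe_finset]
  have h2 : m * (m - 1) / 2 ≤ m * (m - 1) := Nat.div_le_self _ _
  have h3 : m * (m - 1) ≤ m * m := Nat.mul_le_mul_left _ (Nat.sub_le _ _)
  omega

theorem eq_zero_of_forall_encode {n : ℕ} {G : SimpleGraph (Fin n)} (hn : n = 0) (m : ℕ)
    (H : SimpleGraph (Fin m)) (h : H.encode = G.encode) : m = 0 :=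
  (encode_inj h).1.trans hn

theorem exists_kernelOf {n : ℕ} (G : SimpleGraph (Fin n)) : ∃ (m : ℕ) (H : SimpleGraph (Fin m)),
    kernelOf G.encode = H.encode ∧ m ≤ 8 * (G.feedbackEdgeNumber + 1) := by
  rcases Nat.eq_zero_or_pos n with hn | hn
  · refine ⟨0, ⊥, ?_, Nat.zero_le _⟩
    rw [kernelOf_of_invalid (eq_zero_of_forall_encode hn)]
    simp [encode]
  have : NeZero n := ⟨hn.ne'⟩
  by_cases hG : G.CutConnected
  · obtain ⟨m, π, hk⟩ := HasInput.hasKernel hG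
    have hK := hk _ _ (hasInput_initMem G.encode [])
    obtain ⟨m', H', k, pend, hnum⟩ := exists_isNumbered hK.contr hK.zero
    refine ⟨m', H', kernelOf_of_isNumbered hk hnum, ?_⟩
    have : Nonempty (Fin n) := ⟨0⟩
    have h1 := hK.contr.card_quo_le
    rw [Nat.card_eq_fintype_card, Fintype.card_fin] at h1
    rcases hnum.card with h | h <;> omega
  · exact ⟨2, ⊥, kernelOf_of_not_cutConnected hG, by omega⟩

theorem kernelOf_size (x : List Bool) : ∃ (m : ℕ) (H : SimpleGraph (Fin m)),
    kernelOf x = H.encode ∧ m ≤ 8 * (enumMinimalMC.κ x + 1) := by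
  by_cases hx : ∃ (n : ℕ) (G : SimpleGraph (Fin n)), G.encode = x
  · obtain ⟨n, G, rfl⟩ := hx
    rw [enumMinimalMC_κ]
    exact exists_kernelOf G
  · refine ⟨0, ⊥, ?_, Nat.zero_le _⟩
    rw [kernelOf_of_invalid fun n G h => absurd ⟨n, G, h⟩ hx]
    simp [encode]

theorem isKernelization_kernelOf : IsKernelization enumMinimalMC kernelize.prog kernelOf := by
  constructor
  · refine ⟨5 + kernelize.cost.comp (3 * Polynomial.X + 10), fun x => ?_⟩
    obtain ⟨τ, σ, h1, h2, h3, -⟩ := kernelize.exe_prog [x] (by simp)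
    refine ⟨τ, ⟨σ, h1⟩, h2.trans (kernelize_out x), h3.trans ?_⟩
    simp only [Polynomial.eval_add, Polynomial.eval_comp, Polynomial.eval_mul, Polynomial.eval_X,
      Polynomial.eval_ofNat]
    refine Nat.add_le_add_left (eval_mono _ ?_) 5
    simp only [bnd, List.getD_cons_zero, List.getD_cons_succ, List.getD_nil, List.length_nil]
    omega
  -- A graph with `m` vertices has an encoding of length `m * m` and feedback edge number at most `m
  -- * m`.
  · refine ⟨fun k => 2 * ((8 * (k + 1)) * (8 * (k + 1))), ?_, fun x => ?_⟩
    · have h1 : Primrec fun k : ℕ => 8 * (k + 1) :=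
        Primrec.nat_mul.comp (Primrec.const 8) Primrec.succ
      exact (Primrec.nat_mul.comp (Primrec.const 2) (Primrec.nat_mul.comp h1 h1)).to_comp
    · obtain ⟨m, H, h1, h2⟩ := kernelOf_size x
      rw [h1, length_encode, enumMinimalMC_κ]
      have h3 := feedbackEdgeNumber_le_sq H
      have h4 := Nat.mul_le_mul h2 h2
      change _ ≤ 2 * ((8 * (enumMinimalMC.κ x + 1)) * (8 * (enumMinimalMC.κ x + 1)))
      omega

end MatchingCutKernel

/-! ## The enumeration of choice functions -/

namespace Odometer

/-- `c` chooses for each `g` in `S` some `f` with `C g f`. -/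
def Choice (S : ℕ → Prop) (C : ℕ → ℕ → Prop) (c : ℕ → ℕ) : Prop :=
  (∀ g, S g → C g (c g)) ∧ ∀ g, ¬ S g → c g = 0

/-- The choice at `g` is not the last one. -/
def Up (S : ℕ → Prop) (C : ℕ → ℕ → Prop) (c : ℕ → ℕ) (g : ℕ) : Prop := S g ∧ ∃ f, c g < f ∧ C g f

/-- The colexicographic order. -/
def Less (c d : ℕ → ℕ) : Prop := ∃ g, c g < d g ∧ ∀ h > g, c h = d h

/-- `d` is the choice function after `c`: the first choice that is not the last one is
advanced, and all previous ones are reset. -/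
structure IsNext (S : ℕ → Prop) (C : ℕ → ℕ → Prop) (c d : ℕ → ℕ) (g : ℕ) : Prop where
  choice : Choice S C d
  up : Up S C c g
  min : ∀ h < g, ¬ Up S C c h
  above : ∀ h > g, d h = c h
  lt : c g < d g
  next : ∀ f, C g f → c g < f → d g ≤ f
  below : ∀ h < g, S h → ∀ f, C h f → d h ≤ f

theorem Less.irrefl (c : ℕ → ℕ) : ¬ Less c c := fun ⟨_, h, _⟩ => lt_irrefl _ h

theorem Less.trans {c d e : ℕ → ℕ} : Less c d → Less d e → Less c e := by
  rintro ⟨g, h1, h2⟩ ⟨h, h3, h4⟩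
  rcases lt_trichotomy g h with h5 | rfl | h5
  · exact ⟨h, by rwa [h2 h h5], fun k hk => (h2 k (h5.trans hk)).trans (h4 k hk)⟩
  · exact ⟨g, h1.trans h3, fun k hk => (h2 k hk).trans (h4 k hk)⟩
  · exact ⟨g, by rwa [← h4 g h5], fun k hk => (h2 k hk).trans (h4 k (lt_trans h5 hk))⟩

variable {S : ℕ → Prop} {C : ℕ → ℕ → Prop} {N : ℕ}

/-- Choice functions vanish outside `S`, and `S` lies below `N`, so there is a last place where they
differ. -/
theorem exists_last_ne (hS : ∀ g, S g → g < N) {c d : ℕ → ℕ} (hc : Choice S C c)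
    (hd : Choice S C d) (h : c ≠ d) : ∃ g, S g ∧ c g ≠ d g ∧ ∀ h > g, c h = d h := by
  classical
  obtain ⟨g₀, hg₀⟩ := Function.ne_iff.1 h
  have hSne : ∀ g, c g ≠ d g → S g := fun g hg => by
    by_contra h
    exact hg (by rw [hc.2 g h, hd.2 g h])
  have h1 : c (Nat.findGreatest (fun g => c g ≠ d g) N) ≠ d (Nat.findGreatest (fun g => c g ≠ d g) N) :=
    Nat.findGreatest_spec (P := fun g => c g ≠ d g) (hS g₀ (hSne g₀ hg₀)).le hg₀
  refine ⟨_, hSne _ h1, h1, fun k hk => ?_⟩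
  by_contra h2
  exact Nat.findGreatest_is_greatest hk (hS k (hSne k h2)).le h2

theorem eq_or_less_of_first (hS : ∀ g, S g → g < N) {c d : ℕ → ℕ} (hc : Choice S C c)
    (hd : Choice S C d) (hf : ∀ g, S g → ∀ f, C g f → c g ≤ f) : d = c ∨ Less c d := by
  by_cases h : c = d
  · exact Or.inl h.symm
  · obtain ⟨g, h1, h2, h3⟩ := exists_last_ne hS hc hd h
    exact Or.inr ⟨g, lt_of_le_of_ne (hf g h1 _ (hd.1 g h1)) h2, h3⟩

theorem Less.exists_up {c d : ℕ → ℕ} (hc : Choice S C c) (hd : Choice S C d) (h : Less c d) :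
    ∃ g, Up S C c g ∧ c g < d g ∧ ∀ h > g, c h = d h := by
  obtain ⟨g, h1, h2⟩ := h
  have hg : S g := by
    by_contra h
    rw [hc.2 g h, hd.2 g h] at h1
    exact lt_irrefl _ h1
  exact ⟨g, ⟨hg, _, h1, hd.1 g hg⟩, h1, h2⟩

theorem IsNext.less {c d : ℕ → ℕ} {g : ℕ} (h : IsNext S C c d g) : Less c d :=
  ⟨g, h.lt, fun k hk => (h.above k hk).symm⟩

/-- The last place `k` where `e` differs from `c` has a further choice, so `k ≥ g`. For `k > g`, `e`
is greater than `d` at `k`. For `k = g`, the value `d g` is the least one possible there, and all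
values of `d` on `S` before `g` are least. -/
theorem IsNext.eq_or_less (hS : ∀ g, S g → g < N) {c d e : ℕ → ℕ} (hc : Choice S C c) {g : ℕ}
    (h : IsNext S C c d g) (he : Choice S C e) (hce : Less c e) : e = d ∨ Less d e := by
  obtain ⟨k, h1, h2, h3⟩ := hce.exists_up hc he
  rcases lt_trichotomy g k with h4 | rfl | h4
  · exact Or.inr ⟨k, by rwa [h.above k h4], fun j hj => by rw [h.above j (h4.trans hj), h3 j hj]⟩
  · rcases (h.next _ (he.1 g h1.1) h2).lt_or_eq with h5 | h5
    · exact Or.inr ⟨g, h5, fun j hj => by rw [h.above j hj, h3 j hj]⟩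
    · by_cases h6 : d = e
      · exact Or.inl h6.symm
      · obtain ⟨j, h7, h8, h9⟩ := exists_last_ne hS h.choice he h6
        have h10 : j < g := by
          rcases lt_trichotomy j g with h10 | rfl | h10
          · exact h10
          · exact absurd h5 h8
          · exact absurd (by rw [h.above j h10, h3 j h10]) h8
        exact Or.inr ⟨j, lt_of_le_of_ne (h.below j h10 h7 _ (he.1 j h7)) h8, h9⟩
  · exact absurd h1 (h.min k h4)

theorem finite_choice (hS : ∀ g, S g → g < N) (hC : ∀ g f, C g f → f < N) :
    {c | Choice S C c}.Finite := by
  classical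
  refine (Set.finite_range fun (φ : Fin N → Fin N) (g : ℕ) =>
    if h : g < N ∧ S g then (φ ⟨g, h.1⟩ : ℕ) else 0).subset ?_
  intro c hc
  refine ⟨fun g => if h : S g then ⟨c g, hC _ _ (hc.1 g h)⟩ else g, ?_⟩
  funext g
  by_cases hg : S g
  · simp [hg, hS g hg]
  · simp [hg, hc.2 g hg]

open RAM in
/-- If a command outputs the current choice and moves on to the next one, then its iteration
enumerates the choice functions. -/
theorem enumerates (hS : ∀ g, S g → g < N) (hC : ∀ g f, C g f → f < N) {body : Cmd}
    {I : (ℕ → ℕ) → Mem → Prop} {enc : (ℕ → ℕ) → List Bool}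
    (hflag : ∀ c u, Choice S C c → I c u → u 31 0 0 ≠ 0)
    (hout : ∀ c u, Choice S C c → I c u → body.out N (fun _ => 0) u = [enc c])
    (hnext : ∀ c u, Choice S C c → I c u → (∃ g, Up S C c g) →
      ∃ d g, IsNext S C c d g ∧ I d (body.st N (fun _ => 0) u))
    (hlast : ∀ c u, Choice S C c → I c u → (¬ ∃ g, Up S C c g) →
      body.st N (fun _ => 0) u 31 0 0 = 0) {c : ℕ → ℕ} {u : Mem} (hc : Choice S C c) (hI : I c u) :
    ∃ L : List (ℕ → ℕ), L.Nodup ∧ (∀ d, d ∈ L ↔ Choice S C d ∧ (d = c ∨ Less c d)) ∧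
      Enumerates N body u (L.map enc) := by
  have hfin := finite_choice hS hC
  -- The number of choice functions after the current one decreases in each round.
  induction hk : {d | Choice S C d ∧ Less c d}.ncard using Nat.strong_induction_on generalizing c u with
  | _ k ih =>
    by_cases hup : ∃ g, Up S C c g
    · obtain ⟨d, g, h1, h2⟩ := hnext c u hc hI hup
      have hlt : {e | Choice S C e ∧ Less d e}.ncard < k := by
        rw [← hk]
        refine Set.ncard_lt_ncard ⟨fun e he => ⟨he.1, h1.less.trans he.2⟩, fun h => ?_⟩
          (hfin.subset fun e he => he.1)
        exact Less.irrefl d (h ⟨h1.choice, h1.less⟩).2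
      obtain ⟨L, h3, h4, h5⟩ := ih _ hlt h1.choice h2 rfl
      refine ⟨c :: L, List.nodup_cons.2 ⟨fun h => ?_, h3⟩, fun e => ?_, ?_⟩
      · rcases ((h4 c).1 h).2 with h6 | h6
        · exact Less.irrefl c (by simpa [← h6] using h1.less)
        · exact Less.irrefl c (h1.less.trans h6)
      · rw [List.mem_cons, h4]
        constructor
        · rintro (rfl | ⟨h6, rfl | h7⟩)
          · exact ⟨hc, Or.inl rfl⟩
          · exact ⟨h6, Or.inr h1.less⟩
          · exact ⟨h6, Or.inr (h1.less.trans h7)⟩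
        · rintro ⟨h6, rfl | h7⟩
          · exact Or.inl rfl
          · exact Or.inr ⟨h6, h1.eq_or_less hS hc h6 h7⟩
      · have := Enumerates.step u (L.map enc) (hflag c u hc hI) (by simp [hout c u hc hI]) h5
        rwa [hout c u hc hI] at this
    · refine ⟨[c], by simp, fun e => ?_, ?_⟩
      · rw [List.mem_singleton]
        constructor
        · rintro rfl
          exact ⟨hc, Or.inl rfl⟩
        · rintro ⟨h6, h7 | h7⟩
          · exact h7
          · obtain ⟨g, hg, -⟩ := h7.exists_up hc h6
            exact absurd ⟨g, hg⟩ hup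
      · have := Enumerates.step u [] (hflag c u hc hI) (by simp [hout c u hc hI])
          (.finish _ (hlast c u hc hI hup))
        rwa [hout c u hc hI] at this

end Odometer

/-! ## The lifting algorithm -/

namespace RAM.Cmd

variable {N : ℕ} {ρ : ℕ → ℕ} {u : Mem} {t : Tm} {c d : Cmd}

theorem out_ite_pos (h : t.Holds N u ρ) : (Cmd.ite t c d).out N ρ u = c.out N ρ u := if_pos h

theorem out_ite_neg (h : ¬ t.Holds N u ρ) : (Cmd.ite t c d).out N ρ u = d.out N ρ u := if_neg h

theorem st_ite_pos (h : t.Holds N u ρ) : (Cmd.ite t c d).st N ρ u = c.st N ρ u := if_pos h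

theorem st_ite_neg (h : ¬ t.Holds N u ρ) : (Cmd.ite t c d).st N ρ u = d.st N ρ u := if_neg h

end RAM.Cmd

namespace MatchingCutKernel

open RAM RAM.Tm SimpleGraph

/-- The solution contains the pendant edge; the edges of the solution; if there are at least
three; the choices for each edge; the first choice; the current choice. -/
def choices : List (Fin 32 × Tm) :=
  [(24, and (sc 22) (.cell 2 (.lit 0) (sc 20))),
   (27, and (ar 13 (v 0)) (and (not (loop (v 0)))
      (.cell 2 (.lit 0) (.add (.cell 6 (cl (ar 8 (v 0))) (sc 23)) (cl (ar 9 (v 0))))))),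
   (28, lt (.lit 2) (count 2 (ar 27 (v 2)))),
   (29, or (eq (v 0) (v 1)) (and (sc 28) (and (and (ar 14 (v 0)) (ar 14 (v 1)))
      (.cell 10 (v 0) (v 1))))),
   (30, count 2 (all 3 (or (lt (v 2) (v 3)) (not (.cell 29 (v 0) (v 3)))))),
   (11, ar 30 (v 0)),
   (31, .lit 1)]

theorem ssa_choices : ssa choices = true := by decide

def prepare : Cmd := .seq analyse (parList choices)

theorem prepare_out (N : ℕ) (ρ : ℕ → ℕ) (u : Mem) : prepare.out N ρ u = [] := by
  simp [prepare, Cmd.out, analyse_out, parList_out]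

/-- The number of bits of an adjacency matrix. -/
def square : Tm := .cell 6 (sc 4) (sc 4)

def halt : Cmd := .par 31 (.lit 0)

def emitEmpty : Cmd := .seq (.emit 25 square) halt

def emitLost : Cmd := .seq (.rep 5 (.rep 6 (.ite (.cell 21 (v 5) (v 6))
  (.seq (.par 26 (or (same (v 5) (ar 8 (v 1)) (ar 9 (v 1))) (same (v 6) (ar 8 (v 1)) (ar 9 (v 1)))))
    (.emit 26 square)) .nop))) halt

def emitChoice : Cmd :=
  .seq (.par 26 (ex 2 (and (ar 27 (v 2)) (same (ar 11 (v 2)) (ar 8 (v 1)) (ar 9 (v 1))))))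
    (.emit 26 square)

/-- Which edges of the solution have a further choice. -/
def up : Tm := and (ar 27 (v 0)) (ex 2 (and (lt (ar 11 (v 0)) (v 2)) (.cell 29 (v 0) (v 2))))

def nextChoice : Tm := .ite (ex 2 (and (lt (v 2) (v 0)) (ar 12 (v 2)))) (ar 11 (v 0))
  (.ite (ar 12 (v 0)) (count 2 (all 3 (or (lt (v 2) (v 3)) (or (not (lt (ar 11 (v 0)) (v 3)))
    (not (.cell 29 (v 0) (v 3))))))) (ar 30 (v 0)))

def advance : Cmd := .seq (.par 12 up) (.seq (.par 11 nextChoice) (.par 31 (ex 2 (ar 12 (v 2)))))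

def round : Cmd :=
  .ite (sc 10) emitEmpty (.ite (sc 24) emitLost (.seq emitChoice advance))

section

variable {n N : ℕ} {G : SimpleGraph (Fin n)}

theorem encodeEdges_inj {M M' : Set (Sym2 (Fin n))} (h : M ⊆ G.edgeSet) (h' : M' ⊆ G.edgeSet)
    (he : encodeEdges M = encodeEdges M') : M = M' := by
  have h1 : fromEdgeSet M = fromEdgeSet M' := eq_of_heq (encode_inj he).2
  have h2 : ∀ M ⊆ G.edgeSet, (fromEdgeSet M).edgeSet = M := by
    intro M hM
    rw [edgeSet_fromEdgeSet]
    ext e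
    exact ⟨fun he => he.1, fun he => ⟨he, G.not_isDiag_of_mem_edgeSet (hM he)⟩⟩
  rw [← h2 M h, h1, h2 M' h']

theorem subset_of_isMinimal {M : Set (Sym2 (Fin n))} (h : G.IsMinimalMatchingCut M) :
    M ⊆ G.edgeSet := by
  obtain ⟨⟨⟨A, -, -, rfl⟩, -⟩, -⟩ := h
  exact cutEdges_subset A

theorem sol_encode : enumMinimalMC.Sol G.encode = encodeEdges '' {M | G.IsMinimalMatchingCut M} := by
  ext s
  constructor
  · rintro ⟨m, H, M, h1, h2, rfl⟩
    obtain ⟨rfl, h⟩ := encode_inj h1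
    obtain rfl := eq_of_heq h
    exact ⟨M, h2, rfl⟩
  · rintro ⟨M, h, rfl⟩
    exact ⟨n, G, M, rfl, h, rfl⟩

theorem getD_encodeEdges {M : Set (Sym2 (Fin n))} {p q : ℕ} (hp : p < n) (hq : q < n) :
    (encodeEdges M).getD (p * n + q) false = true ↔ s(⟨p, hp⟩, ⟨q, hq⟩) ∈ M ∧ p ≠ q := by
  rw [encodeEdges, getD_encode hp hq, fromEdgeSet_adj, Ne, Fin.mk.injEq]

variable [NeZero n]

/-- The output of an array that contains the adjacency matrix of the edges with numbers in `E`. -/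
theorem HasEdges.emit {u : Mem} (h : HasEdges G N u) (h6 : ∀ i < N, ∀ j < N, u 6 i j = i * j)
    {a : Fin 32} {E : ℕ → Prop} (hE : ∀ e, E e → G.IsE e)
    (ha : ∀ t < n * n, (u a 0 t ≠ 0 ↔ ∃ e, E e ∧ SameEnds n e (t / n) (t % n))) (ρ : ℕ → ℕ) :
    (Cmd.emit a square).out N ρ u = [encodeEdges (ed n '' {e | E e})] := by
  have hlt := h.lt_bound
  have hsq := h.sq_le
  simp only [Cmd.out, square, val, h.size, h6 n hlt n hlt, min_eq_left hsq]
  congr 1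
  refine map_range_eq_encode _ _ fun p q => ?_
  have hp := p.2
  have hq := q.2
  have h0 := NeZero.pos n
  have h1 : ((p : ℕ) * n + q) / n = p := by
    rw [mul_comm, Nat.mul_add_div h0, Nat.div_eq_of_lt hq, add_zero]
  have h2 : ((p : ℕ) * n + q) % n = q := by
    rw [mul_comm, Nat.mul_add_mod, Nat.mod_eq_of_lt hq]
  rw [ha _ (by nlinarith), h1, h2, fromEdgeSet_adj]
  constructor
  · rintro ⟨e, h3, h4⟩
    rw [sameEnds_iff (hE e h3).lt hp hq] at h4
    refine ⟨⟨e, h3, h4.symm⟩, ?_⟩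
    have := (hE e h3).1
    rw [← h4] at this
    exact G.ne_of_adj this
  · rintro ⟨⟨e, h3, h4⟩, -⟩
    exact ⟨e, h3, (sameEnds_iff (hE e h3).lt hp hq).2 h4.symm⟩

theorem HasEdges.holds_same {u : Mem} (h : HasEdges G N u) {ρ : ℕ → ℕ} {s t t' : Tm}
    (hs : s.val N u ρ < N) : (same s t t').Holds N u ρ ↔
      SameEnds n (s.val N u ρ) (t.val N u ρ) (t'.val N u ρ) := by
  simp only [same, holds_or, holds_and, holds_eq, val, h.hd _ hs, h.tl _ hs]
  rfl

theorem HasEdges.congr {u w : Mem} (h : HasEdges G N u) (hw : ∀ a ∈ [(4 : Fin 32), 13, 8, 9, 10],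
    w a = u a) : HasEdges G N w := by
  obtain ⟨h1, h2, h3, h4, h5, h6⟩ := h
  refine ⟨h1, ?_, ?_, ?_, ?_, ?_⟩
  · rwa [hw 4 (by decide)]
  · rwa [hw 13 (by decide)]
  · rwa [hw 8 (by decide)]
  · rwa [hw 9 (by decide)]
  · rwa [hw 10 (by decide)]

theorem halt_flag {u : Mem} {ρ : ℕ → ℕ} (hN : 0 < N) : halt.st N ρ u 31 0 0 = 0 := by
  simp [halt, Cmd.st, hN, val]

/-- The output for a graph that is not connected. -/
theorem enumerates_empty {u : Mem} (h : HasEdges G N u) (h6 : ∀ i < N, ∀ j < N, u 6 i j = i * j)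
    (h25 : u 25 = fun _ _ => 0) (h31 : u 31 0 0 ≠ 0) (h10 : u 10 0 0 ≠ 0) :
    Enumerates N round u [encodeEdges (∅ : Set (Sym2 (Fin n)))] := by
  have h1 : round.out N (fun _ => 0) u = [encodeEdges (∅ : Set (Sym2 (Fin n)))] := by
    have h2 := h.emit h6 (a := 25) (E := fun _ => False) (by simp) (by simp [h25]) (fun _ => 0)
    have h3 : ed n '' {e | False} = ∅ := by simp
    rw [h3] at h2
    rw [round, Cmd.out_ite_pos (t := sc 10) h10, emitEmpty, Cmd.out, h2]
    simp [halt, Cmd.out]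
  have h3 : round.st N (fun _ => 0) u 31 0 0 = 0 := by
    rw [round, Cmd.st_ite_pos (t := sc 10) h10]
    exact halt_flag (by have := h.lt_bound; omega)
  have := Enumerates.step u [] h31 (by rw [h1]; simp) (.finish _ h3)
  rwa [h1, List.append_nil] at this

/-- The output of all lost solutions. -/
theorem enumerates_lost {m : ℕ} {π : Fin n → Fin m} {u : Mem} (h : HasKernel G N π u)
    (h6 : ∀ i < N, ∀ j < N, u 6 i j = i * j) (h31 : u 31 0 0 ≠ 0) (h10 : u 10 0 0 = 0)
    (h24 : u 24 0 0 ≠ 0) (hl : ∃ M, G.LostSol π M) : ∃ l : List (List Bool), l.Nodup ∧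
      {s | s ∈ l} = encodeEdges '' {M | G.LostSol π M} ∧ Enumerates N round u l := by
  classical
  have hlt := h.lt_bound
  set row : Cmd := .par 26 (or (same (v 5) (ar 8 (v 1)) (ar 9 (v 1)))
    (same (v 6) (ar 8 (v 1)) (ar 9 (v 1)))) with hrow
  set inner : Cmd := .ite (.cell 21 (v 5) (v 6)) (.seq row (.emit 26 square)) .nop with hinner
  have hframe : ∀ (c : Cmd) (x : ℕ) (ρ : ℕ → ℕ → ℕ → ℕ) (k : ℕ) (w : Mem), c.writes = [26] →
      ∀ b, b ≠ 26 → (Nat.rec w (fun i w => c.st N (ρ x i) w) k : Mem) b = w b := by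
    intro c x ρ k w hc b hb
    induction k with
    | zero => rfl
    | succ k ih =>
      change c.st N _ _ b = _
      rw [Cmd.st_of_notMem c (by rw [hc]; simpa using hb), ih]
  have hin : ∀ (ρ : ℕ → ℕ) (w : Mem), (∀ b, b ≠ 26 → w b = u b) → ρ 5 < N → ρ 6 < N →
      inner.out N ρ w =
        if u 21 (ρ 5) (ρ 6) ≠ 0 then [encodeEdges {ed n (ρ 5), ed n (ρ 6)}] else [] := by
    intro ρ w hw h5 h6'
    have hw21 : (Tm.cell 21 (v 5) (v 6)).val N w ρ = u 21 (ρ 5) (ρ 6) := by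
      simp only [val, hw 21 (by decide)]
    rw [hinner, Cmd.out, hw21]
    by_cases hL : u 21 (ρ 5) (ρ 6) ≠ 0
    · rw [if_pos hL, if_pos hL]
      obtain ⟨hE, hF, -, -⟩ := (h.lost _ h5 _ h6').1 hL
      have hw' : ∀ b, b ≠ 26 → row.st N ρ w b = u b := fun b hb => by
        rw [hrow, Cmd.st_par_of_ne hb, hw b hb]
      have hE' : HasEdges G N (row.st N ρ w) := h.toHasEdges.congr fun a ha => hw' a (by
        rintro rfl; revert ha; decide)
      have hEw : HasEdges G N w := h.toHasEdges.congr fun a ha => hw a (by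
        rintro rfl; revert ha; decide)
      have h1 := hE'.emit (a := 26) (E := fun e => e = ρ 5 ∨ e = ρ 6)
        (by rw [hw' 6 (by decide)]; exact h6) (by rintro e (rfl | rfl) <;> assumption) ?_ ρ
      · rw [Cmd.out, h1]
        have : ed n '' {e | e = ρ 5 ∨ e = ρ 6} = {ed n (ρ 5), ed n (ρ 6)} := by
          change ed n '' {ρ 5, ρ 6} = _
          rw [Set.image_pair]
        rw [this]
        rfl
      · intro t ht
        have htN : t < N := by have := h.sq_le; omega
        have h2 : row.st N ρ w 26 0 t = (or (same (v 5) (ar 8 (v 1)) (ar 9 (v 1)))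
            (same (v 6) (ar 8 (v 1)) (ar 9 (v 1)))).val N w
              (Function.update (Function.update ρ 0 0) 1 t) := by
          simp only [hrow, Cmd.st, htN, true_and, (show 0 < N by omega), if_true]
        rw [h2]
        change Holds _ _ _ _ ↔ _
        rw [holds_or, hEw.holds_same (by simpa [val] using h5), hEw.holds_same (by simpa [val] using h6')]
        simp only [val, Function.update_apply]
        simp only [if_false, if_true, OfNat.ofNat_ne_zero,
          OfNat.ofNat_ne_one, one_ne_zero]
        rw [hEw.hd t htN, hEw.tl t htN]
        simp only [or_and_right, exists_or, exists_eq_left]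
    · rw [if_neg hL, if_neg hL]
      rfl
  have hmid : ∀ (ρ : ℕ → ℕ) (w : Mem), (∀ b, b ≠ 26 → w b = u b) → ρ 5 < N →
      (Cmd.rep 6 inner).out N ρ w = (List.range N).flatMap fun f =>
        if u 21 (ρ 5) f ≠ 0 then [encodeEdges {ed n (ρ 5), ed n f}] else [] := by
    intro ρ w hw h5
    rw [Cmd.out]
    refine List.flatMap_congr fun f hf => ?_
    have hf := List.mem_range.1 hf
    rw [hin _ _ ?_ (by simpa using h5) (by simpa using hf)]
    · simp
    · intro b hb
      rw [hframe inner 0 (fun _ i => Function.update ρ 6 i) f w (by rfl) b hb, hw b hb]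
  set l := (List.range N).flatMap fun e => (List.range N).flatMap fun f =>
    if u 21 e f ≠ 0 then [encodeEdges {ed n e, ed n f}] else [] with hldef
  have hout : round.out N (fun _ => 0) u = l := by
    rw [round, Cmd.out_ite_neg (t := sc 10) (not_not.2 h10), Cmd.out_ite_pos (t := sc 24) h24, emitLost, Cmd.out, Cmd.out]
    have : ∀ w : Mem, halt.out N (fun _ => 0) w = [] := fun _ => rfl
    rw [this, List.append_nil]
    refine List.flatMap_congr fun e he => ?_
    have he := List.mem_range.1 he
    have h2 := hmid (Function.update (fun _ => 0) 5 e) (Nat.rec u (fun i w =>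
      (Cmd.rep 6 inner).st N (Function.update (fun _ => 0) 5 i) w) e) ?_ (by simpa using he)
    · rw [Function.update_self] at h2
      exact h2
    · intro b hb
      exact hframe (.rep 6 inner) 0 (fun _ i => Function.update (fun _ => 0) 5 i) e u (by rfl) b hb
  have hmem : ∀ s, s ∈ l ↔ ∃ e < N, ∃ f < N, u 21 e f ≠ 0 ∧ s = encodeEdges {ed n e, ed n f} := by
    intro s
    simp only [hldef, List.mem_flatMap, List.mem_range]
    refine exists_congr fun e => and_congr_right fun _ => exists_congr fun f =>
      and_congr_right fun _ => ?_
    split_ifs with hL <;> simp [hL]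
  -- Pairs are recorded with `e ≤ f` only, so each lost solution is output once.
  have hpair : ∀ e < N, ∀ f < N, ∀ e' < N, ∀ f' < N, u 21 e f ≠ 0 → u 21 e' f' ≠ 0 →
      encodeEdges {ed n e, ed n f} = encodeEdges {ed n e', ed n f'} → e = e' ∧ f = f' := by
    intro e he f hf e' he' f' hf' h1 h2 h3
    obtain ⟨hE, hF, hle, hL⟩ := (h.lost e he f hf).1 h1
    obtain ⟨hE', hF', hle', hL'⟩ := (h.lost e' he' f' hf').1 h2
    have h4 := encodeEdges_inj hL.1.1.subset hL'.1.1.subset h3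
    rw [Set.pair_eq_pair_iff, hE.eq hE', hF.eq hF', hE.eq hF', hF.eq hE'] at h4
    omega
  refine ⟨l, ?_, ?_, ?_⟩
  · rw [hldef, List.nodup_flatMap]
    refine ⟨fun e he => ?_, ?_⟩
    · rw [List.nodup_flatMap]
      refine ⟨fun f hf => by split_ifs <;> simp, ?_⟩
      refine List.Pairwise.imp_of_mem ?_ List.nodup_range
      intro f f' hf hf' hff s hs hs'
      simp only [List.mem_ite_nil_right, List.mem_singleton] at hs hs'
      exact hff (hpair e (List.mem_range.1 he) f (List.mem_range.1 hf) e (List.mem_range.1 he) f'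
        (List.mem_range.1 hf') hs.1 hs'.1 (hs.2.symm.trans hs'.2)).2
    · refine List.Pairwise.imp_of_mem ?_ List.nodup_range
      intro e e' he he' hee s hs hs'
      simp only [List.mem_flatMap, List.mem_range, List.mem_ite_nil_right, List.mem_singleton] at hs hs' he he'
      obtain ⟨f, hf, hs⟩ := hs
      obtain ⟨f', hf', hs'⟩ := hs'
      exact hee (hpair e he f hf e' he' f' hf' hs.1 hs'.1 (hs.2.symm.trans hs'.2)).1
  · ext s
    rw [Set.mem_ofPred_eq, hmem]
    constructor
    · rintro ⟨e, he, f, hf, h1, rfl⟩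
      exact ⟨_, ((h.lost e he f hf).1 h1).2.2.2, rfl⟩
    · rintro ⟨M, hM, rfl⟩
      obtain ⟨e, he, f, hf, h1, h2, h3, h4⟩ : ∃ e < N, ∃ f < N, G.IsE e ∧ G.IsE f ∧ e ≤ f ∧
          M = {ed n e, ed n f} := by
        rcases hM.cases with ⟨a, rfl⟩ | ⟨a, b, hab, rfl⟩
        · have ha := isE_ix (hM.1.1.subset rfl)
          refine ⟨ix n a, h.lt ha, ix n a, h.lt ha, ha, ha, le_rfl, ?_⟩
          rw [ed_ix, Set.pair_eq_singleton]
        · have ha := isE_ix (G := G) (e := a) (hM.1.1.subset (by simp))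
          have hb := isE_ix (G := G) (e := b) (hM.1.1.subset (by simp))
          rcases le_total (ix n a) (ix n b) with hle | hle
          · exact ⟨ix n a, h.lt ha, ix n b, h.lt hb, ha, hb, hle, by rw [ed_ix, ed_ix]⟩
          · exact ⟨ix n b, h.lt hb, ix n a, h.lt ha, hb, ha, hle, by rw [ed_ix, ed_ix, Set.pair_comm]⟩
      exact ⟨e, he, f, hf, (h.lost e he f hf).2 ⟨h1, h2, h3, h4 ▸ hM⟩, by rw [h4]⟩
  · have h3 : round.st N (fun _ => 0) u 31 0 0 = 0 := by
      rw [round, Cmd.st_ite_neg (t := sc 10) (not_not.2 h10), Cmd.st_ite_pos (t := sc 24) h24]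
      exact halt_flag (by omega)
    have := Enumerates.step u [] h31 ?_ (.finish _ h3)
    · rwa [hout, List.append_nil] at this
    · rw [hout]
      obtain ⟨e, he, f, hf, h1, h2, h4, h5⟩ := h.exists_lostSol.1 hl
      intro hnil
      have := (hmem (encodeEdges {ed n e, ed n f})).2
        ⟨e, he, f, hf, (h.lost e he f hf).2 ⟨h1, h2, h4, h5⟩, rfl⟩
      rw [hnil] at this
      simp at this

end

end MatchingCutKernel

/-! ### One round of the enumeration of choices -/

namespace MatchingCutKernel

open RAM RAM.Tm SimpleGraph Odometer

/-- The numbers `i` that are counted are those below every element of `P`, and their number is the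
least element. This is how the programs compute minima. -/
theorem card_filter_least {N : ℕ} {P : ℕ → Prop} [DecidablePred fun i => ∀ j < N, i < j ∨ ¬ P j]
    (hP : ∀ j, P j → j < N) (h : ∃ j, P j) :
    P ((Finset.range N).filter fun i => ∀ j < N, i < j ∨ ¬ P j).card ∧
      ∀ j, P j → ((Finset.range N).filter fun i => ∀ j < N, i < j ∨ ¬ P j).card ≤ j := by
  classical
  have h1 : (Finset.range N).filter (fun i => ∀ j < N, i < j ∨ ¬ P j) = Finset.range (Nat.find h) := by
    ext i
    simp only [Finset.mem_filter, Finset.mem_range, Nat.lt_find_iff]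
    constructor
    · rintro ⟨-, h2⟩ j hj hPj
      rcases h2 j (hP j hPj) with h3 | h3
      · omega
      · exact h3 hPj
    · intro h2
      refine ⟨?_, fun j _ => ?_⟩
      · by_contra h3
        exact h2 _ (by have := hP _ (Nat.find_spec h); omega) (Nat.find_spec h)
      · by_cases hij : i < j
        · exact Or.inl hij
        · exact Or.inr (h2 j (by omega))
  rw [h1, Finset.card_range]
  exact ⟨Nat.find_spec h, fun j hj => Nat.find_min' h hj⟩

variable {n N : ℕ} {G : SimpleGraph (Fin n)} [NeZero n]

/-- The memory describes the choices `C` for the edges in `S`. -/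
structure HasChoices (G : SimpleGraph (Fin n)) (N : ℕ) (S : ℕ → Prop) (C : ℕ → ℕ → Prop) (w : Mem) :
    Prop where
  edges : HasEdges G N w
  mul : ∀ i < N, ∀ j < N, w 6 i j = i * j
  conn : w 10 0 0 = 0
  notPend : w 24 0 0 = 0
  mem : ∀ g < N, (w 27 g 0 ≠ 0 ↔ S g)
  choice : ∀ g f, S g → f < N → (w 29 g f ≠ 0 ↔ C g f)
  first : ∀ g, S g → C g (w 30 g 0) ∧ ∀ f, C g f → w 30 g 0 ≤ f

variable {S : ℕ → Prop} {C : ℕ → ℕ → Prop}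

theorem HasChoices.congr {u w : Mem} (h : HasChoices G N S C u)
    (hw : ∀ a ∉ [(11 : Fin 32), 12, 26, 31], w a = u a) : HasChoices G N S C w := by
  obtain ⟨h1, h2, h3, h4, h5, h6, h7⟩ := h
  refine ⟨h1.congr fun a ha => hw a (by revert a; decide), ?_, ?_, ?_, ?_, ?_, ?_⟩
  · rwa [hw 6 (by decide)]
  · rwa [hw 10 (by decide)]
  · rwa [hw 24 (by decide)]
  · rwa [hw 27 (by decide)]
  · rwa [hw 29 (by decide)]
  · rwa [hw 30 (by decide)]

/-- The output for a choice function. -/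
noncomputable def encChoice (n : ℕ) [NeZero n] (S : ℕ → Prop) (c : ℕ → ℕ) : List Bool :=
  encodeEdges (ed n '' {e | ∃ g, S g ∧ c g = e})

section

variable (hS : ∀ g, S g → g < N) (hC : ∀ g f, C g f → G.IsE f)
include hS hC

theorem HasChoices.out {u : Mem} (h : HasChoices G N S C u) {c : ℕ → ℕ} (hc : Choice S C c)
    (hI : ∀ g, S g → u 11 g 0 = c g) : round.out N (fun _ => 0) u = [encChoice n S c] := by
  rw [round, Cmd.out_ite_neg (t := sc 10) (not_not.2 h.conn),
    Cmd.out_ite_neg (t := sc 24) (not_not.2 h.notPend), Cmd.out, emitChoice, Cmd.out]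
  have hE : ∀ e, (∃ g, S g ∧ c g = e) → G.IsE e := by
    rintro _ ⟨g, hg, rfl⟩
    exact hC g _ (hc.1 g hg)
  set row : Cmd := .par 26 (ex 2 (and (ar 27 (v 2)) (same (ar 11 (v 2)) (ar 8 (v 1)) (ar 9 (v 1)))))
    with hrow
  have hfr := h.congr (w := row.st N (fun _ => 0) u) fun a ha => Cmd.st_par_of_ne (by
    rintro rfl; revert ha; decide) _
  have h1 := hfr.edges.emit hfr.mul (a := 26) hE ?_ (fun _ => 0)
  · rw [h1]
    rfl
  · intro t ht
    have htN : t < N := by have := h.edges.sq_le; omega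
    have h2 : row.st N (fun _ => 0) u 26 0 t = (ex 2 (and (ar 27 (v 2)) (same (ar 11 (v 2))
        (ar 8 (v 1)) (ar 9 (v 1))))).val N u (Function.update (Function.update (fun _ => 0) 0 0) 1 t) := by
      simp only [hrow, Cmd.st, htN, true_and, (show 0 < N by omega), if_true]
    rw [h2]
    change Holds _ _ _ _ ↔ _
    simp only [holds_ex, holds_and, holds_cell, val, Function.update_self]
    constructor
    · rintro ⟨g, hg, h3, h4⟩
      rw [h.mem g hg] at h3
      have h5 := h.edges.lt (hE _ ⟨g, h3, rfl⟩)
      rw [h.edges.holds_same (by simpa [val, hI g h3] using h5)] at h4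
      refine ⟨c g, ⟨g, h3, rfl⟩, ?_⟩
      simpa [val, hI g h3, h.edges.hd t htN, h.edges.tl t htN] using h4
    · rintro ⟨_, ⟨g, h3, rfl⟩, h4⟩
      have h5 := h.edges.lt (hE _ ⟨g, h3, rfl⟩)
      refine ⟨g, hS g h3, (h.mem g (hS g h3)).2 h3, ?_⟩
      rw [h.edges.holds_same (by simpa [val, hI g h3] using h5)]
      simpa [val, hI g h3, h.edges.hd t htN, h.edges.tl t htN] using h4

-- Array 12 marks the places with a further choice. A place with a marked place before it keeps its
-- value, the first marked place moves on to the least greater choice, and the places before that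
-- one are reset to their first choice.
open Classical in
theorem HasChoices.step {u : Mem} (h : HasChoices G N S C u) {c : ℕ → ℕ} (hc : Choice S C c)
    (hI : ∀ g, S g → u 11 g 0 = c g) :
    HasChoices G N S C (round.st N (fun _ => 0) u) ∧
      (round.st N (fun _ => 0) u 31 0 0 ≠ 0 ↔ ∃ g, Up S C c g) ∧
      ∀ g, Up S C c g → (∀ h < g, ¬ Up S C c h) →
        IsNext S C c (fun k => if S k then round.st N (fun _ => 0) u 11 k 0 else 0) g := by
  have hN : 0 < N := by have := h.edges.lt_bound; omega
  have hround : round.st N (fun _ => 0) u = advance.st N (fun _ => 0) (emitChoice.st N (fun _ => 0) u) := by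
    rw [round, Cmd.st_ite_neg (t := sc 10) (not_not.2 h.conn),
      Cmd.st_ite_neg (t := sc 24) (not_not.2 h.notPend), Cmd.st]
  set u₁ := emitChoice.st N (fun _ => 0) u with hu₁
  set u₂ := (Cmd.par 12 up).st N (fun _ => 0) u₁ with hu₂
  set u₃ := (Cmd.par 11 nextChoice).st N (fun _ => 0) u₂ with hu₃
  set u₄ := (Cmd.par 31 (ex 2 (ar 12 (v 2)))).st N (fun _ => 0) u₃ with hu₄
  have hround : round.st N (fun _ => 0) u = u₄ := hround
  have hf₁ : ∀ a : Fin 32, a ≠ 26 → u₁ a = u a := fun a ha => Cmd.st_of_notMem emitChoice (by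
    simpa [emitChoice, Cmd.writes] using ha)
  have hf₂ : ∀ a : Fin 32, a ≠ 12 → u₂ a = u₁ a := fun a ha => Cmd.st_par_of_ne ha _
  have hf₃ : ∀ a : Fin 32, a ≠ 11 → u₃ a = u₂ a := fun a ha => Cmd.st_par_of_ne ha _
  have hf₄ : ∀ a : Fin 32, a ≠ 31 → u₄ a = u₃ a := fun a ha => Cmd.st_par_of_ne ha _
  rw [hround]
  have h₁ : HasChoices G N S C u₁ := h.congr fun a ha => hf₁ a (by rintro rfl; revert ha; decide)
  have h₂ : HasChoices G N S C u₂ := h₁.congr fun a ha => hf₂ a (by rintro rfl; revert ha; decide)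
  have h₃ : HasChoices G N S C u₃ := h₂.congr fun a ha => hf₃ a (by rintro rfl; revert ha; decide)
  have h₄ : HasChoices G N S C u₄ := h₃.congr fun a ha => hf₄ a (by rintro rfl; revert ha; decide)
  have hI₁ : ∀ g, S g → u₁ 11 g 0 = c g := by rwa [hf₁ 11 (by decide)]
  have hI₂ : ∀ g, S g → u₂ 11 g 0 = c g := by rwa [hf₂ 11 (by decide)]
  have hCN : ∀ g f, C g f → f < N := fun g f hgf => h.edges.lt (hC g f hgf)
  have hup : ∀ g < N, (u₂ 12 g 0 ≠ 0 ↔ Up S C c g) := by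
    intro g hg
    have h2 : u₂ 12 g 0 = up.val N u₁ (Function.update (Function.update (fun _ => 0) 0 g) 1 0) := by
      simp only [hu₂, Cmd.st, hg, hN, true_and, if_true]
    rw [h2]
    change Holds _ _ _ _ ↔ _
    simp only [up, holds_ex, holds_and, holds_cell, holds_lt, val, Function.update_apply]
    simp only [zero_ne_one, if_false, if_true, OfNat.ofNat_ne_zero,
      OfNat.zero_ne_ofNat, OfNat.ofNat_ne_one]
    rw [h₁.mem g hg, Up]
    refine and_congr_right fun hSg => ?_
    rw [hI₁ g hSg]
    constructor
    · rintro ⟨f, hf, h3, h4⟩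
      exact ⟨f, h3, (h₁.choice g f hSg hf).1 h4⟩
    · rintro ⟨f, h3, h4⟩
      exact ⟨f, hCN g f h4, h3, (h₁.choice g f hSg (hCN g f h4)).2 h4⟩
  refine ⟨h₄, ?_, fun g hg hmin => ?_⟩
  · have h2 : u₄ 31 0 0 = (ex 2 (ar 12 (v 2))).val N u₃
        (Function.update (Function.update (fun _ => 0) 0 0) 1 0) := by
      simp only [hu₄, Cmd.st, hN, true_and, if_true]
    rw [h2]
    change Holds _ _ _ _ ↔ _
    simp only [holds_ex, holds_cell, val, Function.update_self]
    rw [hf₃ 12 (by decide)]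
    constructor
    · rintro ⟨g, hg, h3⟩
      exact ⟨g, (hup g hg).1 h3⟩
    · rintro ⟨g, h3⟩
      exact ⟨g, hS g h3.1, (hup g (hS g h3.1)).2 h3⟩
  · rw [hf₄ 11 (by decide)]
    have hval : ∀ k, S k → u₃ 11 k 0 = if ∃ z < N, z < k ∧ Up S C c z then c k else
        if Up S C c k then
          ((Finset.range N).filter fun i => ∀ j < N, i < j ∨ ¬ (c k < j ∧ C k j)).card
        else u 30 k 0 := by
      intro k hk
      have hkN := hS k hk
      have h2 : u₃ 11 k 0 = nextChoice.val N u₂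
          (Function.update (Function.update (fun _ => 0) 0 k) 1 0) := by
        simp only [hu₃, Cmd.st, hkN, hN, true_and, if_true]
      rw [h2, nextChoice, val_ite, val_ite]
      refine if_congr ?_ ?_ (if_congr ?_ ?_ ?_)
      · simp only [holds_ex, holds_and, holds_lt, holds_cell, val, Function.update_apply]
        simp only [zero_ne_one, if_false, if_true, OfNat.ofNat_ne_zero,
          OfNat.zero_ne_ofNat, OfNat.ofNat_ne_one]
        refine exists_congr fun z => and_congr_right fun hz => and_congr_right fun _ => ?_
        exact hup z hz
      · simp only [val, Function.update_apply]
        simp only [zero_ne_one, if_false, if_true]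
        exact hI₂ k hk
      · simp only [holds_cell, val, Function.update_apply]
        simp only [zero_ne_one, if_false, if_true]
        exact hup k hkN
      · simp only [val_count, holds_all, holds_or, holds_not, holds_lt, holds_cell, val,
          Function.update_apply]
        simp only [zero_ne_one, if_false, if_true, Nat.reduceEqDiff, OfNat.ofNat_ne_zero,
          OfNat.zero_ne_ofNat, OfNat.ofNat_ne_one]
        congr 1
        ext i
        simp only [Finset.mem_filter]
        refine and_congr_right fun _ => forall_congr' fun j => imp_congr_right fun hj => ?_
        rw [hI₂ k hk, h₂.choice k j hk hj, not_and_or]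
      · simp only [val, Function.update_apply]
        simp only [zero_ne_one, if_false, if_true]
        rw [hf₂ 30 (by decide), hf₁ 30 (by decide)]
    have hlow : ∀ k, k ≤ g → ¬ ∃ z < N, z < k ∧ Up S C c z := by
      rintro k hk ⟨z, -, h3, h4⟩
      exact hmin z (by omega) h4
    have hleast := card_filter_least (N := N) (P := fun j => c g < j ∧ C g j)
      (fun j hj => hCN g j hj.2) hg.2
    have hgval : u₃ 11 g 0 =
        ((Finset.range N).filter fun i => ∀ j < N, i < j ∨ ¬ (c g < j ∧ C g j)).card := by
      rw [hval g hg.1, if_neg (hlow g le_rfl), if_pos hg]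
    have habove : ∀ k, S k → g < k → u₃ 11 k 0 = c k := by
      intro k hk hgk
      rw [hval k hk, if_pos ⟨g, hS g hg.1, hgk, hg⟩]
    have hbelow : ∀ k, S k → k < g → u₃ 11 k 0 = u 30 k 0 := by
      intro k hk hgk
      rw [hval k hk, if_neg (hlow k hgk.le), if_neg (hmin k hgk)]
    refine ⟨⟨fun k hk => ?_, fun k hk => if_neg hk⟩, hg, hmin, fun k hk => ?_, ?_, fun f h3 h4 => ?_,
      fun k hk hSk f hf => ?_⟩
    · beta_reduce
      rw [if_pos hk]
      rcases lt_trichotomy g k with h3 | rfl | h3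
      · rw [habove k hk h3]
        exact hc.1 k hk
      · rw [hgval]
        exact hleast.1.2
      · rw [hbelow k hk h3]
        exact (h.first k hk).1
    · by_cases hSk : S k
      · rw [if_pos hSk, habove k hSk hk]
      · rw [if_neg hSk, hc.2 k hSk]
    · rw [if_pos hg.1, hgval]
      exact hleast.1.1
    · rw [if_pos hg.1, hgval]
      exact hleast.2 f ⟨h4, h3⟩
    · rw [if_pos hSk, hbelow k hSk hk]
      exact (h.first k hSk).2 f hf

theorem HasChoices.enumerates {u : Mem} (h : HasChoices G N S C u) (h31 : u 31 0 0 ≠ 0)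
    (h11 : ∀ g, S g → u 11 g 0 = u 30 g 0) : ∃ L : List (ℕ → ℕ), L.Nodup ∧
      (∀ d, d ∈ L ↔ Choice S C d) ∧ Enumerates N round u (L.map (encChoice n S)) := by
  classical
  have hCN : ∀ g f, C g f → f < N := fun g f hgf => h.edges.lt (hC g f hgf)
  set c : ℕ → ℕ := fun g => if S g then u 30 g 0 else 0
  have hcg : ∀ g, S g → c g = u 30 g 0 := fun g hg => if_pos hg
  have hc : Choice S C c := by
    refine ⟨fun g hg => ?_, fun g hg => if_neg hg⟩
    rw [hcg g hg]
    exact (h.first g hg).1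
  obtain ⟨L, h1, h2, h3⟩ := Odometer.enumerates hS hCN (body := round) (enc := encChoice n S)
    (I := fun c u => HasChoices G N S C u ∧ u 31 0 0 ≠ 0 ∧ ∀ g, S g → u 11 g 0 = c g)
    (fun c u _ hI => hI.2.1) (fun c u hc hI => hI.1.out hS hC hc hI.2.2)
    (fun c u hc hI hup => by
      obtain ⟨h4, h5, h6⟩ := hI.1.step hS hC hc hI.2.2
      exact ⟨_, Nat.find hup, h6 _ (Nat.find_spec hup) fun k hk => Nat.find_min hup hk, h4, h5.2 hup,
        fun g hg => (if_pos hg).symm⟩)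
    (fun c u hc hI hup => by
      obtain ⟨-, h5, -⟩ := hI.1.step hS hC hc hI.2.2
      by_contra h6
      exact hup (h5.1 h6))
    hc ⟨h, h31, fun g hg => by rw [h11 g hg, hcg g hg]⟩
  refine ⟨L, h1, fun d => ?_, h3⟩
  rw [h2]
  refine ⟨fun h => h.1, fun hd => ⟨hd, eq_or_less_of_first hS hc hd fun g hg f hf => ?_⟩⟩
  rw [hcg g hg]
  exact (h.first g hg).2 f hf

end

end MatchingCutKernel

/-! ### The choices belonging to a solution of the kernel -/

namespace MatchingCutKernel

open RAM RAM.Tm SimpleGraph Odometer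

variable {n N : ℕ} {G : SimpleGraph (Fin n)} [NeZero n]

/-- The edges of `M₀`. -/
def InSol (G : SimpleGraph (Fin n)) (M₀ : Set (Sym2 (Fin n))) (g : ℕ) : Prop := G.IsE g ∧ ed n g ∈ M₀

/-- The edges that can replace an edge of `M₀`. -/
def CanReplace (G : SimpleGraph (Fin n)) (M₀ : Set (Sym2 (Fin n))) (g f : ℕ) : Prop :=
  InSol G M₀ g ∧ G.IsE f ∧
    (g = f ∨ 3 ≤ M₀.ncard ∧ G.Loose (ed n g) ∧ G.Loose (ed n f) ∧ G.Sim (ed n g) (ed n f))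

section Kernel

variable {m m' : ℕ} {π : Fin n → Fin m} {H' : SimpleGraph (Fin m')} {k : Fin n → Fin m'}
  {pend : Set (Sym2 (Fin m'))}

theorem IsNumbered.map_eq (hn : IsNumbered G π H' k pend) {e f : Sym2 (Fin n)}
    (h : e.map k = f.map k) : e.map π = f.map π := by
  have hk : ∀ a b, k a = k b → π a = π b := fun a b hab => Fin.ext (by
    rw [← hn.map, ← hn.map, hab])
  induction e with | _ a b =>
  induction f with | _ c d =>
  rw [Sym2.map_mk, Sym2.map_mk, Sym2.eq_iff] at h ⊢
  rcases h with ⟨h1, h2⟩ | ⟨h1, h2⟩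
  · exact Or.inl ⟨hk _ _ h1, hk _ _ h2⟩
  · exact Or.inr ⟨hk _ _ h1, hk _ _ h2⟩

theorem IsNumbered.mem_image_iff (hn : IsNumbered G π H' k pend) {M₀ : Set (Sym2 (Fin n))}
    (h₀ : G.Kept π M₀) {e : Sym2 (Fin n)} (he : e ∈ G.edgeSet) (hd : ¬ (e.map π).IsDiag) :
    e.map k ∈ Sym2.map k '' M₀ ↔ e ∈ M₀ := by
  constructor
  · rintro ⟨f, hf, h1⟩
    have h2 := hn.isKernel.contr.injOn ⟨h₀.1.1.subset hf, h₀.2.1 f hf⟩ ⟨he, hd⟩ (hn.map_eq h1)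
    rwa [← h2]
  · exact fun h => ⟨e, h, rfl⟩

variable {u w : Mem} {s : List Bool}

/-- The memory after the preparation for the solution `s`. -/
theorem prepare_frame {x y : List Bool}
    (hw : w = prepare.st (bnd [x, y, s]) (fun _ => 0) (initMem [x, y, s])) :
    (∀ j, w 2 0 j = (s.getD j false).toNat) ∧ w 25 = fun _ _ => 0 := by
  constructor
  · intro j
    rw [hw, Cmd.st_of_notMem (b := 2) prepare (by decide)]
    simp [initMem]
  · rw [hw, Cmd.st_of_notMem (b := 25) prepare (by decide)]
    funext i j
    simp [initMem]

theorem HasKernel.congr (h : HasKernel G N π u) (hw : ∀ a ∉ (parList choices).writes, w a = u a) :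
    HasKernel G N π w := by
  obtain ⟨⟨h1, h7, h8, h9, h10⟩, g1, g2, g3, g4, g5, g6, g7, g8⟩ := h
  refine ⟨⟨h1.congr fun a ha => hw a (by revert a; decide), h7, ?_, ?_, ?_⟩, g1, g2, ?_, g4, ?_, ?_, ?_,
    ?_⟩
  · rwa [hw 14 (by decide)]
  · rwa [hw 15 (by decide)]
  · rwa [hw 16 (by decide)]
  · rwa [hw 19 (by decide)]
  · rwa [hw 21 (by decide)]
  · rwa [hw 22 (by decide)]
  · rwa [hw 20 (by decide)]
  · rwa [hw 23 (by decide), hw 22 (by decide)]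

theorem bit_ne_zero {j : ℕ} : (s.getD j false).toNat ≠ 0 ↔ s.getD j false = true := by
  cases s.getD j false <;> simp

/-- The pendant edge joins 0 and `m`; in row 0 of the adjacency matrix this is the bit with the
number `m`. -/
theorem hasPendBit (hK : HasKernel G N π u) (hn : IsNumbered G π H' k pend)
    (hw : w = (parList choices).st N (fun _ => 0) u) {N' : Set (Sym2 (Fin m'))}
    (h2 : ∀ j, w 2 0 j = ((encodeEdges N').getD j false).toNat) :
    w 24 0 0 ≠ 0 ↔ (∃ M, G.LostSol π M) ∧ ∃ (h : m < m') (h₀ : 0 < m'),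
      s(⟨m, h⟩, ⟨0, h₀⟩) ∈ N' := by
  have hlt := hK.lt_bound
  have hm : 0 < m := (π 0).pos
  have hw' : ∀ a : Fin 32, a ∉ (parList choices).writes → w a = u a := fun a ha => by
    rw [hw]; exact Cmd.st_of_notMem _ ha
  rw [hw, parList_holds ssa_choices (List.getElem_mem (l := choices) (n := 0) (by decide))
    (by omega) (by omega), ← hw]
  simp only [holds_and, holds_cell, val]
  rw [hw' 22 (by decide), hw' 20 (by decide), hK.pend, hK.count, h2, bit_ne_zero]
  refine and_congr_right fun hl => ?_
  have hm' : m' = m + 1 := by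
    rcases hn.card with h | h
    · exact absurd hl h.1
    · exact h.2
  have h3 := getD_encodeEdges (M := N') (p := 0) (q := m) (by omega) (by omega)
  rw [zero_mul, zero_add] at h3
  rw [h3, Sym2.eq_swap]
  constructor
  · exact fun h => ⟨by omega, by omega, h.1⟩
  · exact fun ⟨_, _, h⟩ => ⟨h, by omega⟩

/-- The contraction is injective on the edges that do not become loops. Hence an edge of `G` lies in
`M₀` exactly if it is not a loop and the bit of its image is set, and `M₀` can be read off from the
solution of the kernel. -/
theorem hasChoices_prepare (hK : HasKernel G N π u) (h6 : ∀ i < N, ∀ j < N, u 6 i j = i * j)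
    (hn : IsNumbered G π H' k pend) (hw : w = (parList choices).st N (fun _ => 0) u)
    {M₀ : Set (Sym2 (Fin n))} (h₀ : G.Kept π M₀)
    (h2 : ∀ j, w 2 0 j = ((encodeEdges (Sym2.map k '' M₀)).getD j false).toNat) :
    HasChoices G N (InSol G M₀) (CanReplace G M₀) w ∧ w 31 0 0 ≠ 0 ∧
      ∀ g < N, w 11 g 0 = w 30 g 0 := by
  classical
  have hlt := hK.lt_bound
  have hm : 0 < m := (π 0).pos
  have hw' : ∀ a : Fin 32, a ∉ (parList choices).writes → w a = u a := fun a ha => by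
    rw [hw]; exact Cmd.st_of_notMem _ ha
  have hKw := hK.congr hw'
  have hm' : m' ≤ n + 1 := by
    have := hK.le
    rcases hn.card with h | h <;> omega
  have hmN : m' < N := by
    have := hK.bound
    have := Nat.le_mul_self n
    omega
  have h23 : w 23 0 0 = m' := IsNumbered.card_eq hKw hn
  have h6w : ∀ i < N, ∀ j < N, w 6 i j = i * j := by rwa [hw' 6 (by decide)]
  -- All fibres have numbers below `m`, so the image of `M₀` avoids the pendant vertex.
  have h24 : w 24 0 0 = 0 := by
    by_contra h
    obtain ⟨-, h3, h4, e, -, h5⟩ := (hasPendBit hK hn hw h2).1 h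
    have h7 : (⟨m, h3⟩ : Fin m') ∈ Sym2.map k e := h5 ▸ Sym2.mem_mk_left _ _
    obtain ⟨p, -, hp⟩ := Sym2.mem_map.1 h7
    have h8 := hn.map p
    rw [hp] at h8
    have := (π p).2
    simp only at h8
    omega
  have mem : ∀ g < N, ∀ j < N, (w 27 g j ≠ 0 ↔ InSol G M₀ g) := by
    intro g hg j hj
    rw [hw, parList_holds ssa_choices (List.getElem_mem (l := choices) (n := 1) (by decide)) hg hj, ← hw]
    simp only [holds_and, holds_not, loop, holds_eq, holds_cell, val, MatchingCutKernel.cl,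
      Function.update_apply]
    simp only [zero_ne_one, if_false, if_true]
    rw [hKw.isE g hg 0 (by omega), InSol]
    refine and_congr_right fun hE => ?_
    have hcl : ∀ p (hp : p < n), w 19 p 0 = k ⟨p, hp⟩ := fun p hp => by
      rw [hn.map]; exact hKw.cl ⟨p, hp⟩
    have hd := hE.div_lt
    have ht := Nat.mod_lt g (NeZero.pos n)
    have hkd := (k ⟨_, hd⟩).2
    have hkt := (k ⟨_, ht⟩).2
    rw [hKw.hd g hg, hKw.tl g hg, hcl _ hd, hcl _ ht, h23, h6w _ (by omega) _ hmN, h2, bit_ne_zero,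
      getD_encodeEdges hkd hkt]
    have hmk : s(⟨(k ⟨_, hd⟩ : ℕ), hkd⟩, ⟨(k ⟨_, ht⟩ : ℕ), hkt⟩) = (ed n g).map k := by
      rw [ed_eq hE.lt, Sym2.map_mk]
    rw [hmk]
    have hdiag : ((ed n g).map π).IsDiag ↔ (k ⟨_, hd⟩ : ℕ) = k ⟨_, ht⟩ := by
      rw [ed_eq hE.lt, Sym2.map_mk, Sym2.mk_isDiag_iff, hn.map, hn.map, Fin.ext_iff]
    rw [← hdiag]
    constructor
    · rintro ⟨h3, h4, -⟩
      exact (hn.mem_image_iff h₀ hE.1 h3).1 h4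
    · intro h3
      have h4 := h₀.2.1 _ h3
      refine ⟨h4, ⟨_, h3, rfl⟩, ?_⟩
      rwa [Ne, ← hdiag]
  have large : w 28 0 0 ≠ 0 ↔ 3 ≤ M₀.ncard := by
    rw [hw, parList_holds ssa_choices (List.getElem_mem (l := choices) (n := 2) (by decide)) (by omega)
      (by omega), ← hw]
    simp only [holds_lt, val_count, holds_cell, val, Function.update_self]
    have : ((Finset.range N).filter fun i => w 27 i 0 ≠ 0).card = M₀.ncard := by
      rw [← Set.ncard_coe_finset]
      refine Set.ncard_congr (fun g _ => ed n g) (fun g hg => ?_) (fun g g' hg hg' he => ?_)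
        (fun e he => ?_)
      · rw [Finset.mem_coe, Finset.mem_filter, Finset.mem_range] at hg
        exact ((mem g hg.1 0 (by omega)).1 hg.2).2
      · rw [Finset.mem_coe, Finset.mem_filter, Finset.mem_range] at hg hg'
        exact (((mem g hg.1 0 (by omega)).1 hg.2).1.eq ((mem g' hg'.1 0 (by omega)).1 hg'.2).1).1 he
      · have h3 := isE_ix (h₀.1.1.subset he)
        refine ⟨ix n e, ?_, ed_ix e⟩
        rw [Finset.mem_coe, Finset.mem_filter, Finset.mem_range, mem _ (hK.lt h3) 0 (by omega)]
        exact ⟨hK.lt h3, h3, by rwa [ed_ix]⟩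
    rw [this]
    rfl
  have choice : ∀ g f, InSol G M₀ g → f < N → (w 29 g f ≠ 0 ↔ CanReplace G M₀ g f) := by
    intro g f hg hf
    have hgN := hK.lt hg.1
    rw [hw, parList_holds ssa_choices (List.getElem_mem (l := choices) (n := 3) (by decide)) hgN hf, ← hw]
    simp only [holds_and, holds_or, holds_eq, holds_cell, val, Function.update_apply]
    simp only [zero_ne_one, if_false, if_true]
    rw [large, hKw.loose g hgN 0 (by omega), hKw.loose f hf 0 (by omega)]
    constructor
    · rintro (rfl | ⟨h3, ⟨h4, h5⟩, h7⟩)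
      · exact ⟨hg, hg.1, Or.inl rfl⟩
      · exact ⟨hg, h5.1, Or.inr ⟨h3, h4.2, h5.2,
          (hKw.sim hKw.conn hg.1 h5.1 h4.2.2.1 h5.2.2.1).1 (Or.inr h7)⟩⟩
    · rintro ⟨-, h3, h4 | ⟨h4, h5, h7, h8⟩⟩
      · exact Or.inl h4
      · rcases (hKw.sim hKw.conn hg.1 h3 h5.2.1 h7.2.1).2 h8 with h9 | h9
        · exact Or.inl h9
        · exact Or.inr ⟨h4, ⟨⟨hg.1, h5⟩, h3, h7⟩, h9⟩
  refine ⟨⟨hKw.toHasEdges, h6w, ?_, h24, fun g hg => mem g hg 0 (by omega), choice, fun g hg => ?_⟩, ?_,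
    fun g hg => ?_⟩
  · by_contra h
    exact hKw.not_cutConnected.1 h hKw.conn
  · have hgN := hK.lt hg.1
    have hfirst : w 30 g 0 = ((Finset.range N).filter fun i => ∀ j < N, i < j ∨ ¬ CanReplace G M₀ g j).card := by
      rw [hw, parList_spec _ ssa_choices (30, _) (List.getElem_mem (l := choices) (n := 4) (by decide)) g
        hgN 0 (by omega), ← hw]
      simp only [val_count, holds_all, holds_or, holds_not, holds_lt, holds_cell, val,
          Function.update_apply]
      simp only [zero_ne_one, if_false, if_true, Nat.reduceEqDiff, OfNat.ofNat_ne_zero,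
        OfNat.zero_ne_ofNat, OfNat.ofNat_ne_one]
      congr 1
      ext i
      simp only [Finset.mem_filter]
      refine and_congr_right fun _ => forall_congr' fun j => imp_congr_right fun hj => ?_
      rw [choice g j hg hj]
    rw [hfirst]
    exact card_filter_least (fun j hj => hK.lt hj.2.1) ⟨g, hg, hg.1, Or.inl rfl⟩
  · rw [hw, parList_holds ssa_choices (List.getElem_mem (l := choices) (n := 6) (by decide)) (by omega)
      (by omega)]
    simp [Holds, val]
  · rw [hw, parList_spec _ ssa_choices (11, _) (List.getElem_mem (l := choices) (n := 5) (by decide)) g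
        hg 0 (by omega), ← hw]
    simp [val]

/-- The edge sets described by the choice functions are the solutions that are represented by the
image of `M₀`. -/
theorem image_encChoice (hn : IsNumbered G π H' k pend) {M₀ : Set (Sym2 (Fin n))} (h₀ : G.Kept π M₀) :
    Set.InjOn (encChoice n (InSol G M₀)) {c | Choice (InSol G M₀) (CanReplace G M₀) c} ∧
      encChoice n (InSol G M₀) '' {c | Choice (InSol G M₀) (CanReplace G M₀) c} =
        encodeEdges '' {M | G.IsMinimalMatchingCut M ∧
          G.reprSol (ix n) π k pend M = Sym2.map k '' M₀} := by
  classical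
  set S := InSol G M₀ with hS
  set C := CanReplace G M₀ with hC
  have hSix : ∀ e ∈ M₀, S (ix n e) := fun e he =>
    ⟨isE_ix (h₀.1.1.subset he), by rwa [ed_ix]⟩
  -- The exchange of edges that corresponds to a choice function on edge numbers.
  let ex : (ℕ → ℕ) → Sym2 (Fin n) → Sym2 (Fin n) := fun c e => ed n (c (ix n e))
  have himg : ∀ c, ed n '' {e | ∃ g, S g ∧ c g = e} = ex c '' M₀ := by
    intro c
    ext e
    constructor
    · rintro ⟨_, ⟨g, hg, rfl⟩, rfl⟩
      refine ⟨ed n g, hg.2, ?_⟩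
      simp only [ex, hg.1.2]
    · rintro ⟨e, he, rfl⟩
      exact ⟨_, ⟨_, hSix e he, rfl⟩, rfl⟩
  have hexch : ∀ c, Choice S C c → G.IsExchange M₀ (ex c) := by
    intro c hc e he
    obtain ⟨-, h1, h2 | h2⟩ := hc.1 _ (hSix e he)
    · left
      simp only [ex, ← h2, ed_ix]
    · right
      rw [ed_ix] at h2
      exact h2.2
  have hsub : ∀ c, Choice S C c → ex c '' M₀ ⊆ G.edgeSet := by
    rintro c hc _ ⟨e, he, rfl⟩
    exact (hc.1 _ (hSix e he)).2.1.1
  -- With fewer than three edges only the identical choice is allowed, as the class contains nothing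
  -- but `M₀`.
  have hsmall : ¬ 3 ≤ M₀.ncard → ∀ c, Choice S C c → ∀ g, S g → c g = g := by
    intro h3 c hc g hg
    obtain ⟨-, h1, h2 | h2⟩ := hc.1 g hg
    · exact h2.symm
    · exact absurd h2.1 h3
  refine ⟨fun c hc d hd hcd => ?_, ?_⟩
  · have hc : Choice S C c := hc
    have hd : Choice S C d := hd
    rw [encChoice, encChoice, himg, himg] at hcd
    have h1 := encodeEdges_inj (hsub c hc) (hsub d hd) hcd
    funext g
    by_cases hg : S g
    · by_cases h3 : 3 ≤ M₀.ncard
      · have h4 := LargeSol.exchange_inj ⟨h₀.1, h₀.isMat, h3⟩ (hexch c hc) (hexch d hd) h1 _ hg.2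
        simp only [ex, hg.1.2] at h4
        exact ((hc.1 g hg).2.1.eq (hd.1 g hg).2.1).1 h4
      · rw [hsmall h3 c hc g hg, hsmall h3 d hd g hg]
    · rw [hc.2 g hg, hd.2 g hg]
  · have hset : {M | G.IsMinimalMatchingCut M ∧ G.reprSol (ix n) π k pend M = Sym2.map k '' M₀} =
        {M | if 3 ≤ M₀.ncard then ∃ c, G.IsExchange M₀ c ∧ M = c '' M₀ else M = M₀} := by
      ext M
      exact hn.isKernel.reprSol_eq_image h₀
    rw [hset]
    ext s
    constructor
    · rintro ⟨c, hc, rfl⟩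
      refine ⟨ex c '' M₀, ?_, by rw [encChoice, himg]⟩
      change ite _ _ _
      split_ifs with h3
      · exact ⟨_, hexch c hc, rfl⟩
      · rw [Set.image_congr (g := id), Set.image_id]
        intro e he
        simp only [ex, hsmall h3 c hc _ (hSix e he), ed_ix, id]
    · rintro ⟨M, hM, rfl⟩
      have hM : ite _ _ _ := hM
      -- The identity serves as exchange in the small case, so that both cases give a choice
      -- function by the same formula.
      obtain ⟨c, hc, hc3, rfl⟩ : ∃ c, G.IsExchange M₀ c ∧ (¬ 3 ≤ M₀.ncard → ∀ e, c e = e) ∧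
          M = c '' M₀ := by
        split_ifs at hM with h3
        · obtain ⟨c, h4, h5⟩ := hM
          exact ⟨c, h4, fun h => absurd h3 h, h5⟩
        · exact ⟨id, fun g _ => Or.inl rfl, fun _ _ => rfl, by rw [hM, Set.image_id]⟩
      have hedge : ∀ e ∈ M₀, c e ∈ G.edgeSet := by
        intro e he
        rcases hc e he with h | h
        · rw [h]; exact h₀.1.1.subset he
        · exact h.2.1.1
      refine ⟨fun g => if S g then ix n (c (ed n g)) else 0, ⟨fun g hg => ?_, fun g hg => if_neg hg⟩, ?_⟩
      · beta_reduce
        rw [if_pos hg]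
        refine ⟨hg, isE_ix (hedge _ hg.2), ?_⟩
        rw [ed_ix]
        by_cases h3 : 3 ≤ M₀.ncard
        · rcases hc _ hg.2 with h | h
          · left
            rw [h, hg.1.2]
          · exact Or.inr ⟨h3, h⟩
        · left
          rw [hc3 h3, hg.1.2]
      · rw [encChoice, himg]
        congr 1
        refine Set.image_congr fun e he => ?_
        simp only [ex, if_pos (hSix e he), ed_ix]

end Kernel

end MatchingCutKernel

/-! ### Correctness of the lifting algorithm -/

namespace MatchingCutKernel

open RAM RAM.Tm SimpleGraph Odometer

/-- The loop of the lifting algorithm, started after the preparation, outputs exactly the strings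
in `X`, without repetition. -/
def Lifts (x y s : List Bool) (X : Set (List Bool)) : Prop :=
  ∃ l : List (List Bool), Enumerates (bnd [x, y, s]) round
    (prepare.st (bnd [x, y, s]) (fun _ => 0) (initMem [x, y, s])) l ∧ l.Nodup ∧ {w | w ∈ l} = X

variable {n : ℕ} {G : SimpleGraph (Fin n)}

theorem sol_eq_empty {x : List Bool}
    (h : ∀ (n : ℕ) (G : SimpleGraph (Fin n)), G.encode = x → n = 0) : enumMinimalMC.Sol x = ∅ := by
  refine Set.eq_empty_iff_forall_notMem.2 ?_
  rintro s ⟨n, G, M, h1, h2, -⟩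
  obtain rfl := h n G h1
  obtain ⟨⟨⟨A, ⟨a, -⟩, -⟩, -⟩, -⟩ := h2
  exact a.elim0

theorem sol_of_not_cutConnected (hG : ¬ G.CutConnected) :
    enumMinimalMC.Sol G.encode = {encodeEdges (∅ : Set (Sym2 (Fin n)))} := by
  rw [sol_encode]
  simp only [isMinimalMatchingCut_of_not_cutConnected hG, Set.ofPred_eq_eq_singleton, Set.image_singleton]

theorem not_cutConnected_bot : ¬ (⊥ : SimpleGraph (Fin 2)).CutConnected := by
  intro h
  have h1 : (⊥ : SimpleGraph (Fin 2)).cutEdges {0} = ∅ := by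
    refine Set.eq_empty_iff_forall_notMem.2 ?_
    rintro e ⟨u, -, v, -, h, -⟩
    exact h
  rcases h _ h1 with h2 | h2
  · exact Set.singleton_ne_empty _ h2
  · have h3 : (1 : Fin 2) ∈ ({0} : Set (Fin 2)) := h2 ▸ Set.mem_univ _
    simp at h3

theorem isPartitionBy_singleton (s : List Bool) {X : Set (List Bool)} (hX : X.Nonempty) :
    IsPartitionBy {s} X fun _ => X :=
  ⟨fun _ _ => hX, fun t ht t' ht' h => absurd (ht.trans ht'.symm) h, by simp⟩

variable [NeZero n]

theorem prepare_mul (x y s : List Bool) {w : Mem}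
    (hw : w = prepare.st (bnd [x, y, s]) (fun _ => 0) (initMem [x, y, s])) :
    ∀ i < bnd [x, y, s], ∀ j < bnd [x, y, s], w 6 i j = i * j := by
  have h1 := (hasInput_initMem x [y, s]).hasReading.graph.mul
  have h2 : w = (parList choices).st (bnd [x, y, s]) (fun _ => 0)
    (analyse.st (bnd [x, y, s]) (fun _ => 0) (initMem [x, y, s])) := hw
  rwa [h2, Cmd.st_of_notMem (b := 6) (parList choices) (by decide)]

theorem prepare_flag (x y s : List Bool) {w : Mem}
    (hw : w = prepare.st (bnd [x, y, s]) (fun _ => 0) (initMem [x, y, s])) : w 31 0 0 ≠ 0 := by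
  have h0 : 0 < bnd [x, y, s] := by simp only [bnd]; omega
  have h1 : w = (parList choices).st (bnd [x, y, s]) (fun _ => 0)
    (analyse.st (bnd [x, y, s]) (fun _ => 0) (initMem [x, y, s])) := hw
  rw [h1, parList_holds ssa_choices (List.getElem_mem (l := choices) (n := 6) (by decide)) h0 h0]
  simp [Holds, val]

theorem lifts_of_not_cutConnected (hG : ¬ G.CutConnected) (y s : List Bool) :
    Lifts G.encode y s (enumMinimalMC.Sol G.encode) := by
  have hE := (hasInput_initMem G.encode [y, s]).hasEdges_analyse
  obtain ⟨w, hw⟩ : ∃ w, w = prepare.st (bnd [G.encode, y, s]) (fun _ => 0) (initMem [G.encode, y, s]) :=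
    ⟨_, rfl⟩
  have hEw : HasEdges G (bnd [G.encode, y, s]) w := hE.congr fun a ha => by
    rw [hw]
    exact Cmd.st_of_notMem (parList choices) (by revert a; decide)
  refine ⟨_, ?_, List.nodup_singleton (encodeEdges (∅ : Set (Sym2 (Fin n)))), ?_⟩
  · rw [← hw]
    exact enumerates_empty hEw (prepare_mul _ _ _ hw) (prepare_frame hw).2 (prepare_flag _ _ _ hw)
      (hEw.not_cutConnected.2 hG)
  · rw [sol_of_not_cutConnected hG]
    ext t
    simp

section Connected

variable {m m' : ℕ} {π : Fin n → Fin m} {H' : SimpleGraph (Fin m')} {k : Fin n → Fin m'}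
  {pend : Set (Sym2 (Fin m'))}
  (hk : ∀ N u, HasInput G.encode N u → HasKernel G N π (analyse.st N (fun _ => 0) u))
  (hn : IsNumbered G π H' k pend)
include hk hn

theorem lifts_kept (y : List Bool) {M₀ : Set (Sym2 (Fin n))} (h₀ : G.Kept π M₀) :
    Lifts G.encode y (encodeEdges (Sym2.map k '' M₀)) (encodeEdges '' {M | G.IsMinimalMatchingCut M ∧
      G.reprSol (ix n) π k pend M = Sym2.map k '' M₀}) := by
  set s := encodeEdges (Sym2.map k '' M₀) with hs
  have hK := hk _ _ (hasInput_initMem G.encode [y, s])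
  have h6 := (hasInput_initMem G.encode [y, s]).hasReading.graph.mul
  obtain ⟨w, hw⟩ : ∃ w, w = prepare.st (bnd [G.encode, y, s]) (fun _ => 0) (initMem [G.encode, y, s]) :=
    ⟨_, rfl⟩
  obtain ⟨h1, h2, h3⟩ := hasChoices_prepare hK h6 hn hw h₀ (prepare_frame hw).1
  have hS : ∀ g, InSol G M₀ g → g < bnd [G.encode, y, s] := fun g hg => hK.lt hg.1
  obtain ⟨L, h4, h5, h7⟩ := h1.enumerates hS (fun g f hgf => hgf.2.1) h2 fun g hg => h3 g (hS g hg)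
  obtain ⟨h8, h9⟩ := image_encChoice hn h₀
  refine ⟨_, hw ▸ h7, ?_, ?_⟩
  · exact h4.map_on fun c hc d hd hcd => h8 ((h5 c).1 hc) ((h5 d).1 hd) hcd
  · rw [← h9]
    ext t
    simp only [List.mem_map, h5, Set.mem_image, Set.mem_ofPred_eq]

theorem lifts_lost (y : List Bool) (hl : ∃ M, G.LostSol π M) :
    Lifts G.encode y (encodeEdges pend) (encodeEdges '' {M | G.LostSol π M}) := by
  set s := encodeEdges pend with hs
  have hK := hk _ _ (hasInput_initMem G.encode [y, s])
  obtain ⟨w, hw⟩ : ∃ w, w = prepare.st (bnd [G.encode, y, s]) (fun _ => 0) (initMem [G.encode, y, s]) :=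
    ⟨_, rfl⟩
  have hKw : HasKernel G (bnd [G.encode, y, s]) π w := hK.congr fun a ha => by
    rw [hw]
    exact Cmd.st_of_notMem (parList choices) ha
  have h24 : w 24 0 0 ≠ 0 := by
    refine (hasPendBit hK hn hw (prepare_frame hw).1).2 ⟨hl, ?_⟩
    obtain ⟨h1, h2, h3⟩ := hn.pend_eq hl
    exact ⟨h1, h2, h3 ▸ rfl⟩
  obtain ⟨l, h1, h2, h3⟩ := enumerates_lost hKw (prepare_mul _ _ _ hw) (prepare_flag _ _ _ hw)
    (by_contra fun h => hKw.not_cutConnected.1 h hKw.conn) h24 hl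
  exact ⟨l, hw ▸ h3, h1, h2⟩

/-- The classes are the fibres of `reprSol`. Over the image of a kept solution the choice functions
are enumerated, over the pendant edge the lost solutions. -/
theorem exists_lifting_of_isNumbered : ∃ S : List Bool → Set (List Bool),
    IsPartitionBy (enumMinimalMC.Sol H'.encode) (enumMinimalMC.Sol G.encode) S ∧
    ∀ s ∈ enumMinimalMC.Sol H'.encode, Lifts G.encode H'.encode s (S s) := by
  have hsurj := hn.isKernel.reprSol_surj
  have hpart := isPartitionBy_image (X := {M | G.IsMinimalMatchingCut M})
    (Y := enumMinimalMC.Sol H'.encode) encodeEdges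
    (fun M hM M' hM' h => encodeEdges_inj (subset_of_isMinimal hM) (subset_of_isMinimal hM') h)
    (fun M => encodeEdges (G.reprSol (ix n) π k pend M)) (by
      rw [sol_encode, ← hsurj, Set.image_image])
  rw [← sol_encode] at hpart
  refine ⟨_, hpart, fun s hs => ?_⟩
  rw [sol_encode] at hs
  obtain ⟨N', hN', rfl⟩ := hs
  have hclass : {M ∈ {M | G.IsMinimalMatchingCut M} |
      encodeEdges (G.reprSol (ix n) π k pend M) = encodeEdges N'} =
      {M | G.IsMinimalMatchingCut M ∧ G.reprSol (ix n) π k pend M = N'} := by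
    ext M
    refine and_congr_right fun hM => ⟨fun h => ?_, fun h => by rw [h]⟩
    have h1 : H'.IsMinimalMatchingCut (G.reprSol (ix n) π k pend M) := by
      have : G.reprSol (ix n) π k pend M ∈ {N | H'.IsMinimalMatchingCut N} := hsurj ▸ ⟨M, hM, rfl⟩
      exact this
    exact encodeEdges_inj (subset_of_isMinimal h1) (subset_of_isMinimal hN') h
  rw [hclass]
  rcases (hn.isKernel.sol N').1 hN' with ⟨M₀, h₀, rfl⟩ | ⟨hl, rfl⟩
  · exact lifts_kept hk hn _ h₀
  · simp only [hn.isKernel.reprSol_eq_pend hl]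
    exact lifts_lost hk hn _ hl

end Connected

omit [NeZero n]

theorem exists_lifting (x : List Bool) : ∃ S : List Bool → Set (List Bool),
    IsPartitionBy (enumMinimalMC.Sol (kernelOf x)) (enumMinimalMC.Sol x) S ∧
    ∀ s ∈ enumMinimalMC.Sol (kernelOf x), Lifts x (kernelOf x) s (S s) := by
  by_cases hx : ∀ (n : ℕ) (G : SimpleGraph (Fin n)), G.encode = x → n = 0
  · have h1 : enumMinimalMC.Sol (kernelOf x) = ∅ := by
      rw [kernelOf_of_invalid hx]
      refine sol_eq_empty fun n G h => ?_
      have := congrArg List.length h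
      rw [length_encode] at this
      simpa using this
    refine ⟨fun _ => ∅, ?_, ?_⟩
    · rw [h1, sol_eq_empty hx]
      exact ⟨by simp, by simp, by simp⟩
    · rw [h1]
      simp
  push Not at hx
  obtain ⟨n, G, rfl, h0⟩ := hx
  have : NeZero n := ⟨h0⟩
  by_cases hG : G.CutConnected
  · obtain ⟨m, π, hk⟩ := HasInput.hasKernel hG
    have hK := hk _ _ (hasInput_initMem G.encode [])
    obtain ⟨m', H', k, pend, hn⟩ := exists_isNumbered hK.contr hK.zero
    rw [kernelOf_of_isNumbered hk hn]
    exact exists_lifting_of_isNumbered hk hn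
  · rw [kernelOf_of_not_cutConnected hG, sol_of_not_cutConnected not_cutConnected_bot]
    refine ⟨fun _ => enumMinimalMC.Sol G.encode, ?_, fun s _ => lifts_of_not_cutConnected hG _ _⟩
    refine isPartitionBy_singleton _ ?_
    rw [sol_of_not_cutConnected hG]
    exact Set.singleton_nonempty _

theorem length_of_mem_sol {x s : List Bool} (h : s ∈ enumMinimalMC.Sol x) : s.length = x.length := by
  obtain ⟨n, G, M, rfl, -, rfl⟩ := h
  rw [encodeEdges, length_encode, length_encode]

theorem isPolyDelayEnumKernel :
    IsPolyDelayEnumKernel enumMinimalMC kernelize.prog (iterProg prepare round) kernelOf := by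
  choose S h1 h2 using exists_lifting
  refine ⟨isKernelization_kernelOf, S, h1, 2 * (5 + prepare.cost.comp (6 * Polynomial.X + 10) +
    round.cost.comp (6 * Polynomial.X + 10)) + 1, fun x s hs => ?_⟩
  obtain ⟨l, h3, h4, h5⟩ := h2 x s hs
  obtain ⟨τ, h6, h7, h8⟩ := iterProg_run prepare round [x, kernelOf x, s] (by simp)
    (prepare_out _ _ _) h3
  refine ⟨τ, h6, h7 ▸ h4, h7 ▸ h5, fun d hd => (h8 d hd).trans ?_⟩
  simp only [Polynomial.eval_add, Polynomial.eval_comp, Polynomial.eval_mul, Polynomial.eval_X,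
    Polynomial.eval_ofNat, Polynomial.eval_one]
  -- A solution of the kernel is as long as the kernel itself, so the second string counts twice;
  -- this turns the factor 3 into 6.
  have hb : bnd [x, kernelOf x, s] ≤ 6 * (x.length + (kernelOf x).length + enumMinimalMC.κ x +
      enumMinimalMC.κ (kernelOf x)) + 10 := by
    simp only [bnd, List.getD_cons_zero, List.getD_cons_succ, length_of_mem_sol hs]
    omega
  have h9 := eval_mono prepare.cost hb
  have h10 := eval_mono round.cost hb
  omega

end MatchingCutKernel

/-! ## Graphs with few cycles and many solutions -/

namespace SimpleGraph

variable {V : Type*} {G : SimpleGraph V}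

theorem isBridge_of_forall_adj {B : Set V} {u v : V} (hu : u ∈ B) (hv : v ∉ B)
    (h : ∀ x y, G.Adj x y → x ∈ B → y ∉ B → s(x, y) = s(u, v)) : G.IsBridge s(u, v) := by
  rw [isBridge_iff]
  rintro ⟨p⟩
  have : ∀ x y, (G.deleteEdges {s(u, v)}).Walk x y → x ∈ B → y ∈ B := by
    intro x y p
    induction p with
    | nil => exact id
    | @cons a b c hab _ ih =>
      intro ha
      refine ih ?_
      by_contra hb
      rw [deleteEdges_adj] at hab
      exact hab.2 (h a b hab.1 ha hb)
  exact hv (this u v p hu)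

variable {r l : ℕ}

/-- Oriented edges of a theta graph: `r` paths with `l + 1` inner vertices each between two hubs. -/
def thetaStep : Bool ⊕ (Fin r × Fin (l + 1)) → Bool ⊕ (Fin r × Fin (l + 1)) → Prop
  | .inl false, .inr (_, j) => (j : ℕ) = 0
  | .inr (_, j), .inl true => (j : ℕ) = l
  | .inr (i, j), .inr (i', j') => i = i' ∧ (j : ℕ) + 1 = j'
  | _, _ => False

theorem thetaStep_irrefl (x : Bool ⊕ (Fin r × Fin (l + 1))) : ¬ thetaStep x x := by
  rcases x with (_ | _) | ⟨i, j⟩ <;> simp [thetaStep]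

/-- The theta graph, with vertices named by `e`. -/
def theta (e : V ≃ Bool ⊕ (Fin r × Fin (l + 1))) : SimpleGraph V where
  Adj x y := thetaStep (e x) (e y) ∨ thetaStep (e y) (e x)
  symm := ⟨fun _ _ h => h.symm⟩
  loopless := ⟨fun _ h => h.elim (thetaStep_irrefl _) (thetaStep_irrefl _)⟩

variable (e : V ≃ Bool ⊕ (Fin r × Fin (l + 1)))

theorem theta_adj (x y) : (theta e).Adj (e.symm x) (e.symm y) ↔ thetaStep x y ∨ thetaStep y x := by
  simp [theta]

/-- The edge of the path `i` that the choice function `c` selects. -/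
def thetaEdge (c : Fin r → Fin l) (i : Fin r) : Sym2 V :=
  s(e.symm (.inr (i, (c i).castSucc)), e.symm (.inr (i, (c i).succ)))

/-- The side of the cut selected by `c` that contains the first hub. -/
def thetaSide (c : Fin r → Fin l) : Bool ⊕ (Fin r × Fin (l + 1)) → Prop
  | .inl b => b = false
  | .inr (i, j) => (j : ℕ) ≤ c i

/-- Path `i` changes sides exactly between its positions `c i` and `c i + 1`. Both are inner
vertices, so no edge at a hub is cut, and the edges on different paths are disjoint. -/
theorem theta_cutEdges (c : Fin r → Fin l) :
    (theta e).cutEdges {x | thetaSide c (e x)} = Set.range (thetaEdge e c) := by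
  ext f
  constructor
  · rintro ⟨u, hu, v, hv, h, rfl⟩
    obtain ⟨x, rfl⟩ := e.symm.surjective u
    obtain ⟨y, rfl⟩ := e.symm.surjective v
    rw [theta_adj] at h
    simp only [Set.mem_ofPred_eq, Equiv.apply_symm_apply] at hu hv
    have key : ∀ i (j j' : Fin (l + 1)), (j : ℕ) ≤ c i → ¬ (j' : ℕ) ≤ c i → (j : ℕ) + 1 = j' →
        s(e.symm (.inr (i, j)), e.symm (.inr (i, j'))) ∈ Set.range (thetaEdge e c) := by
      intro i j j' h1 h2 h3
      refine ⟨i, ?_⟩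
      have h4 : (c i).castSucc = j := Fin.ext (by simp only [Fin.val_castSucc]; omega)
      have h5 : (c i).succ = j' := Fin.ext (by simp only [Fin.val_succ]; omega)
      rw [thetaEdge, h4, h5]
    rcases x with (_ | _) | ⟨i, j⟩ <;> rcases y with (_ | _) | ⟨i', j'⟩ <;>
      simp only [thetaSide, thetaStep, or_false, false_or, or_self, Bool.true_eq_false, not_true] at h hu hv
    · omega
    · have := (c i).2
      omega
    · rcases h with ⟨rfl, h⟩ | ⟨rfl, h⟩
      · exact key _ _ _ hu hv h
      · omega
  · rintro ⟨i, rfl⟩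
    refine ⟨_, ?_, _, ?_, ?_, rfl⟩
    · simp [thetaSide]
    · simp [thetaSide]
    · rw [theta_adj]
      left
      simp [thetaStep]

theorem thetaEdge_eq {c d : Fin r → Fin l} {i k : Fin r} {v : V} (h : v ∈ thetaEdge e c i)
    (h' : v ∈ thetaEdge e d k) : i = k := by
  simp only [thetaEdge, Sym2.mem_iff] at h h'
  rcases h with rfl | rfl <;> rcases h' with h | h <;>
    exact congrArg Prod.fst (Sum.inr_injective (e.symm.injective h))

theorem thetaEdge_injective {c d : Fin r → Fin l}
    (h : Set.range (thetaEdge e c) = Set.range (thetaEdge e d)) : c = d := by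
  funext i
  obtain ⟨k, hk⟩ : thetaEdge e c i ∈ Set.range (thetaEdge e d) := h ▸ ⟨i, rfl⟩
  have hik : i = k := by
    have h1 : e.symm (.inr (i, (c i).castSucc)) ∈ thetaEdge e c i := Sym2.mem_mk_left _ _
    exact thetaEdge_eq e h1 (hk.symm ▸ h1)
  subst hik
  simp only [thetaEdge, Sym2.eq_iff, e.symm.injective.eq_iff, Sum.inr.injEq, Prod.mk.injEq, true_and,
    Fin.ext_iff, Fin.val_castSucc, Fin.val_succ] at hk
  apply Fin.ext
  omega

/-- Without the selected edges, every vertex is still joined to the hub on its side. A smaller cut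
is therefore constant on both sides; being nontrivial it separates the hubs, and so contains all
selected edges. -/
theorem theta_isMinimalMatchingCut (c : Fin r → Fin l) :
    (theta e).IsMinimalMatchingCut (Set.range (thetaEdge e c)) := by
  refine ⟨⟨⟨{x | thetaSide c (e x)}, ⟨e.symm (.inl false), ?_⟩, ⟨e.symm (.inl true), ?_⟩,
    (theta_cutEdges e c).symm⟩, ?_⟩, ?_⟩
  · simp [thetaSide]
  · simp [thetaSide]
  · rintro _ ⟨i, rfl⟩ _ ⟨k, rfl⟩ v h h'
    rw [thetaEdge_eq e h h']
  · rintro _ ⟨⟨B, hB, hB', rfl⟩, -⟩ hsub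
    set C : Bool ⊕ (Fin r × Fin (l + 1)) → Prop := fun x => e.symm x ∈ B with hC
    have same : ∀ x y, thetaStep x y → (thetaSide c x ↔ thetaSide c y) → (C x ↔ C y) := by
      intro x y hxy h
      have hadj := (theta_adj e x y).2 (Or.inl hxy)
      have hno : s(e.symm x, e.symm y) ∉ (theta e).cutEdges B := by
        intro h1
        have h2 := hsub h1
        rw [← theta_cutEdges, mem_cutEdges] at h2
        simp only [Set.mem_ofPred_eq, Equiv.apply_symm_apply] at h2
        exact h2.2 h
      rw [mem_cutEdges] at hno
      by_contra h1
      exact hno ⟨hadj, h1⟩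
    have low : ∀ i (j : ℕ) (hj : j < l + 1), j ≤ c i → (C (.inl false) ↔ C (.inr (i, ⟨j, hj⟩))) := by
      intro i j
      induction j with
      | zero => exact fun hj h => same _ _ rfl (by simp [thetaSide])
      | succ j ih =>
        intro hj h
        rw [ih (by omega) (by omega)]
        exact same _ _ ⟨rfl, rfl⟩ (by simp only [thetaSide]; omega)
    have high : ∀ i (k j : ℕ) (hj : j < l + 1), j + k = l → ¬ j ≤ c i →
        (C (.inr (i, ⟨j, hj⟩)) ↔ C (.inl true)) := by
      intro i k
      induction k with
      | zero => exact fun j hj h h' => same _ _ h (by simpa [thetaSide] using h')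
      | succ k ih =>
        intro j hj h h'
        rw [← ih (j + 1) (by omega) (by omega) (by omega)]
        exact same _ _ ⟨rfl, rfl⟩ (by simp only [thetaSide]; omega)
    have all : ∀ x, (thetaSide c x ∧ (C (.inl false) ↔ C x)) ∨ ¬ thetaSide c x ∧ (C x ↔ C (.inl true)) := by
      rintro ((_ | _) | ⟨i, j⟩)
      · simp [thetaSide]
      · simp [thetaSide]
      · by_cases h : (j : ℕ) ≤ c i
        · exact Or.inl ⟨h, low i j j.2 h⟩
        · exact Or.inr ⟨h, high i (l - j) j j.2 (by omega) h⟩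
    have hne : ¬ (C (.inl false) ↔ C (.inl true)) := by
      intro h
      obtain ⟨u, hu⟩ := hB
      obtain ⟨v, hv⟩ := hB'
      have h1 : C (e u) := by simpa [hC] using hu
      have h2 : ¬ C (e v) := by simpa [hC] using hv
      have h3 := all (e u)
      have h4 := all (e v)
      tauto
    rintro _ ⟨i, rfl⟩
    rw [thetaEdge, mem_cutEdges, theta_adj]
    refine ⟨Or.inl ⟨rfl, by simp⟩, ?_⟩
    have h1 := all (.inr (i, (c i).castSucc))
    have h2 := all (.inr (i, (c i).succ))
    simp only [thetaSide, Fin.val_castSucc, Fin.val_succ, le_refl, true_and, not_true, false_and, or_false,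
      Nat.succ_le_iff, lt_irrefl, not_false_iff, false_or] at h1 h2
    change ¬ (C _ ↔ C _)
    tauto

/-- Deleting the `r` edges at the first hub isolates it and leaves `r` paths that meet in the second
hub; every remaining edge is a bridge. -/
theorem feedbackEdgeNumber_theta_le : (theta e).feedbackEdgeNumber ≤ r := by
  classical
  let f : Fin r → Sym2 V := fun i => s(e.symm (.inl false), e.symm (.inr (i, 0)))
  have hf : ((Finset.univ.image f : Finset (Sym2 V)) : Set (Sym2 V)) ⊆ (theta e).edgeSet := by
    intro g hg
    simp only [Finset.coe_image, Finset.coe_univ, Set.image_univ] at hg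
    obtain ⟨i, rfl⟩ := hg
    exact (theta_adj e _ _).2 (Or.inl rfl)
  have hac : ((theta e).deleteEdges ((Finset.univ.image f : Finset (Sym2 V)) : Set (Sym2 V))).IsAcyclic := by
    rw [isAcyclic_iff_forall_adj_isBridge]
    have hadj : ∀ x y, ((theta e).deleteEdges ((Finset.univ.image f : Finset (Sym2 V)) : Set (Sym2 V))).Adj
        (e.symm x) (e.symm y) → (x ≠ .inl false ∧ y ≠ .inl false) ∧ (thetaStep x y ∨ thetaStep y x) := by
      intro x y h
      rw [deleteEdges_adj, theta_adj] at h
      refine ⟨⟨?_, ?_⟩, h.1⟩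
      · rintro rfl
        rcases y with (_ | _) | ⟨i, j⟩ <;> simp only [thetaStep, or_self, false_and, or_false] at h
        apply h.2
        have : j = 0 := Fin.ext h.1
        simp [f, this]
      · rintro rfl
        rcases x with (_ | _) | ⟨i, j⟩ <;> simp only [thetaStep, or_self, false_and, false_or] at h
        apply h.2
        have : j = 0 := Fin.ext h.1
        simp [f, this, Sym2.eq_swap]
    have bridge : ∀ x y, x ≠ .inl false → thetaStep x y →
        ((theta e).deleteEdges ((Finset.univ.image f : Finset (Sym2 V)) : Set (Sym2 V))).IsBridge
          s(e.symm x, e.symm y) := by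
      intro x y hx hxy
      rcases x with (_ | _) | ⟨i, j⟩
      · exact absurd rfl hx
      · rcases y with (_ | _) | ⟨i', j'⟩ <;> exact hxy.elim
      -- With the edges at the first hub deleted, the initial segment of path `i` up to position `j`
      -- is left only by the edge in question.
      refine isBridge_of_forall_adj (B := {v | ∃ k : Fin (l + 1), k ≤ j ∧ e v = .inr (i, k)})
        ⟨j, le_rfl, by simp⟩ ?_ ?_
      · rintro ⟨k, hk, h⟩
        rw [Equiv.apply_symm_apply] at h
        subst h
        have h1 : i = i ∧ (j : ℕ) + 1 = k := hxy
        have : (k : ℕ) ≤ j := hk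
        omega
      · intro u v huv hu hv
        obtain ⟨a, rfl⟩ := e.symm.surjective u
        obtain ⟨b, rfl⟩ := e.symm.surjective v
        obtain ⟨⟨ha, hb⟩, hab⟩ := hadj a b huv
        obtain ⟨k, hk, h⟩ := hu
        rw [Equiv.apply_symm_apply] at h
        subst h
        have hk' : (k : ℕ) ≤ j := hk
        have hv' : ∀ k' : Fin (l + 1), b = .inr (i, k') → (j : ℕ) < k' := by
          intro k' h1
          by_contra h2
          exact hv ⟨k', not_lt.1 h2, by rw [Equiv.apply_symm_apply, h1]⟩
        have hj := j.2
        rcases b with (_ | _) | ⟨i', k'⟩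
        · exact absurd rfl hb
        · simp only [thetaStep, or_false] at hab
          rcases y with (_ | _) | ⟨i'', j''⟩
          · exact hxy.elim
          · have : k = j := Fin.ext (by omega)
            rw [this]
          · have h1 : i = i'' ∧ (j : ℕ) + 1 = j'' := hxy
            have := j''.2
            omega
        · simp only [thetaStep] at hab
          have h1 : i' = i := by rcases hab with ⟨h, -⟩ | ⟨h, -⟩ <;> simp [h]
          subst h1
          have h2 := hv' k' rfl
          have h3 : k = j := Fin.ext (by omega)
          subst h3
          rcases y with (_ | _) | ⟨i'', j''⟩
          · exact hxy.elim
          · have h4 : (k : ℕ) = l := hxy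
            have := k'.2
            omega
          · have h4 : i' = i'' ∧ (k : ℕ) + 1 = j'' := hxy
            obtain ⟨rfl, h4⟩ := h4
            have : k' = j'' := Fin.ext (by omega)
            rw [this]
    intro v w hvw
    obtain ⟨a, rfl⟩ := e.symm.surjective v
    obtain ⟨b, rfl⟩ := e.symm.surjective w
    obtain ⟨⟨ha, hb⟩, hab | hab⟩ := hadj a b hvw
    · exact bridge a b ha hab
    · rw [Sym2.eq_swap]
      exact bridge b a hb hab
  refine (feedbackEdgeNumber_le hf hac).trans (Finset.card_image_le.trans ?_)
  simp

end SimpleGraph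

/-! ## No fully-polynomial kernel -/

namespace RAM

theorem Exec.length_outputs_le {p : Prog} {σ σ' : State} {τ : List Event} (h : Exec p σ τ σ') :
    (outputs τ).length ≤ time τ := by
  induction h with
  | emit a l σ => simp [outputs, time]
  | seq _ _ h1 h2 => simp; omega
  | ite_true _ _ h => simp [outputs, time]; omega
  | ite_false _ _ h => simp [outputs, time]; omega
  | loop_true _ _ _ h1 h2 => simp [outputs, time]; omega
  | _ => simp [outputs, time]

end RAM

theorem IsPartitionBy.ncard_le {Y X : Set (List Bool)} {S : List Bool → Set (List Bool)}
    (h : IsPartitionBy Y X S) (hY : Y.Finite) {t : ℕ} (ht : ∀ s ∈ Y, (S s).Finite ∧ (S s).ncard ≤ t) :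
    X.ncard ≤ Y.ncard * t := by
  classical
  obtain ⟨Y, rfl⟩ := hY.exists_finset_coe
  rw [← h.union]
  refine (Finset.set_ncard_biUnion_le Y S).trans ?_
  rw [Set.ncard_coe_finset]
  exact Finset.sum_le_card_nsmul _ _ _ fun s hs => (ht s hs).2

/-- An instance with a fully-polynomial kernel of bounded size has few solutions. -/
theorem IsFullyPolyEnumKernel.ncard_sol_le {P : ParamEnumProblem} {A A' : RAM.Prog}
    {K : List Bool → List Bool} (h : IsFullyPolyEnumKernel P A A' K)
    (hP : ∀ x, ∀ s ∈ P.Sol x, s.length = x.length) :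
    ∃ (p : Polynomial ℕ) (F : ℕ → ℕ), ∀ r x, P.κ x ≤ r →
      (P.Sol x).ncard ≤ 2 ^ F r * p.eval (x.length + F r + r) := by
  obtain ⟨-, f, -, hf⟩ := h.kernelization
  obtain ⟨S, hS, p, hp⟩ := h.lifting
  -- The parameter of `x` is only known to be at most `r`, and `f` need not be monotone, hence the
  -- maximum over all smaller parameters.
  refine ⟨p, fun r => (Finset.range (r + 1)).sup f, fun r x hx => ?_⟩
  set F := (Finset.range (r + 1)).sup f with hF
  have h1 : (K x).length + P.κ (K x) ≤ F :=
    (hf x).trans (Finset.le_sup (f := f) (Finset.mem_range.2 (by omega)))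
  refine ((hS x).ncard_le (P.finite_Sol _) (t := p.eval (x.length + F + r)) fun s hs => ?_).trans
    (Nat.mul_le_mul_right _ ?_)
  · obtain ⟨τ, ⟨σ, h2⟩, h3, h4⟩ := hp x s hs
    rw [← h3]
    have h5 : {w | w ∈ RAM.outputs τ} = ((RAM.outputs τ).toFinset : Set (List Bool)) := by
      ext; simp
    rw [h5, Set.ncard_coe_finset]
    refine ⟨Finset.finite_toSet _, (List.toFinset_card_le _).trans ?_⟩
    refine h2.length_outputs_le.trans (h4.trans (RAM.eval_mono p ?_))
    omega
  · have h2 : P.Sol (K x) ⊆ {s | s.length = (K x).length} := fun s hs => hP _ s hs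
    refine (Set.ncard_le_ncard h2 (List.finite_length_eq _ _)).trans ?_
    have h3 : {s : List Bool | s.length = (K x).length}.ncard = 2 ^ (K x).length := by
      change Nat.card (List.Vector Bool (K x).length) = _
      rw [Nat.card_eq_fintype_card, card_vector, Fintype.card_bool]
    rw [h3]
    exact Nat.pow_le_pow_right two_pos ((Nat.le_add_right _ _).trans h1)

namespace MatchingCutKernel

open SimpleGraph

/-- The number of solutions is not bounded by a polynomial whose degree does not depend on the
parameter. -/
theorem exists_many_solutions (r l : ℕ) : ∃ x : List Bool, enumMinimalMC.κ x ≤ r ∧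
    x.length = (2 + r * (l + 1)) * (2 + r * (l + 1)) ∧ l ^ r ≤ (enumMinimalMC.Sol x).ncard := by
  classical
  have hcard : Fintype.card (Bool ⊕ (Fin r × Fin (l + 1))) = 2 + r * (l + 1) := by simp
  let e : Fin (2 + r * (l + 1)) ≃ Bool ⊕ (Fin r × Fin (l + 1)) :=
    (Fintype.equivFinOfCardEq hcard).symm
  refine ⟨(theta e).encode, ?_, length_encode _, ?_⟩
  · rw [enumMinimalMC_κ]
    exact feedbackEdgeNumber_theta_le e
  · have h1 : (Set.univ : Set (Fin r → Fin l)).ncard = l ^ r := by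
      rw [Set.ncard_univ, Nat.card_eq_fintype_card]
      simp
    rw [← h1]
    refine Set.ncard_le_ncard_of_injOn (fun c => encodeEdges (Set.range (thetaEdge e c)))
      (fun c _ => ?_) (fun c _ d _ h => ?_) (enumMinimalMC.finite_Sol _)
    · rw [sol_encode]
      exact ⟨_, theta_isMinimalMatchingCut e c, rfl⟩
    · exact thetaEdge_injective e (encodeEdges_inj
        (subset_of_isMinimal (theta_isMinimalMatchingCut e c))
        (subset_of_isMinimal (theta_isMinimalMatchingCut e d)) h)

theorem eval_le_mul_pow (p : Polynomial ℕ) {x : ℕ} (hx : 0 < x) :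
    p.eval x ≤ p.eval 1 * x ^ p.natDegree := by
  rw [Polynomial.eval_eq_sum_range, Polynomial.eval_eq_sum_range, Finset.sum_mul]
  refine Finset.sum_le_sum fun i hi => ?_
  rw [one_pow, mul_one]
  exact Nat.mul_le_mul_left _ (Nat.pow_le_pow_right hx (by have := Finset.mem_range.1 hi; omega))

theorem not_isFullyPolyEnumKernel : ¬ ∃ (A A' : RAM.Prog) (K : List Bool → List Bool),
    IsFullyPolyEnumKernel enumMinimalMC A A' K := by
  rintro ⟨A, A', K, h⟩
  obtain ⟨p, F, hF⟩ := h.ncard_sol_le fun x s hs => length_of_mem_sol hs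
  set d := p.natDegree with hd
  -- The instance has length quadratic in `l`, so a polynomial of degree `d` in the length has
  -- degree `2 * d` in `l`; one path more than that is enough.
  set r := 2 * d + 1 with hr
  set B := (2 + 2 * r) * (2 + 2 * r) + F r + r with hB
  set D := 2 ^ F r * (p.eval 1 * B ^ d) with hD
  -- The constant `D` depends on `r` and `p` only, so the paths can be taken longer than `D`;
  -- cancelling `l ^ (2 * d)` then leaves `D + 1 ≤ D`.
  obtain ⟨x, h1, h2, h3⟩ := exists_many_solutions r (D + 1)
  set l := D + 1 with hl
  have h4 := h3.trans (hF r x h1)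
  have h5 : x.length + F r + r ≤ B * (l * l) := by
    have h6 : 2 + r * (l + 1) ≤ (2 + 2 * r) * l := by nlinarith
    have h7 := Nat.mul_le_mul h6 h6
    have h8 : F r + r ≤ (F r + r) * (l * l) := Nat.le_mul_of_pos_right _ (by positivity)
    rw [h2, hB]
    calc _ ≤ ((2 + 2 * r) * l) * ((2 + 2 * r) * l) + (F r + r) * (l * l) := by omega
      _ = _ := by ring
  have h6 : p.eval (x.length + F r + r) ≤ p.eval 1 * (B * (l * l)) ^ d :=
    (RAM.eval_mono p h5).trans (eval_le_mul_pow p (by positivity))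
  have h7 : l ^ r ≤ D * l ^ (2 * d) := by
    refine h4.trans ((Nat.mul_le_mul_left _ h6).trans_eq ?_)
    rw [hD, mul_pow, ← pow_two, ← pow_mul]
    ring
  rw [hr, pow_succ, mul_comm] at h7
  have h8 := Nat.le_of_mul_le_mul_right h7 (by positivity)
  omega

end MatchingCutKernel

theorem theorem5p6 :
    (∃ (A A' : RAM.Prog) (K : List Bool → List Bool),
      IsPolyDelayEnumKernel enumMinimalMC A A' K ∧
      ∃ c : ℕ, ∀ (n : ℕ) (G : SimpleGraph (Fin n)),
        ∃ (m : ℕ) (H : SimpleGraph (Fin m)),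
          K G.encode = H.encode ∧ m ≤ c * (G.feedbackEdgeNumber + 1)) ∧
    ¬ ∃ (A A' : RAM.Prog) (K : List Bool → List Bool),
      IsFullyPolyEnumKernel enumMinimalMC A A' K := by
  exact ⟨⟨_, _, _, MatchingCutKernel.isPolyDelayEnumKernel, 8, fun n G =>
    MatchingCutKernel.exists_kernelOf G⟩, MatchingCutKernel.not_isFullyPolyEnumKernel⟩
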